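/- All graphs are finite and simple. The Euler genus $\widehat g(\Pi)$ of an embedding $\Pi$ (given by a rotation system and a signature) of a graph $G$ with $c$ connected components is $2c-|V(G)|+|E(G)|-|F(G,\Pi)|$, where $F(G,\Pi)$ is the set of faces of $\Pi$ (an isolated vertex contributes one face); the Euler genus $\widehat g(G)$ of $G$ is the minimum of $\widehat g(\Pi)$ over all embeddings $\Pi$ of $G$. Let $\mathcal G_{xy}$ be the class of graphs with two distinct special vertices $x,y$ (terminals), and let $\mathcal G^\circ_{xy}$ consist of those $G\in\mathcal G_{xy}$ with $xy\notin E(G)$. For $G\in\mathcal G_{xy}$ let $G^+$ be obtained from $G$ by adding the edge $xy$ if it is not already present, and put $\widehat g^+(G)=\widehat g(G^+)$. The minor-operations on $G\in\mathcal G_{xy}$ are the deletion of any edge and the contraction of any edge other than $xy$ (multiple edges being replaced by single edges, and a vertex arising from a terminal being that terminal). For $k\ge 0$ let $\mathcal C^\circ_k(\widehat g^+)$ be the class of all $G\in\mathcal G^\circ_{xy}$ such that $\widehat g^+(G)=k+1$ and every minor-operation $\mu$ on $G$ satisfies $\widehat g^+(\mu G)<\widehat g^+(G)$. If $G_1,G_2\in\mathcal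 G_{xy}$ and $V(G_1)\cap V(G_2)=\{x,y\}$, the graph $(V(G_1)\cup V(G_2),\,E(G_1)\cup E(G_2))$ with terminals $x,y$ is the $xy$-sum of $G_1$ and $G_2$. **Theorem.** Let $G$ be the $xy$-sum of connected graphs $G_1,G_2\in\mathcal G^\circ_{xy}$. If $G_1\in\mathcal C^\circ_0(\widehat g^+)$ and $G_2\in\mathcal C^\circ_1(\widehat g^+)$, then $G\in\mathcal C^\circ_2(\widehat g^+)$. Conversely, every 2-connected graph $G\in\mathcal C^\circ_2(\widehat g^+)$ such that $\{x,y\}$ is a 2-vertex-cut of $G$ is the $xy$-sum of connected graphs $G_1,G_2\in\mathcal G^\circ_{xy}$ with $G_1\in\mathcal C^\circ_0(\widehat g^+)$ and $G_2\in\mathcal C^\circ_1(\widehat g^+)$. -/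

import Mathlib

universe u

/-! ### Embeddings of graphs in surfaces and the Euler genus -/

/-- An embedding of a simple graph, given by a rotation system and a signature.
A dart `d` stands for the edge `d.edge` seen from its initial vertex `d.fst`. The permutation `rot`
sends a dart to the next one in the local rotation at the same vertex, and at every vertex it
acts as one cyclic permutation of the incident edges. -/
structure GraphEmbedding {V : Type u} (G : SimpleGraph V) where
  /-- the rotation system -/
  rot : Equiv.Perm G.Dart
  rot_fst : ∀ d, (rot d).fst = d.fst
  rot_cyclic : ∀ d d' : G.Dart, d.fst = d'.fst → rot.SameCycle d d'
  /-- the signature -/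
  sign : G.edgeSet → ℤˣ

namespace GraphEmbedding

variable {V : Type u} {G : SimpleGraph V}

/-- The sign of the edge underlying a dart. -/
def dartSign (P : GraphEmbedding G) (d : G.Dart) : ℤˣ := P.sign ⟨d.edge, d.edge_mem⟩

/-- One step of the face traversal. The triple `(v, e, s)` is encoded as a dart `d` (the edge `e`
traversed from `v = d.fst` to `d.snd`) together with `s`; it is followed by `(v', e', s')` with
`v' = d.snd`, `s' = s * λ(e)` and `e' = π_{v'}^{s'}(e)`. -/
def faceStep (P : GraphEmbedding G) (a : G.Dart × ℤˣ) : G.Dart × ℤˣ :=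
  ((P.rot ^ ((a.2 * P.dartSign a.1 : ℤˣ) : ℤ)) a.1.symm, a.2 * P.dartSign a.1)

/-- The triple traversing the same side of the same edge in the opposite direction. -/
def faceReverse (P : GraphEmbedding G) (a : G.Dart × ℤˣ) : G.Dart × ℤˣ :=
  (a.1.symm, -(a.2 * P.dartSign a.1))

/-- The faces with at least one edge: cyclic sequences of triples closed under the face traversal,
where a sequence and the same sequence traversed backwards are one face. -/
def Face (P : GraphEmbedding G) : Type u :=
  Quot fun a b : G.Dart × ℤˣ => b = P.faceStep a ∨ b = P.faceReverse a

/-- The number of faces; every isolated vertex is a component with one face of length zero. -/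
noncomputable def numFaces (P : GraphEmbedding G) : ℕ :=
  Nat.card P.Face + Nat.card {v : V // G.IsIsolated v}

/-- The Euler genus `2c - |V| + |E| - |F|` of an embedding, where `c` is the number of connected
components of the graph. For connected graphs it is `2 - |V| + |E| - |F|`, and in general it is
the sum of the Euler genera of the embeddings of the components. -/
noncomputable def eulerGenus (P : GraphEmbedding G) : ℤ :=
  2 * (Nat.card G.ConnectedComponent : ℤ) - Nat.card V + Nat.card G.edgeSet - P.numFaces

end GraphEmbedding

/-- The Euler genus of a (finite) graph: the minimum Euler genus of its embeddings. -/
noncomputable def SimpleGraph.eulerGenus {V : Type u} (G : SimpleGraph V) : ℕ :=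
  sInf {n : ℕ | ∃ P : GraphEmbedding G, P.eulerGenus = n}

/-! ### Graphs with terminals -/

/-- A finite simple graph with two distinct terminals `x` and `y`. -/
structure TermGraph : Type (u + 1) where
  /-- the vertex set -/
  V : Type u
  finite : Finite V
  /-- the underlying graph without terminals -/
  graph : SimpleGraph V
  /-- the first terminal -/
  x : V
  /-- the second terminal -/
  y : V
  x_ne_y : x ≠ y

namespace TermGraph

/-- The minor-operations available for `G`: deletion of any edge, and contraction of any edge
other than `xy`. -/
inductive MinorOp (G : TermGraph.{u}) : Type u
  | delete (e : Sym2 G.V) (he : e ∈ G.graph.edgeSet)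
  | contract (e : Sym2 G.V) (he : e ∈ G.graph.edgeSet) (hxy : e ≠ s(G.x, G.y))

/-- The equivalence relation that identifies the two ends of `e`. -/
def contractSetoid {V : Type u} (e : Sym2 V) : Setoid V where
  r a b := a = b ∨ (a ∈ e ∧ b ∈ e)
  iseqv :=
    { refl := fun _ => Or.inl rfl
      symm := by
        rintro a b (h | ⟨h, h'⟩)
        · exact Or.inl h.symm
        · exact Or.inr ⟨h', h⟩
      trans := by
        rintro a b c (rfl | ⟨h, h'⟩) (rfl | ⟨k, k'⟩)
        · exact Or.inl rfl
        · exact Or.inr ⟨k, k'⟩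
        · exact Or.inr ⟨h, h'⟩
        · exact Or.inr ⟨h, k'⟩ }

/-- The graph `G - e`. -/
def deleteEdge (G : TermGraph.{u}) (e : Sym2 G.V) : TermGraph.{u} where
  V := G.V
  finite := G.finite
  graph := G.graph.deleteEdges {e}
  x := G.x
  y := G.y
  x_ne_y := G.x_ne_y

/-- The graph `G / e`, for an edge `e ≠ xy`: the ends of `e` are identified, the loop is dropped,
and parallel edges are replaced by single edges. A vertex resulting from a terminal is a
terminal. -/
def contractEdge (G : TermGraph.{u}) (e : Sym2 G.V) (hxy : e ≠ s(G.x, G.y)) : TermGraph.{u} where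
  V := Quotient (contractSetoid e)
  finite := haveI := G.finite; inferInstance
  graph := G.graph.map (Quotient.mk (contractSetoid e))
  x := Quotient.mk (contractSetoid e) G.x
  y := Quotient.mk (contractSetoid e) G.y
  x_ne_y := by
    intro h
    rcases Quotient.exact h with h | ⟨h, h'⟩
    · exact G.x_ne_y h
    · exact hxy ((Sym2.mem_and_mem_iff G.x_ne_y).1 ⟨h, h'⟩)

/-- The graph obtained from `G` by applying a minor-operation. -/
def applyOp (G : TermGraph.{u}) : G.MinorOp → TermGraph.{u}
  | .delete e _ => G.deleteEdge e
  | .contract e _ hxy => G.contractEdge e hxy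

/-- The graph `G⁺`: the edge `xy` is added if it is not already present. -/
def plus (G : TermGraph.{u}) : SimpleGraph G.V := G.graph ⊔ SimpleGraph.edge G.x G.y

/-- The parameter `ĝ⁺(G) = ĝ(G⁺)`. -/
noncomputable def eulerGenusPlus (G : TermGraph.{u}) : ℕ := G.plus.eulerGenus

/-- `G` is critical for the parameter `P`: every minor-operation decreases `P`. -/
def IsCritical (P : TermGraph.{u} → ℕ) (G : TermGraph.{u}) : Prop :=
  ∀ μ : G.MinorOp, P (G.applyOp μ) < P G

/-- The class `C_k(P)` of `P`-critical graphs `G` with `P(G) = k + 1`. -/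
def criticalClass (P : TermGraph.{u} → ℕ) (k : ℕ) : Set TermGraph.{u} :=
  {G | IsCritical P G ∧ P G = k + 1}

/-- The class of graphs with terminals that do not contain the edge `xy`. -/
def noTerminalEdge : Set TermGraph.{u} := {G | ¬ G.graph.Adj G.x G.y}

/-- The class `C°_k(P)` of those graphs in `C_k(P)` that do not contain the edge `xy`. -/
def criticalClassNoEdge (P : TermGraph.{u} → ℕ) (k : ℕ) : Set TermGraph.{u} :=
  criticalClass P k ∩ noTerminalEdge

/-- `G` is the `xy`-sum of `G₁` and `G₂`: there are copies of `G₁` and `G₂` in `G`, with the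
same terminals as `G`, whose vertex sets cover `V(G)` and meet exactly in `{x, y}`, and `G` is the
union of the two copies. -/
def IsXYSum (G G₁ G₂ : TermGraph.{u}) : Prop :=
  ∃ (f₁ : G₁.V ↪ G.V) (f₂ : G₂.V ↪ G.V),
    f₁ G₁.x = G.x ∧ f₁ G₁.y = G.y ∧ f₂ G₂.x = G.x ∧ f₂ G₂.y = G.y ∧
    Set.range f₁ ∪ Set.range f₂ = Set.univ ∧
    Set.range f₁ ∩ Set.range f₂ = {G.x, G.y} ∧
    G.graph = G₁.graph.map f₁ ⊔ G₂.graph.map f₂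

end TermGraph

/-- A graph is 2-connected if it is connected, has at least three vertices, and has no
cutvertex. -/
def SimpleGraph.IsTwoConnected {V : Type u} (G : SimpleGraph V) : Prop :=
  G.Connected ∧ 3 ≤ Nat.card V ∧ ∀ v : V, (G.induce {v}ᶜ).Connected

/-- `S` is a vertex-cut of the graph: deleting `S` leaves at least two components. -/
def SimpleGraph.IsVertexCut {V : Type u} (G : SimpleGraph V) (S : Set V) : Prop :=
  ¬ (G.induce Sᶜ).Preconnected

/-! The theorem rests on additivity: ĝ⁺ of an `xy`-sum is the sum of the values of its parts
(`TermGraph.IsXYSum.eulerGenusPlus_eq`). Without the edge `xy`, every minor-operation on the sum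
acts in exactly one part and leaves the other unchanged, so the sum is critical if and only if both
parts are, and 3 = 1 + 2. Conversely, the cut {x, y} of a 2-connected graph yields two connected
parts. Both are critical and have an edge, so both have a positive value, and positive values with
sum 3 are 1 and 2.

Additivity of ĝ⁺ is additivity of the Euler genus over amalgamations along an edge
(`SimpleGraph.IsEdgeAmalgam.eulerGenus_eq_add`). An embedding is encoded by three fixed-point-free
involutions on its flags: `a` runs along a side of an edge, `b` changes the side, `w` turns at a
corner. The classes of `a, b` are the edges, those of `b, w` the vertices, those of `a, w` the
faces. Every such system comes from an embedding (`FlagSystem.exists_graphEmbedding`). The Euler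
genus is a number that depends only on the graph, `SimpleGraph.eulerNumber`, minus the number of
faces, and amalgamation costs exactly one in that number. What remains is to control faces under
surgery, and all surgery consists of replacing two pairs of an involution by two others
(`Pairing.swap`), which changes a number of classes by at most one.

For the upper bound, `Pairing.exists_glued` glues embeddings of the parts at `x` and at `y` without
losing a face, so that the two copies of `xy` bound a digon; removing the digon costs one face. For
the lower bound, the edge `xy` of an embedded amalgam is doubled, which gains a face, and
`Pairing.exists_split` cuts at `x` and `y` without losing one. The cutting lemma
`Pairing.exists_separated` is the hard part: an induction on the number of flags reduces it to the
case in which all corners are mixed and all sides run from `x` to `y`, where a direct count of faces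
and vertices suffices. -/

/-! ### Counting classes of equivalence relations -/

namespace Setoid

variable {α : Type*} {β : Type*} {γ : Type*}

/-- The number of classes of an equivalence relation. -/
noncomputable def numClasses (r : Setoid α) : ℕ := Nat.card (Quotient r)

/-- The smallest equivalence relation that relates every point with its image. -/
@[reducible]
def gen (a : α → α) : Setoid α := Relation.EqvGen.setoid fun f g => g = a f

/-- The smallest equivalence relation that relates two given points. -/
@[reducible]
def pair (p q : α) : Setoid α := Relation.EqvGen.setoid fun f g => f = p ∧ g = q

theorem gen_le_iff {a : α → α} {r : Setoid α} : gen a ≤ r ↔ ∀ f, r f (a f) := by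
  refine ⟨fun h f => h (Relation.EqvGen.rel _ _ rfl), fun h => eqvGen_le ?_⟩
  rintro f _ rfl
  exact h f

theorem gen_apply (a : α → α) (f : α) : gen a f (a f) := gen_le_iff.1 le_rfl f

theorem pair_le_iff {p q : α} {r : Setoid α} : pair p q ≤ r ↔ r p q := by
  refine ⟨fun h => h (Relation.EqvGen.rel _ _ ⟨rfl, rfl⟩), fun h => eqvGen_le ?_⟩
  rintro f g ⟨rfl, rfl⟩
  exact h

theorem pair_apply (p q : α) : pair p q p q := pair_le_iff.1 le_rfl

theorem left_apply {r s : Setoid α} {f g : α} (h : r f g) : (r ⊔ s) f g :=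
  (le_sup_left : r ≤ r ⊔ s) h

theorem right_apply {r s : Setoid α} {f g : α} (h : s f g) : (r ⊔ s) f g :=
  (le_sup_right : s ≤ r ⊔ s) h

theorem numClasses_anti [Finite α] {r s : Setoid α} (h : r ≤ s) : s.numClasses ≤ r.numClasses :=
  Nat.card_le_card_of_surjective (map_of_le h) (by
    intro c
    induction c using Quotient.inductionOn with
    | h f => exact ⟨Quotient.mk r f, rfl⟩)

theorem numClasses_lt [Finite α] {r s : Setoid α} (h : r ≤ s) {p q : α} (hs : s p q)
    (hr : ¬ r p q) : s.numClasses + 1 ≤ r.numClasses := by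
  by_contra hlt
  have hcard : Nat.card (Quotient r) = Nat.card (Quotient s) := by
    have := numClasses_anti h
    simp only [numClasses] at *
    omega
  have hsurj : Function.Surjective (map_of_le h) := by
    intro c
    induction c using Quotient.inductionOn with
    | h f => exact ⟨Quotient.mk r f, rfl⟩
  have hb := (Nat.bijective_iff_surjective_and_card (map_of_le h)).2 ⟨hsurj, hcard⟩
  exact hr (Quotient.exact (hb.1 (a₁ := Quotient.mk r p) (a₂ := Quotient.mk r q)
    (Quotient.sound (s := s) hs)))

theorem numClasses_le_sup_pair [Finite α] (r : Setoid α) (p q : α) :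
    r.numClasses ≤ (r ⊔ pair p q).numClasses + 1 := by
  classical
  -- Folding the class of `p` onto that of `q` gives a map that is constant on the classes of the
  -- join. Its image misses at most the class of `p`, which `none` supplies.
  let h : α → Quotient r := fun f => if r f p then Quotient.mk r q else Quotient.mk r f
  have hker : r ⊔ pair p q ≤ ker h := by
    refine sup_le ?_ (pair_le_iff.2 ?_)
    · intro f g hfg
      rw [ker_def]
      by_cases hf : r f p
      · have hg : r g p := r.trans' (r.symm' hfg) hf
        simp [h, hf, hg]
      · have hg : ¬ r g p := fun hg => hf (r.trans' hfg hg)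
        simp only [h, hf, hg, if_false]
        exact Quotient.sound hfg
    · rw [ker_def]
      simp [h]
  let F : Option (Quotient (r ⊔ pair p q)) → Quotient r := fun c =>
    c.elim (Quotient.mk r p) (Quotient.lift h fun _ _ hab => hker hab)
  have hF : Function.Surjective F := by
    intro c
    induction c using Quotient.inductionOn with
    | h f =>
      by_cases hf : r f p
      · exact ⟨none, Quotient.sound (r.symm' hf)⟩
      · exact ⟨some (Quotient.mk _ f), by simp [F, h, hf]⟩
  have := Nat.card_le_card_of_surjective F hF
  rwa [Finite.card_option] at this

theorem numClasses_sup_pair [Finite α] (r : Setoid α) {p q : α} (h : ¬ r p q) :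
    (r ⊔ pair p q).numClasses + 1 = r.numClasses :=
  le_antisymm (numClasses_lt le_sup_left (right_apply (pair_apply p q)) h)
    (numClasses_le_sup_pair r p q)

theorem numClasses_eq_add (r : Setoid α) [Finite β] [Finite γ] {i : β → α} {j : γ → α}
    (hij : ∀ f, (∃ x, i x = f) ∨ ∃ y, j y = f) (hr : ∀ x y, ¬ r (i x) (j y)) :
    r.numClasses = (comap i r).numClasses + (comap j r).numClasses := by
  unfold numClasses
  rw [← Nat.card_sum]
  refine (Nat.card_congr (Equiv.ofBijective (Sum.elim
    (Quotient.map' (s₁ := comap i r) (s₂ := r) i fun _ _ h => h)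
    (Quotient.map' (s₁ := comap j r) (s₂ := r) j fun _ _ h => h)) ⟨?_, ?_⟩)).symm
  · rintro (c | c) (d | d) h <;> induction c using Quotient.inductionOn <;>
      induction d using Quotient.inductionOn
    · exact congrArg Sum.inl (Quotient.sound (s := comap i r) (Quotient.exact h :))
    · exact (hr _ _ (Quotient.exact h)).elim
    · exact (hr _ _ (r.symm' (Quotient.exact h))).elim
    · exact congrArg Sum.inr (Quotient.sound (s := comap j r) (Quotient.exact h :))
  · intro c
    induction c using Quotient.inductionOn with
    | h f =>
      rcases hij f with ⟨x, rfl⟩ | ⟨y, rfl⟩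
      · exact ⟨Sum.inl (Quotient.mk _ x), rfl⟩
      · exact ⟨Sum.inr (Quotient.mk _ y), rfl⟩

theorem numClasses_comap_surjective {i : β → α} (r : Setoid α) (hi : Function.Surjective i) :
    (comap i r).numClasses = r.numClasses := by
  refine Nat.card_congr (Equiv.ofBijective
    (Quotient.map' (s₁ := comap i r) (s₂ := r) i fun _ _ h => h) ⟨?_, ?_⟩)
  · intro c d h
    induction c using Quotient.inductionOn
    induction d using Quotient.inductionOn
    exact Quotient.sound (s := comap i r) (Quotient.exact h :)
  · intro c
    induction c using Quotient.inductionOn with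
    | h f =>
      obtain ⟨x, rfl⟩ := hi f
      exact ⟨Quotient.mk _ x, rfl⟩

theorem numClasses_ker (φ : α → β) : (ker φ).numClasses = Nat.card (Set.range φ) :=
  Nat.card_congr (quotientKerEquivRange φ)

/-- The relation on a larger type that extends an equivalence relation on a part of it, all
remaining points being related. -/
@[reducible]
def extend (i : β → α) (hi : Function.Injective i) (t : Setoid β) : Setoid α where
  r f g := ((∃ x, i x = f) ↔ ∃ x, i x = g) ∧ ∀ x y, i x = f → i y = g → t x y
  iseqv :=
    { refl := fun f => ⟨Iff.rfl, fun x y hx hy => by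
        obtain rfl := hi (hx.trans hy.symm)
        exact t.refl' x⟩
      symm := fun h => ⟨h.1.symm, fun x y hx hy => t.symm' (h.2 y x hy hx)⟩
      trans := by
        rintro f g h h₁ h₂
        refine ⟨h₁.1.trans h₂.1, fun x y hx hy => ?_⟩
        obtain ⟨z, hz⟩ := h₁.1.1 ⟨x, hx⟩
        exact t.trans' (h₁.2 x z hx hz) (h₂.2 z y hz hy) }

theorem gen_le_extend {i : β → α} (hi : Function.Injective i) {t : Setoid β} {a : α → α}
    {a' : β → β} (ha : ∀ f, a (a f) = f) (h : ∀ x, a (i x) = i (a' x)) (ht : gen a' ≤ t) :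
    gen a ≤ extend i hi t := by
  refine gen_le_iff.2 fun f => ⟨⟨?_, ?_⟩, ?_⟩
  · rintro ⟨x, rfl⟩
    exact ⟨a' x, (h x).symm⟩
  · rintro ⟨x, hx⟩
    exact ⟨a' x, by rw [← h, hx, ha]⟩
  · rintro x y rfl hy
    rw [h] at hy
    rw [hi hy]
    exact gen_le_iff.1 ht x

theorem comap_le_of_le_extend {i : β → α} (hi : Function.Injective i) {t : Setoid β}
    {r : Setoid α} (h : r ≤ extend i hi t) : comap i r ≤ t :=
  fun {x y} hxy => (h hxy).2 x y rfl rfl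

theorem gen_le_comap {i : β → α} {r : Setoid α} {a : α → α} {a' : β → β}
    (h : ∀ x, a (i x) = i (a' x)) (hr : gen a ≤ r) : gen a' ≤ comap i r :=
  gen_le_iff.2 fun x => by
    rw [comap_rel, ← h]
    exact gen_le_iff.1 hr _

/-- The range of `i` is closed under both involutions, so a chain between two of its points never
leaves it. For the upper bound, the target relation is extended to the whole type by one extra
class. -/
theorem comap_gen_sup {i : β → α} (hi : Function.Injective i) {a w : α → α} {a' w' : β → β}
    (ha : ∀ f, a (a f) = f) (hw : ∀ f, w (w f) = f)
    (ha' : ∀ x, a (i x) = i (a' x)) (hw' : ∀ x, w (i x) = i (w' x)) :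
    comap i (gen a ⊔ gen w) = gen a' ⊔ gen w' := by
  refine le_antisymm (comap_le_of_le_extend hi (sup_le ?_ ?_)) (sup_le ?_ ?_)
  · exact gen_le_extend hi ha ha' le_sup_left
  · exact gen_le_extend hi hw hw' le_sup_right
  · exact gen_le_comap ha' le_sup_left
  · exact gen_le_comap hw' le_sup_right

theorem comap_gen_sup_sup {i : β → α} (hi : Function.Injective i) {a b w : α → α}
    {a' b' w' : β → β} (ha : ∀ f, a (a f) = f) (hb : ∀ f, b (b f) = f) (hw : ∀ f, w (w f) = f)
    (ha' : ∀ x, a (i x) = i (a' x)) (hb' : ∀ x, b (i x) = i (b' x))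
    (hw' : ∀ x, w (i x) = i (w' x)) :
    comap i (gen a ⊔ gen b ⊔ gen w) = gen a' ⊔ gen b' ⊔ gen w' := by
  refine le_antisymm (comap_le_of_le_extend hi (sup_le (sup_le ?_ ?_) ?_))
    (sup_le (sup_le ?_ ?_) ?_)
  · exact gen_le_extend hi ha ha' (le_sup_left.trans le_sup_left)
  · exact gen_le_extend hi hb hb' (le_sup_right.trans le_sup_left)
  · exact gen_le_extend hi hw hw' le_sup_right
  · exact gen_le_comap ha' (le_sup_left.trans le_sup_left)
  · exact gen_le_comap hb' (le_sup_right.trans le_sup_left)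
  · exact gen_le_comap hw' le_sup_right

/-- Removing a class that consists of two given points. -/
theorem numClasses_eq_compl_pair [Finite α] (r : Setoid α) {p q : α} (hpq : r p q)
    (h : ∀ f, r p f → f = p ∨ f = q) :
    r.numClasses = (comap (Subtype.val : {f // f ≠ p ∧ f ≠ q} → α) r).numClasses + 1 := by
  have hone : (comap (Subtype.val : {f // f = p ∨ f = q} → α) r).numClasses = 1 := by
    refine Nat.card_eq_one_iff_unique.2 ⟨⟨fun c d => ?_⟩, ⟨Quotient.mk _ ⟨p, Or.inl rfl⟩⟩⟩
    induction c using Quotient.inductionOn with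
    | h f =>
    induction d using Quotient.inductionOn with
    | h g =>
    refine Quotient.sound (s := comap _ r) ?_
    change r f.1 g.1
    have key : ∀ f : {f // f = p ∨ f = q}, r p f.1 := by
      rintro ⟨f, rfl | rfl⟩
      exacts [r.refl' _, hpq]
    exact r.trans' (r.symm' (key f)) (key g)
  rw [numClasses_eq_add r (i := (Subtype.val : {f // f ≠ p ∧ f ≠ q} → α))
    (j := (Subtype.val : {f // f = p ∨ f = q} → α)) ?_ ?_, hone]
  · intro f
    by_cases hf : f = p ∨ f = q
    · exact Or.inr ⟨⟨f, hf⟩, rfl⟩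
    · exact Or.inl ⟨⟨f, not_or.1 hf⟩, rfl⟩
  · rintro ⟨f, hfp, hfq⟩ ⟨g, rfl | rfl⟩ hr
    · rcases h f (r.symm' hr) with rfl | rfl
      exacts [hfp rfl, hfq rfl]
    · rcases h f (r.trans' hpq (r.symm' hr)) with rfl | rfl
      exacts [hfp rfl, hfq rfl]

end Setoid

/-! ### Fixed-point-free involutions -/

/-- A fixed-point-free involution, that is, a partition of a type into pairs. -/
@[ext]
structure Pairing (Φ : Type*) where
  /-- the partner of a point -/
  toFun : Φ → Φ
  invol : ∀ f, toFun (toFun f) = f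
  ne : ∀ f, toFun f ≠ f

namespace Pairing

open Setoid

variable {Φ : Type*} {Ψ : Type*} {K : Type*}

instance : CoeFun (Pairing Φ) fun _ => Φ → Φ := ⟨toFun⟩

theorem injective (w : Pairing Φ) : Function.Injective w := fun f g h => by
  rw [← w.invol f, ← w.invol g, h]

theorem eq_comm_iff (w : Pairing Φ) {f g : Φ} : w f = g ↔ f = w g :=
  ⟨fun h => by rw [← h, w.invol], fun h => by rw [h, w.invol]⟩

open Classical in
/-- The pairing in which the pairs of `p` and `q` are replaced by `{p, q}` and the pair of
their partners. -/
noncomputable def swap (w : Pairing Φ) (p q : Φ) : Pairing Φ where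
  toFun f := Equiv.swap (w p) q (w (Equiv.swap (w p) q f))
  invol f := by simp [w.invol]
  ne f h := w.ne (Equiv.swap (w p) q f) (by
    rw [← Equiv.swap_apply_eq_iff]
    exact h)

theorem swap_left (w : Pairing Φ) {p q : Φ} (h : p ≠ q) : w.swap p q p = q := by
  classical
  simp [swap, Equiv.swap_apply_of_ne_of_ne (w.ne p).symm h]

theorem swap_right (w : Pairing Φ) {p q : Φ} (h : p ≠ q) : w.swap p q q = p := by
  rw [eq_comm_iff, swap_left w h]

theorem swap_partner_left (w : Pairing Φ) {p q : Φ} (h : p ≠ q) :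
    w.swap p q (w p) = w q := by
  classical
  simp only [swap, Equiv.swap_apply_left]
  rw [Equiv.swap_apply_of_ne_of_ne (fun e => h (w.injective e).symm) (w.ne q)]

theorem swap_partner_right (w : Pairing Φ) {p q : Φ} (h : p ≠ q) :
    w.swap p q (w q) = w p := by
  rw [eq_comm_iff, swap_partner_left w h]

theorem swap_of_ne (w : Pairing Φ) {p q f : Φ} (h₁ : f ≠ p) (h₂ : f ≠ q) (h₃ : f ≠ w p)
    (h₄ : f ≠ w q) : w.swap p q f = w f := by
  classical
  simp only [swap]
  rw [Equiv.swap_apply_of_ne_of_ne h₃ h₂, Equiv.swap_apply_of_ne_of_ne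
    (fun e => h₁ (w.injective e)) (fun e => h₄ (w.eq_comm_iff.1 e))]

theorem swap_swap (w : Pairing Φ) {p q : Φ} (h : p ≠ q) : (w.swap p q).swap p (w p) = w := by
  classical
  ext f
  change Equiv.swap ((w.swap p q) p) (w p) ((w.swap p q)
    (Equiv.swap ((w.swap p q) p) (w p) f)) = w f
  rw [swap_left w h]
  simp [swap, Equiv.swap_comm q (w p)]

theorem swap_partner (w : Pairing Φ) (p : Φ) : w.swap p (w p) = w := by
  classical
  ext f
  simp [swap]

/-- A property of a swap follows from the properties of the four points concerned. -/
theorem swap_induction (w : Pairing Φ) {p q : Φ} (h : p ≠ q) {P : Φ → Φ → Prop}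
    (hpq : P p q) (hqp : P q p) (hpq' : w p ≠ q → P (w p) (w q)) (hqp' : w p ≠ q → P (w q) (w p))
    (hw : ∀ f, f ≠ p → f ≠ q → f ≠ w p → f ≠ w q → P f (w f)) (f : Φ) : P f (w.swap p q f) := by
  by_cases h₁ : f = p
  · subst h₁; rwa [swap_left w h]
  by_cases h₂ : f = q
  · subst h₂; rwa [swap_right w h]
  by_cases h' : w p = q
  · subst h'
    rw [swap_partner]
    exact hw f h₁ h₂ h₂ (by rwa [w.invol])
  by_cases h₃ : f = w p
  · subst h₃; rw [swap_partner_left w h]; exact hpq' h'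
  by_cases h₄ : f = w q
  · subst h₄; rw [swap_partner_right w h]; exact hqp' h'
  rw [swap_of_ne w h₁ h₂ h₃ h₄]
  exact hw f h₁ h₂ h₃ h₄

theorem swap_preserves (w : Pairing Φ) {p q : Φ} (h : p ≠ q) {φ : Φ → K}
    (hφ : ∀ f, φ (w f) = φ f) (hpq : φ p = φ q) (f : Φ) : φ (w.swap p q f) = φ f :=
  swap_induction w h (P := fun f g => φ g = φ f) hpq.symm hpq
    (fun _ => by rw [hφ, hφ, hpq]) (fun _ => by rw [hφ, hφ, hpq]) (fun f _ _ _ _ => hφ f) f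

theorem rel_partner (w : Pairing Φ) (r : Setoid Φ) (f : Φ) : (r ⊔ gen w) f (w f) :=
  right_apply (gen_apply w f)

theorem gen_swap_le (w : Pairing Φ) {p q : Φ} (h : p ≠ q) {r : Setoid Φ} (hw : gen w ≤ r)
    (hpq : r p q) : gen (w.swap p q) ≤ r := by
  have hw' := gen_le_iff.1 hw
  refine gen_le_iff.2 (swap_induction w h hpq (r.symm' hpq) (fun _ => ?_) (fun _ => ?_)
    fun f _ _ _ _ => hw' f)
  · exact r.trans' (r.symm' (hw' p)) (r.trans' hpq (hw' q))
  · exact r.trans' (r.symm' (hw' q)) (r.trans' (r.symm' hpq) (hw' p))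

theorem sup_gen_swap_le (w : Pairing Φ) {p q : Φ} (h : p ≠ q) (r : Setoid Φ) :
    r ⊔ gen (w.swap p q) ≤ r ⊔ gen w ⊔ pair p q :=
  sup_le (le_sup_left.trans le_sup_left) (gen_swap_le w h (le_sup_right.trans le_sup_left)
    (right_apply (pair_apply p q)))

theorem numClasses_le_swap [Finite Φ] (w : Pairing Φ) {p q : Φ} (h : p ≠ q) (r : Setoid Φ) :
    (r ⊔ gen w).numClasses ≤ (r ⊔ gen (w.swap p q)).numClasses + 1 :=
  (numClasses_le_sup_pair _ p q).trans
    (Nat.add_le_add_right (numClasses_anti (sup_gen_swap_le w h r)) 1)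

theorem numClasses_swap_le [Finite Φ] (w : Pairing Φ) {p q : Φ} (h : p ≠ q) (r : Setoid Φ) :
    (r ⊔ gen (w.swap p q)).numClasses ≤ (r ⊔ gen w).numClasses + 1 := by
  have := numClasses_le_swap (w.swap p q) (w.ne p).symm r
  rwa [swap_swap w h] at this

theorem even_card (w : Pairing Φ) (s : Finset Φ) (h : ∀ f ∈ s, w f ∈ s) : Even s.card := by
  have : ∑ f ∈ s, (1 : ZMod 2) = 0 :=
    Finset.sum_involution (fun f _ => w f) (fun _ _ => by decide) (fun f _ _ => w.ne f)
      (fun f hf => h f hf) (fun f _ => w.invol f)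
  simpa [ZMod.natCast_eq_zero_iff_even] using this

/-- A swap that links two different classes keeps the two pairs linked. -/
theorem swap_rel_partner [Finite Φ] (w a : Pairing Φ) {p q : Φ} {r : Setoid Φ}
    (ha : gen a ≤ r) (hpq : ¬ (r ⊔ gen w) p q) : (r ⊔ gen (w.swap p q)) p (w p) := by
  classical
  have := Fintype.ofFinite Φ
  by_contra hcon
  have hne : p ≠ q := fun e => hpq (e ▸ Setoid.refl' _ _)
  -- `u` is `w` made to fix the four points of the swap, so together with `r` it links nothing that
  -- `w` or the swapped pairing does not link.
  let u : Φ → Φ := fun f => if f = p ∨ f = q ∨ f = w p ∨ f = w q then f else w f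
  have hu₁ : r ⊔ gen u ≤ r ⊔ gen w := by
    refine sup_le le_sup_left (gen_le_iff.2 fun f => ?_)
    by_cases hf : f = p ∨ f = q ∨ f = w p ∨ f = w q
    · simp only [u, if_pos hf]; exact Setoid.refl' _ _
    · simp only [u, if_neg hf]; exact rel_partner w r f
  have hu₂ : r ⊔ gen u ≤ r ⊔ gen (w.swap p q) := by
    refine sup_le le_sup_left (gen_le_iff.2 fun f => ?_)
    by_cases hf : f = p ∨ f = q ∨ f = w p ∨ f = w q
    · simp only [u, if_pos hf]; exact Setoid.refl' _ _
    · simp only [u, if_neg hf]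
      push Not at hf
      rw [← swap_of_ne w hf.1 hf.2.1 hf.2.2.1 hf.2.2.2]
      exact rel_partner _ r f
  -- If the claim failed, the class `C` of `p` would contain none of the other three points. Then
  -- `a` would pair up all of `C` and `w` all of `C` except `p`, against parity.
  let C : Finset Φ := Finset.univ.filter fun f => (r ⊔ gen u) p f
  have hmem : ∀ f, f ∈ C ↔ (r ⊔ gen u) p f := fun f => by simp [C]
  have hpC : p ∈ C := (hmem p).2 (Setoid.refl' _ _)
  have hqC : q ∉ C := fun h => hpq (hu₁ ((hmem q).1 h))
  have hwpC : w p ∉ C := fun h => hcon (hu₂ ((hmem _).1 h))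
  have hwqC : w q ∉ C := fun h => hpq (Setoid.trans' _ (hu₁ ((hmem _).1 h))
    (Setoid.symm' _ (rel_partner w r q)))
  have h₁ : Even C.card := even_card a C fun f hf => (hmem _).2
    (Setoid.trans' _ ((hmem f).1 hf) (left_apply (gen_le_iff.1 ha f)))
  have h₂ : Even (C.erase p).card := by
    refine even_card w _ fun f hf => ?_
    obtain ⟨hfp, hfC⟩ := Finset.mem_erase.1 hf
    refine Finset.mem_erase.2 ⟨fun e => hwpC (w.eq_comm_iff.1 e ▸ hfC), (hmem _).2
      (Setoid.trans' _ ((hmem f).1 hfC) ?_)⟩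
    have hf' : ¬ (f = p ∨ f = q ∨ f = w p ∨ f = w q) := by
      rintro (e | e | e | e)
      · exact hfp e
      · exact hqC (e ▸ hfC)
      · exact hwpC (e ▸ hfC)
      · exact hwqC (e ▸ hfC)
    have hfu : u f = w f := by simp only [u, if_neg hf']
    rw [← hfu]
    exact right_apply (gen_apply u f)
  rw [Finset.card_erase_of_mem hpC] at h₂
  have : 0 < C.card := Finset.card_pos.2 ⟨p, hpC⟩
  rcases h₁ with ⟨m, hm⟩
  rcases h₂ with ⟨k, hk⟩
  omega

theorem swap_comm (w : Pairing Φ) {p q : Φ} (h : p ≠ q) : w.swap p q = w.swap q p := by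
  ext f
  refine (swap_induction w h (P := fun f g => g = w.swap q p f) ?_ ?_ ?_ ?_ ?_ f)
  · rw [swap_right w h.symm]
  · rw [swap_left w h.symm]
  · exact fun _ => (swap_partner_right w h.symm).symm
  · exact fun _ => (swap_partner_left w h.symm).symm
  · intro f h₁ h₂ h₃ h₄
    rw [swap_of_ne w h₂ h₁ h₄ h₃]

/-- A swap that links two different classes merges them. -/
theorem le_swap [Finite Φ] (w a : Pairing Φ) {p q : Φ} {r : Setoid Φ}
    (ha : gen a ≤ r) (hpq : ¬ (r ⊔ gen w) p q) : r ⊔ gen w ≤ r ⊔ gen (w.swap p q) := by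
  have hne : p ≠ q := fun e => hpq (e ▸ Setoid.refl' _ _)
  have hp := swap_rel_partner w a ha hpq
  have hq := swap_rel_partner w a ha fun h => hpq (Setoid.symm' _ h)
  rw [← swap_comm w hne] at hq
  refine sup_le le_sup_left (gen_le_iff.2 fun f => ?_)
  by_cases h₁ : f = p
  · subst h₁; exact hp
  by_cases h₂ : f = q
  · subst h₂; exact hq
  by_cases h₃ : f = w p
  · subst h₃; rw [w.invol]; exact Setoid.symm' _ hp
  by_cases h₄ : f = w q
  · subst h₄; rw [w.invol]; exact Setoid.symm' _ hq
  rw [← swap_of_ne w h₁ h₂ h₃ h₄]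
  exact rel_partner _ r f

theorem swap_rel (w : Pairing Φ) {p q : Φ} (h : p ≠ q) (r : Setoid Φ) :
    (r ⊔ gen (w.swap p q)) p q := by
  have := rel_partner (w.swap p q) r p
  rwa [swap_left w h] at this

theorem numClasses_swap_lt [Finite Φ] (w a : Pairing Φ) {p q : Φ} {r : Setoid Φ}
    (ha : gen a ≤ r) (hpq : ¬ (r ⊔ gen w) p q) :
    (r ⊔ gen (w.swap p q)).numClasses + 1 ≤ (r ⊔ gen w).numClasses :=
  numClasses_lt (le_swap w a ha hpq)
    (swap_rel w (by rintro rfl; exact hpq (Setoid.refl' _ _)) r) hpq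

/-- A swap that separates two points from their former partners splits a class. -/
theorem numClasses_lt_swap [Finite Φ] (w a : Pairing Φ) {p q : Φ} (h : p ≠ q) {r : Setoid Φ}
    (ha : gen a ≤ r) (hp : ¬ (r ⊔ gen (w.swap p q)) p (w p)) :
    (r ⊔ gen w).numClasses + 1 ≤ (r ⊔ gen (w.swap p q)).numClasses := by
  have := numClasses_swap_lt (w.swap p q) a ha hp
  rwa [swap_swap w h] at this

/-- If a set is closed under both pairings, it is a union of classes. -/
theorem mem_of_rel {a w : Pairing Φ} {S : Φ → Prop} (ha : ∀ f, S f → S (a f))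
    (hw : ∀ f, S f → S (w f)) {f g : Φ} (h : (gen a ⊔ gen w) f g) (hf : S f) : S g := by
  have key : gen a ⊔ gen w ≤ ker S :=
    sup_le (gen_le_iff.2 fun f => propext ⟨ha f, fun h => by simpa [a.invol] using ha _ h⟩)
      (gen_le_iff.2 fun f => propext ⟨hw f, fun h => by simpa [w.invol] using hw _ h⟩)
  exact (key h : S f = S g) ▸ hf

/-- If `{p, w p}` is made a pair of `a`, then a class splits off. -/
theorem numClasses_swap_partner [Finite Φ] (a w : Pairing Φ) {p q : Φ} (hw : w p = q)
    (ha : a p ≠ q) :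
    (gen (a.swap p q) ⊔ gen w).numClasses = (gen a ⊔ gen w).numClasses + 1 := by
  have hne : p ≠ q := fun e => w.ne p (hw.trans e.symm)
  rw [sup_comm, sup_comm (gen a)]
  refine le_antisymm (numClasses_swap_le a hne _) (numClasses_lt_swap a w hne le_rfl ?_)
  intro h
  -- After the swap, `{p, q}` is closed under both pairings, but `a p` lies outside it.
  have : a p = p ∨ a p = q := mem_of_rel (S := fun f => f = p ∨ f = q) (a := w)
    (w := a.swap p q) (by
      rintro f (rfl | rfl)
      · exact Or.inr hw
      · rw [← hw, w.invol]; exact Or.inl rfl) (by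
      rintro f (rfl | rfl)
      · exact Or.inr (swap_left a hne)
      · exact Or.inl (swap_right a hne)) h (Or.inl rfl)
  rcases this with h | h
  · exact a.ne p h
  · exact ha h

/-- The restriction of a pairing to a union of pairs. -/
def restrict (w : Pairing Φ) (S : Φ → Prop) (h : ∀ f, S f → S (w f)) : Pairing {f // S f} where
  toFun f := ⟨w f.1, h f.1 f.2⟩
  invol f := Subtype.ext (w.invol f.1)
  ne f e := w.ne f.1 (congrArg Subtype.val e)

open Classical in
/-- The pairing that agrees with a given one on a union of pairs of `w`, and with `w`
elsewhere. -/
noncomputable def patch (w : Pairing Φ) (S : Φ → Prop) (h : ∀ f, S f → S (w f))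
    (u : Pairing {f // S f}) : Pairing Φ where
  toFun f := if hf : S f then (u ⟨f, hf⟩).1 else w f
  invol f := by
    by_cases hf : S f
    · have := (u ⟨f, hf⟩).2
      simp [hf, this, u.invol]
    · have : ¬ S (w f) := fun h' => hf (by simpa [w.invol] using h _ h')
      simp [hf, this, w.invol]
  ne f := by
    by_cases hf : S f
    · simp only [hf, dif_pos]
      exact fun e => u.ne ⟨f, hf⟩ (Subtype.ext e)
    · simp only [hf, dif_neg, not_false_eq_true]
      exact w.ne f

theorem patch_pos (w : Pairing Φ) (S : Φ → Prop) (h : ∀ f, S f → S (w f))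
    (u : Pairing {f // S f}) (f : {f // S f}) : w.patch S h u f.1 = (u f).1 := by
  simp [patch, f.2]

theorem patch_neg (w : Pairing Φ) (S : Φ → Prop) (h : ∀ f, S f → S (w f))
    (u : Pairing {f // S f}) {f : Φ} (hf : ¬ S f) : w.patch S h u f = w f := by
  simp [patch, hf]

theorem ne_and_ne_closed (w : Pairing Φ) {p q : Φ} (h : w p = q) (f : Φ) (hf : f ≠ p ∧ f ≠ q) :
    w f ≠ p ∧ w f ≠ q :=
  ⟨fun e => hf.2 ((w.eq_comm_iff.1 e).trans h), fun e => hf.1 (w.injective (e.trans h.symm))⟩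

theorem eq_or_eq_of_rel {a w : Pairing Φ} {p q : Φ} (ha : a p = q) (hw : w p = q) {f : Φ}
    (h : (gen a ⊔ gen w) p f) : f = p ∨ f = q :=
  mem_of_rel (S := fun f => f = p ∨ f = q) (by
      rintro f (rfl | rfl)
      · exact Or.inr ha
      · rw [← ha, a.invol]; exact Or.inl rfl) (by
      rintro f (rfl | rfl)
      · exact Or.inr hw
      · rw [← hw, w.invol]; exact Or.inl rfl) h (Or.inl rfl)

/-- Removing a common pair of two pairings. -/
theorem numClasses_restrict_compl_pair [Finite Φ] (a w : Pairing Φ) {p q : Φ} (ha : a p = q)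
    (hw : w p = q) : (gen a ⊔ gen w).numClasses =
      (gen (a.restrict _ (a.ne_and_ne_closed ha)) ⊔
        gen (w.restrict _ (w.ne_and_ne_closed hw))).numClasses + 1 := by
  rw [numClasses_eq_compl_pair _ (p := p) (q := q) (hw ▸ rel_partner w _ p)
    fun f => eq_or_eq_of_rel ha hw]
  rw [comap_gen_sup Subtype.val_injective a.invol w.invol
    (a' := a.restrict _ (a.ne_and_ne_closed ha))
    (w' := w.restrict _ (w.ne_and_ne_closed hw)) (fun _ => rfl) fun _ => rfl]

end Pairing

namespace Pairing

open Setoid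

variable {Φ : Type u} {K : Type*} {L : Type*}

/-! ### Euler's inequality -/

/-- The swap can only make Euler's inequality harder, which drives its induction. Splitting off `{p,
q}` gains a class of `a, w`. If `p` and `a p` stay linked through `b`, no component is gained and at
most one class of `a, b` is lost. Otherwise a class of `a, b` is gained as well, and the two gains
pay for at most one new component. -/
theorem numClasses_sup_swap_le [Finite Φ] (a b w : Pairing Φ) {p q : Φ} (hw : w p = q) :
    (gen a ⊔ gen b).numClasses + (gen a ⊔ gen w).numClasses +
        2 * (gen (a.swap p q) ⊔ gen b ⊔ gen w).numClasses ≤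
      (gen (a.swap p q) ⊔ gen b).numClasses + (gen (a.swap p q) ⊔ gen w).numClasses +
        2 * (gen a ⊔ gen b ⊔ gen w).numClasses := by
  by_cases ha : a p = q
  · subst ha
    rw [swap_partner]
  have hne : p ≠ q := fun e => w.ne p (hw.trans e.symm)
  have h₁ := numClasses_swap_partner a w hw ha
  have hcomm : ∀ a : Pairing Φ, gen a ⊔ gen b ⊔ gen w = gen b ⊔ gen w ⊔ gen a := fun a => by
    rw [sup_assoc, sup_comm]
  rw [hcomm, hcomm]
  have h₂ := numClasses_swap_le a hne (gen b ⊔ gen w)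
  have h₃ := numClasses_le_swap a hne (gen b)
  by_cases hp : (gen b ⊔ gen (a.swap p q)) p (a p)
  · have h₄ : gen b ⊔ gen w ⊔ gen a ≤ gen b ⊔ gen w ⊔ gen (a.swap p q) := by
      refine sup_le le_sup_left ?_
      have hle : gen b ⊔ gen (a.swap p q) ≤ gen b ⊔ gen w ⊔ gen (a.swap p q) :=
        sup_le_sup_right le_sup_left _
      have := gen_swap_le (a.swap p q) (a.ne p).symm
        (r := gen b ⊔ gen w ⊔ gen (a.swap p q)) le_sup_right (hle hp)
      rwa [swap_swap a hne] at this
    have := numClasses_anti h₄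
    rw [sup_comm (gen a) (gen b), sup_comm (gen (a.swap p q)) (gen b)]
    omega
  · have h₄ := numClasses_lt_swap a b hne le_rfl hp
    rw [sup_comm (gen a) (gen b), sup_comm (gen (a.swap p q)) (gen b)]
    omega

theorem card_subtype_ne_and_ne [Finite Φ] {p q : Φ} (h : p ≠ q) :
    Nat.card {f // f ≠ p ∧ f ≠ q} + 2 = Nat.card Φ := by
  classical
  have := Fintype.ofFinite Φ
  have h₁ : Nat.card {f // f ≠ p ∧ f ≠ q} = (({p, q} : Finset Φ)ᶜ).card := by
    rw [Nat.card_eq_fintype_card, Fintype.card_subtype]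
    congr 1
    ext f
    simp
  rw [h₁, Finset.card_compl, Finset.card_pair h, Nat.card_eq_fintype_card]
  have : 2 ≤ Fintype.card Φ := by
    rw [← Finset.card_pair h]
    exact Finset.card_le_univ _
  omega

theorem numClasses_of_isEmpty [IsEmpty Φ] (r : Setoid Φ) : r.numClasses = 0 := by
  have : IsEmpty (Quotient r) := ⟨fun c => c.inductionOn fun f => isEmptyElim f⟩
  exact Nat.card_of_isEmpty

theorem gen_le_ker_pair {a : Pairing Φ} {p q : Φ} (ha : a p = q) :
    gen a ≤ ker fun f => f = p ∨ f = q := by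
  refine gen_le_iff.2 fun f => ?_
  rw [ker_def]
  by_cases h : f ≠ p ∧ f ≠ q
  · simp [h, a.ne_and_ne_closed ha f h]
  · have : a f = p ∨ a f = q := by
      rcases not_and_or.1 h with h | h <;> rw [not_not] at h <;> subst h
      exacts [Or.inr ha, Or.inl (by rw [← ha, a.invol])]
    simpa [this, or_iff_not_and_not] using h

/-- Euler's inequality for three pairings. -/
theorem euler_inequality (n : ℕ) : ∀ (Φ : Type u) [Finite Φ] (a b w : Pairing Φ), Nat.card Φ = n →
    2 * ((gen a ⊔ gen b).numClasses + (gen a ⊔ gen w).numClasses + (gen b ⊔ gen w).numClasses) ≤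
      n + 4 * (gen a ⊔ gen b ⊔ gen w).numClasses := by
  induction n using Nat.strong_induction_on with
  | _ n ih =>
  intro Φ _ a b w hn
  rcases isEmpty_or_nonempty Φ with hΦ | ⟨⟨p⟩⟩
  · simp [numClasses_of_isEmpty]
  -- A pair common to all three pairings is a class of each of the joins. Removing it lowers the
  -- left side by 6 and the right side by 2 + 4.
  have key : ∀ a b : Pairing Φ, a p = w p → b p = w p →
      2 * ((gen a ⊔ gen b).numClasses + (gen a ⊔ gen w).numClasses +
        (gen b ⊔ gen w).numClasses) ≤ n + 4 * (gen a ⊔ gen b ⊔ gen w).numClasses := by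
    intro a b ha hb
    have hcard := card_subtype_ne_and_ne (w.ne p).symm
    have h := ih _ (by omega) {f // f ≠ p ∧ f ≠ w p} (a.restrict _ (a.ne_and_ne_closed ha))
      (b.restrict _ (b.ne_and_ne_closed hb)) (w.restrict _ (w.ne_and_ne_closed rfl)) rfl
    have h₁ := numClasses_restrict_compl_pair a w ha rfl
    have h₂ := numClasses_restrict_compl_pair b w hb rfl
    have h₃ := numClasses_restrict_compl_pair a b ha hb
    have h₄ : (gen a ⊔ gen b ⊔ gen w).numClasses = _ + 1 :=
      numClasses_eq_compl_pair _ (p := p) (q := w p) (rel_partner w _ p) fun f hf => by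
        have hle : gen a ⊔ gen b ⊔ gen w ≤ ker fun f => f = p ∨ f = w p :=
          sup_le (sup_le (gen_le_ker_pair ha) (gen_le_ker_pair hb)) (gen_le_ker_pair rfl)
        have := hle hf
        rw [ker_def] at this
        exact this ▸ Or.inl rfl
    rw [comap_gen_sup_sup Subtype.val_injective a.invol b.invol w.invol
      (a' := a.restrict _ (a.ne_and_ne_closed ha)) (b' := b.restrict _ (b.ne_and_ne_closed hb))
      (w' := w.restrict _ (w.ne_and_ne_closed rfl)) (fun _ => rfl) (fun _ => rfl)
      fun _ => rfl] at h₄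
    omega
  -- Swapping in `a` and then in `b` makes `{p, w p}` a common pair.
  have h₁ := numClasses_sup_swap_le a b w (p := p) rfl
  have h₂ := numClasses_sup_swap_le b (a.swap p (w p)) w (p := p) rfl
  have h₃ := key (a.swap p (w p)) (b.swap p (w p)) (swap_left _ (w.ne p).symm)
    (swap_left _ (w.ne p).symm)
  rw [sup_comm (gen b) (gen (a.swap p (w p))),
    sup_comm (gen (b.swap p (w p))) (gen (a.swap p (w p)))] at h₂
  omega

/-! ### A pairing that connects prescribed parts in two ways -/

/-- `Q` is built pair by pair. Two points of one part that are partners neither in `X` nor in `Y`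
become a pair of `Q` and are spliced out of `X` and `Y` by a swap. This is possible until every part
is one common pair of `X` and `Y`, which then serves as a pair of `Q`. -/
theorem exists_connecting_pairing (n : ℕ) : ∀ (Φ : Type u) [Finite Φ] (X Y : Pairing Φ) (τ : Φ → K),
    Nat.card Φ = n → (∀ f, τ (X f) = τ f) → (∀ f, τ (Y f) = τ f) →
    ∃ Q : Pairing Φ, (∀ f, τ (Q f) = τ f) ∧ ∀ f g, τ f = τ g →
      (gen X ⊔ gen Q) f g ∧ (gen Y ⊔ gen Q) f g := by
  induction n using Nat.strong_induction_on with
  | _ n ih =>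
  intro Φ _ X Y τ hn hX hY
  by_cases hcl : ∀ f g, τ f = τ g → g = f ∨ g = X f ∨ g = Y f
  · have hXY : ∀ f, Y f = X f := fun f => by
      rcases hcl f (X (Y f)) (by rw [hX, hY]) with h | h | h
      · exact (X.eq_comm_iff.1 h)
      · exact (Y.ne f (X.injective h)).elim
      · exact (X.ne _ h).elim
    have hYX : Y = X := Pairing.ext (funext hXY)
    subst hYX
    refine ⟨Y, hY, fun f g hfg => ?_⟩
    rcases hcl f g hfg with rfl | rfl | rfl
    · exact ⟨Setoid.refl' _ _, Setoid.refl' _ _⟩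
    · exact ⟨rel_partner _ _ _, rel_partner _ _ _⟩
    · exact ⟨rel_partner _ _ _, rel_partner _ _ _⟩
  push Not at hcl
  obtain ⟨p, q, hpq, hqp, hqX, hqY⟩ := hcl
  have hcard := card_subtype_ne_and_ne hqp.symm
  have hX' := swap_left X hqp.symm
  have hY' := swap_left Y hqp.symm
  obtain ⟨Q, hQ, hQ'⟩ := ih _ (by omega) {f // f ≠ p ∧ f ≠ q}
    ((X.swap p q).restrict _ ((X.swap p q).ne_and_ne_closed hX'))
    ((Y.swap p q).restrict _ ((Y.swap p q).ne_and_ne_closed hY')) (fun f => τ f.1) rfl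
    (fun f => swap_preserves X hqp.symm hX hpq f.1) (fun f => swap_preserves Y hqp.symm hY hpq f.1)
  let R := (X.swap p q).patch _ ((X.swap p q).ne_and_ne_closed hX') Q
  have hRp : R p = q := by
    rw [← hX']
    exact patch_neg _ _ _ _ (by simp)
  have hRS : ∀ f : {f // f ≠ p ∧ f ≠ q}, R f.1 = (Q f).1 := fun f => patch_pos _ _ _ _ f
  have key : ∀ X : Pairing Φ, q ≠ X p → (∀ f, τ (X f) = τ f) → ∀ hX' : X.swap p q p = q,
      (∀ f g : {f // f ≠ p ∧ f ≠ q}, τ f.1 = τ g.1 →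
        (gen ((X.swap p q).restrict _ ((X.swap p q).ne_and_ne_closed hX')) ⊔ gen Q) f g) →
      ∀ f g, τ f = τ g → (gen X ⊔ gen R) f g := by
    intro X hqX hX hX' hQ f g hfg
    have hpqR : (gen X ⊔ gen R) p q := hRp ▸ rel_partner R _ p
    have hle : gen (X.swap p q) ⊔ gen R ≤ gen X ⊔ gen R :=
      sup_le (gen_swap_le X hqp.symm le_sup_left hpqR) le_sup_right
    have hsub : ∀ f g : {f // f ≠ p ∧ f ≠ q}, τ f.1 = τ g.1 → (gen X ⊔ gen R) f.1 g.1 := by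
      intro f g hfg
      have hle' : gen ((X.swap p q).restrict _ ((X.swap p q).ne_and_ne_closed hX')) ⊔ gen Q ≤
          comap Subtype.val (gen X ⊔ gen R) := by
        refine sup_le (gen_le_iff.2 fun f => ?_) (gen_le_iff.2 fun f => ?_)
        · exact hle (left_apply (gen_apply (X.swap p q) f.1))
        · rw [comap_rel, ← hRS]
          exact rel_partner R _ f.1
      exact hle' (hQ f g hfg)
    -- The partners of `p` and `q` in `X` are not removed, so each point is linked to a remaining
    -- one.
    have hto : ∀ f, ∃ f' : {f // f ≠ p ∧ f ≠ q}, τ f'.1 = τ f ∧ (gen X ⊔ gen R) f f'.1 := by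
      intro f
      by_cases hf : f ≠ p ∧ f ≠ q
      · exact ⟨⟨f, hf⟩, rfl, Setoid.refl' _ _⟩
      refine ⟨⟨X f, ?_⟩, hX f, left_apply (gen_apply X f)⟩
      rcases not_and_or.1 hf with h | h <;> rw [not_not] at h <;> subst h
      · exact ⟨X.ne _, hqX.symm⟩
      · exact ⟨fun e => hqX (X.eq_comm_iff.1 e), X.ne _⟩
    obtain ⟨f', hf', hff'⟩ := hto f
    obtain ⟨g', hg', hgg'⟩ := hto g
    exact Setoid.trans' _ hff' (Setoid.trans' _ (hsub f' g' (by rw [hf', hg', hfg]))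
      (Setoid.symm' _ hgg'))
  refine ⟨R, fun f => ?_, fun f g hfg => ⟨?_, ?_⟩⟩
  · by_cases hf : f ≠ p ∧ f ≠ q
    · rw [hRS ⟨f, hf⟩]
      exact hQ ⟨f, hf⟩
    · rw [show R f = X.swap p q f from patch_neg _ _ _ _ hf]
      exact swap_preserves X hqp.symm hX hpq f
  · exact key X hqX hX hX' (fun f g h => (hQ' f g h).1) f g hfg
  · exact key Y hqY hY hY' (fun f g h => (hQ' f g h).2) f g hfg

end Pairing

namespace Pairing

open Setoid

variable {Φ : Type u} {K : Type*} {L : Type*}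

/-! ### Separating two parts that meet in two vertices -/

theorem numClasses_le_card [Finite Φ] [Finite K] {r : Setoid Φ} {φ : Φ → K}
    (h : ∀ f g, φ f = φ g → r f g) : r.numClasses ≤ Nat.card K := by
  have h₁ : r.numClasses ≤ (ker φ).numClasses := numClasses_anti fun {f g} hfg => h f g hfg
  rw [numClasses_ker] at h₁
  exact h₁.trans (Nat.card_le_card_of_injective _ Subtype.val_injective)

theorem card_le_numClasses [Finite Φ] {r : Setoid Φ} {φ : Φ → K} (h : r ≤ ker φ)
    (hφ : Function.Surjective φ) : Nat.card K ≤ r.numClasses := by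
  have h₁ := numClasses_anti h
  rwa [numClasses_ker, hφ.range_eq, Nat.card_congr (Equiv.Set.univ K)] at h₁

theorem card_eq_sum_classes [Finite Φ] (r : Setoid Φ) :
    ∃ s : Quotient r → ℕ, (∀ f, s (Quotient.mk r f) = Nat.card {g // r f g}) ∧
      ∃ _ : Fintype (Quotient r), Nat.card Φ = ∑ c, s c := by
  classical
  have := Fintype.ofFinite Φ
  have := Fintype.ofFinite (Quotient r)
  refine ⟨fun c => Nat.card {g // Quotient.mk r g = c}, fun f => ?_, inferInstance, ?_⟩
  · refine Nat.card_congr (Equiv.subtypeEquivRight fun g => ?_)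
    exact ⟨fun h => r.symm' (Quotient.exact h), fun h => Quotient.sound (s := r) (r.symm' h)⟩
  · rw [← Nat.card_sigma]
    exact (Nat.card_congr (Equiv.sigmaFiberEquiv (Quotient.mk r))).symm

theorem mul_numClasses_le [Finite Φ] {r : Setoid Φ} {k : ℕ}
    (h : ∀ f, k ≤ Nat.card {g // r f g}) : k * r.numClasses ≤ Nat.card Φ := by
  obtain ⟨s, hs, hfin, hsum⟩ := card_eq_sum_classes r
  rw [hsum, numClasses, Nat.card_eq_fintype_card, mul_comm, ← smul_eq_mul]
  refine Finset.card_nsmul_le_sum _ _ _ fun c _ => ?_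
  induction c using Quotient.inductionOn with
  | h f => rw [hs]; exact h f

theorem card_le_mul_numClasses [Finite Φ] {r : Setoid Φ} {k : ℕ}
    (h : ∀ f, Nat.card {g // r f g} ≤ k) : Nat.card Φ ≤ k * r.numClasses := by
  obtain ⟨s, hs, hfin, hsum⟩ := card_eq_sum_classes r
  rw [hsum, numClasses, Nat.card_eq_fintype_card, mul_comm, ← smul_eq_mul]
  refine Finset.sum_le_card_nsmul _ _ _ fun c _ => ?_
  induction c using Quotient.inductionOn with
  | h f => rw [hs]; exact h f

/-- Since `a` preserves `τ` and `v` changes it, `f`, `a f`, `v f` and `a (v f)` are four distinct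
points of one class. -/
theorem four_mul_numClasses_le [Finite Φ] {a v : Pairing Φ} {τ : Φ → Bool}
    (ha : ∀ f, τ (a f) = τ f) (hv : ∀ f, τ (v f) ≠ τ f) :
    4 * (gen a ⊔ gen v).numClasses ≤ Nat.card Φ := by
  classical
  refine mul_numClasses_le fun f => ?_
  have h₁ : (gen a ⊔ gen v) f (a f) := left_apply (gen_apply a f)
  have h₂ : (gen a ⊔ gen v) f (v f) := rel_partner v _ f
  have h₃ : (gen a ⊔ gen v) f (a (v f)) := Setoid.trans' _ h₂ (left_apply (gen_apply a _))
  have hsub : (({f, a f, v f, a (v f)} : Finset Φ) : Set Φ) ⊆ {g | (gen a ⊔ gen v) f g} := by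
    intro g hg
    simp only [Finset.coe_insert, Finset.coe_singleton, Set.mem_insert_iff,
      Set.mem_singleton_iff] at hg
    rcases hg with h | h | h | h <;> subst h
    exacts [Setoid.refl' (gen a ⊔ gen v) _, h₁, h₂, h₃]
  have hcard : ({f, a f, v f, a (v f)} : Finset Φ).card = 4 := by
    have e₁ : f ≠ v f := (v.ne f).symm
    have e₂ : f ≠ a (v f) := fun e => hv f (by rw [← ha, ← e])
    have e₃ : a f ≠ v f := fun e => hv f (by rw [← e, ha])
    have e₄ : a f ≠ a (v f) := fun e => v.ne f (a.injective e).symm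
    rw [Finset.card_insert_of_notMem, Finset.card_insert_of_notMem, Finset.card_pair]
    · exact (a.ne _).symm
    · simp [e₃, e₄]
    · simp [e₁, e₂, (a.ne f).symm]
  have := Set.ncard_le_ncard hsub (Set.toFinite _)
  rwa [Set.ncard_coe_finset, hcard] at this

/-- Two commuting involutions have orbits of at most four points. -/
theorem card_le_four_mul_numClasses [Finite Φ] {a w : Pairing Φ} (h : ∀ f, w (a f) = a (w f)) :
    Nat.card Φ ≤ 4 * (gen a ⊔ gen w).numClasses := by
  classical
  refine card_le_mul_numClasses fun f => ?_
  have hsub : {g | (gen a ⊔ gen w) f g} ⊆ (({f, a f, w f, a (w f)} : Finset Φ) : Set Φ) := by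
    intro g hg
    refine mem_of_rel (S := fun g => g ∈ (({f, a f, w f, a (w f)} : Finset Φ) : Set Φ)) ?_ ?_ hg
      (by simp)
    · intro g hg
      simp only [Finset.coe_insert, Finset.coe_singleton, Set.mem_insert_iff,
        Set.mem_singleton_iff] at hg ⊢
      rcases hg with rfl | rfl | rfl | rfl <;> simp [a.invol]
    · intro g hg
      simp only [Finset.coe_insert, Finset.coe_singleton, Set.mem_insert_iff,
        Set.mem_singleton_iff] at hg ⊢
      rcases hg with rfl | rfl | rfl | rfl <;> simp [h, w.invol]
  have := Set.ncard_le_ncard hsub (Set.toFinite _)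
  rw [Set.ncard_coe_finset] at this
  exact this.trans Finset.card_le_four

/-- The final case of `exists_separated`: all pairs of `v` join the two parts, and all pairs of
`a` join the two vertices. -/
theorem exists_separated_of_mixed [Finite Φ] {a b v : Pairing Φ} {τ : Φ → Bool} {ℓ : Φ → L}
    {x y : L} (haτ : ∀ f, τ (a f) = τ f) (hbτ : ∀ f, τ (b f) = τ f) (hbℓ : ∀ f, ℓ (b f) = ℓ f)
    (hvℓ : ∀ f, ℓ (v f) = ℓ f) (hxy : ∀ f, ℓ f = x ∨ ℓ f = y) (hv : ∀ f, τ (v f) ≠ τ f)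
    (ha : ∀ f, ℓ (a f) ≠ ℓ f) :
    ∃ w : Pairing Φ, (∀ f, τ (w f) = τ f) ∧ (∀ f, ℓ (w f) = ℓ f) ∧
      (gen b ⊔ gen w).numClasses + (gen a ⊔ gen v).numClasses ≤
        (gen a ⊔ gen w).numClasses + (gen b ⊔ gen v).numClasses + 2 := by
  classical
  rcases isEmpty_or_nonempty Φ with hΦ | ⟨⟨f₀⟩⟩
  · exact ⟨v, isEmptyElim, isEmptyElim, by simp [numClasses_of_isEmpty]⟩
  have hax : ∀ f, ℓ (a f) = x ↔ ℓ f ≠ x := fun f => by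
    have h₁ := ha f
    rcases hxy f with h | h <;> rcases hxy (a f) with h' | h' <;> rw [h, h'] at h₁ ⊢ <;>
      first | exact (h₁ rfl).elim | simp [h₁, h₁.symm]
  have hyx : ∀ f g, ℓ f ≠ x → ℓ g ≠ x → ℓ f = ℓ g := fun f g hf hg =>
    ((hxy f).resolve_left hf).trans ((hxy g).resolve_left hg).symm
  -- `X` is `b` at the vertex `x`; `Y` is `b` at the other vertex, carried over to `x` by `a`.
  let X : Pairing {f // ℓ f = x} := b.restrict _ fun f hf => (hbℓ f).trans hf
  let Y : Pairing {f // ℓ f = x} :=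
    { toFun := fun f => ⟨a (b (a f.1)), (hax _).2 (by rw [hbℓ]; exact fun h => (hax _).1 h f.2)⟩
      invol := fun f => Subtype.ext (by simp [a.invol, b.invol])
      ne := fun f e => by
        have := congrArg Subtype.val e
        rw [a.eq_comm_iff] at this
        exact b.ne _ this }
  obtain ⟨Q, hQτ, hQ⟩ := exists_connecting_pairing _ {f // ℓ f = x} X Y (fun f => τ f.1) rfl
    (fun f => hbτ f.1) (fun f => by
      change τ (a (b (a f.1))) = τ f.1
      rw [haτ, hbτ, haτ])
  have hax' : ∀ f, ¬ ℓ f = x → ℓ (a f) = x := fun f => (hax f).2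
  -- `w` is `Q` at `x` and its conjugate by `a` at the other vertex. Thus it commutes with `a`,
  -- which keeps the faces short, while `Q` connects each part at both vertices.
  let w : Pairing Φ :=
    { toFun := fun f => if h : ℓ f = x then (Q ⟨f, h⟩).1 else a (Q ⟨a f, hax' f h⟩).1
      invol := fun f => by
        by_cases h : ℓ f = x
        · simp [h, (Q ⟨f, h⟩).2, Q.invol]
        · have h₁ : ¬ ℓ (a (Q ⟨a f, hax' f h⟩).1) = x := fun e => (hax _).1 e (Q _).2
          simp [h, h₁, a.invol, Q.invol]
      ne := fun f => by
        by_cases h : ℓ f = x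
        · simp only [h, dif_pos]
          exact fun e => Q.ne _ (Subtype.ext e)
        · simp only [h, dif_neg, not_false_eq_true]
          exact fun e => Q.ne ⟨a f, hax' f h⟩ (Subtype.ext (a.eq_comm_iff.1 e)) }
  have hwx : ∀ f : {f // ℓ f = x}, w f.1 = (Q f).1 := fun f => by
    change dite _ _ _ = _
    rw [dif_pos f.2]
  have hwy : ∀ f (h : ¬ ℓ f = x), w f = a (Q ⟨a f, hax' f h⟩).1 := fun f h => by
    change dite _ _ _ = _
    rw [dif_neg h]
  have hwa : ∀ f, w (a f) = a (w f) := fun f => by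
    by_cases h : ℓ f = x
    · rw [hwx ⟨f, h⟩, hwy _ fun e => (hax f).1 e h]
      simp [a.invol]
    · rw [hwy f h, a.invol, hwx ⟨a f, hax' f h⟩]
  have hwτ : ∀ f, τ (w f) = τ f := fun f => by
    by_cases h : ℓ f = x
    · rw [hwx ⟨f, h⟩]; exact hQτ ⟨f, h⟩
    · rw [hwy f h, haτ]; exact (hQτ ⟨a f, hax' f h⟩).trans (haτ f)
  have hwℓ : ∀ f, ℓ (w f) = ℓ f := fun f => by
    by_cases h : ℓ f = x
    · rw [hwx ⟨f, h⟩, h]; exact (Q ⟨f, h⟩).2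
    · rw [hwy f h]
      exact hyx _ _ (fun e => (hax _).1 e (Q ⟨a f, hax' f h⟩).2) h
  refine ⟨w, hwτ, hwℓ, ?_⟩
  have h₁ : (gen b ⊔ gen w).numClasses ≤ 4 := by
    have := numClasses_le_card (r := gen b ⊔ gen w) (φ := fun f => (τ f, decide (ℓ f = x))) ?_
    · simpa using this
    have hQX : gen X ⊔ gen Q ≤ comap Subtype.val (gen b ⊔ gen w) := by
      refine sup_le (gen_le_iff.2 fun f => left_apply (gen_apply b f.1)) (gen_le_iff.2 fun f => ?_)
      rw [comap_rel, ← hwx]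
      exact rel_partner w _ f.1
    have hQY : gen Y ⊔ gen Q ≤ comap (fun f : {f // ℓ f = x} => a f.1) (gen b ⊔ gen w) := by
      refine sup_le (gen_le_iff.2 fun f => ?_) (gen_le_iff.2 fun f => ?_)
      · rw [comap_rel]
        change (gen b ⊔ gen w) (a f.1) (a (a (b (a f.1))))
        rw [a.invol]
        exact left_apply (gen_apply b _)
      · rw [comap_rel, ← hwx, ← hwa]
        exact rel_partner w _ _
    intro f g hfg
    obtain ⟨hτ, hℓ⟩ := Prod.mk.injEq _ _ _ _ ▸ hfg
    by_cases h : ℓ f = x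
    · have h' : ℓ g = x := by simpa [h] using hℓ
      exact hQX (hQ ⟨f, h⟩ ⟨g, h'⟩ hτ).1
    · have h' : ¬ ℓ g = x := by simpa [h] using hℓ
      have := hQY (hQ ⟨a f, hax' f h⟩ ⟨a g, hax' g h'⟩ (by simpa [haτ] using hτ)).2
      simpa [comap_rel, a.invol] using this
  have h₂ : 2 ≤ (gen b ⊔ gen v).numClasses := by
    have := card_le_numClasses (r := gen b ⊔ gen v) (φ := fun f => decide (ℓ f = x))
      (sup_le (gen_le_iff.2 fun f => by rw [ker_def, hbℓ])
        (gen_le_iff.2 fun f => by rw [ker_def, hvℓ])) ?_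
    · simpa using this
    · intro t
      by_cases h : decide (ℓ f₀ = x) = t
      · exact ⟨f₀, h⟩
      · refine ⟨a f₀, ?_⟩
        have := hax f₀
        cases t <;> simp_all
  -- The faces of `v` have at least four flags and those of `w` at most four, so no face is lost.
  -- The number of vertices is at least 2 before and at most 4 after.
  have h₃ := four_mul_numClasses_le haτ hv
  have h₄ := card_le_four_mul_numClasses hwa
  omega

/-- The two parts given by `τ`, which meet only in the vertices `x` and `y`, can be separated by
a new pairing without decreasing the number of faces minus the number of vertices by more
than two. -/
theorem exists_separated (n : ℕ) : ∀ (Φ : Type u) [Finite Φ] (a b v : Pairing Φ) (τ : Φ → Bool)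
    (ℓ : Φ → L) (x y : L), Nat.card Φ = n → (∀ f, τ (a f) = τ f) → (∀ f, τ (b f) = τ f) →
    (∀ f, ℓ (b f) = ℓ f) → (∀ f, ℓ (v f) = ℓ f) → (∀ f, τ (v f) ≠ τ f → ℓ f = x ∨ ℓ f = y) →
    ∃ w : Pairing Φ, (∀ f, τ (w f) = τ f) ∧ (∀ f, ℓ (w f) = ℓ f) ∧
      (gen b ⊔ gen w).numClasses + (gen a ⊔ gen v).numClasses ≤
        (gen a ⊔ gen w).numClasses + (gen b ⊔ gen v).numClasses + 2 := by
  induction n using Nat.strong_induction_on with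
  | _ n ih =>
  intro Φ _ a b v τ ℓ x y hn haτ hbτ hbℓ hvℓ hxy
  -- A corner `{p, q}` of `v` inside one part can be kept: swaps make it a pair of `a` and of `b` as
  -- well, and it is removed. Such swaps need not preserve commutation of `a` and `b`, so the
  -- induction runs over arbitrary pairings.
  have key : ∀ v : Pairing Φ, (∀ f, ℓ (v f) = ℓ f) → (∀ f, τ (v f) ≠ τ f → ℓ f = x ∨ ℓ f = y) →
      (∃ p, τ (v p) = τ p) → ∃ w : Pairing Φ, (∀ f, τ (w f) = τ f) ∧ (∀ f, ℓ (w f) = ℓ f) ∧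
      (gen b ⊔ gen w).numClasses + (gen a ⊔ gen v).numClasses ≤
        (gen a ⊔ gen w).numClasses + (gen b ⊔ gen v).numClasses + 2 := by
    rintro v hvℓ hxy ⟨p, hp⟩
    obtain ⟨q, hq⟩ : ∃ q, v p = q := ⟨_, rfl⟩
    have hne : p ≠ q := fun e => v.ne p (hq.trans e.symm)
    have hτ : τ p = τ q := by rw [← hq, hp]
    have hℓ : ℓ p = ℓ q := by rw [← hq, hvℓ]
    have ha' := swap_left a hne
    have hb' := swap_left b hne
    have hcard := card_subtype_ne_and_ne hne
    obtain ⟨u, huτ, huℓ, hu⟩ := ih _ (by omega) {f // f ≠ p ∧ f ≠ q}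
      ((a.swap p q).restrict _ ((a.swap p q).ne_and_ne_closed ha'))
      ((b.swap p q).restrict _ ((b.swap p q).ne_and_ne_closed hb'))
      (v.restrict _ (v.ne_and_ne_closed hq)) (fun f => τ f.1) (fun f => ℓ f.1) x y rfl
      (fun f => swap_preserves a hne haτ hτ f.1) (fun f => swap_preserves b hne hbτ hτ f.1)
      (fun f => swap_preserves b hne hbℓ hℓ f.1) (fun f => hvℓ f.1) (fun f => hxy f.1)
    let w := v.patch _ (v.ne_and_ne_closed hq) u
    have hwS : ∀ f : {f // f ≠ p ∧ f ≠ q}, w f.1 = (u f).1 := fun f => patch_pos _ _ _ _ f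
    have hwp : w p = q := (patch_neg _ _ _ _ (by simp)).trans hq
    have hwq : w q = p := by rw [← hwp, w.invol]
    have hwu : w.restrict _ (w.ne_and_ne_closed hwp) = u :=
      Pairing.ext (funext fun f => Subtype.ext (hwS f))
    -- Passing to the smaller instance changes the number of classes by the same amount for `v` as
    -- for `w`, so the inequality is inherited.
    have hd : ∀ a : Pairing Φ, ∃ k, (gen a ⊔ gen v).numClasses + k =
          (gen ((a.swap p q).restrict _ ((a.swap p q).ne_and_ne_closed (swap_left a hne))) ⊔
            gen (v.restrict _ (v.ne_and_ne_closed hq))).numClasses + 1 ∧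
        (gen a ⊔ gen w).numClasses + k =
          (gen ((a.swap p q).restrict _ ((a.swap p q).ne_and_ne_closed (swap_left a hne))) ⊔
            gen u).numClasses + 1 := by
      intro a
      have e₁ := numClasses_restrict_compl_pair (a.swap p q) v (swap_left a hne) hq
      have e₂ := numClasses_restrict_compl_pair (a.swap p q) w (swap_left a hne) hwp
      rw [hwu] at e₂
      rw [← e₁, ← e₂]
      by_cases h : a p = q
      · refine ⟨0, ?_⟩
        have : a.swap p q = a := by rw [← h, swap_partner]
        simp [this]
      · exact ⟨1, (numClasses_swap_partner a v hq h).symm, (numClasses_swap_partner a w hwp h).symm⟩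
    obtain ⟨k, hk₁, hk₂⟩ := hd a
    obtain ⟨m, hm₁, hm₂⟩ := hd b
    refine ⟨w, fun f => ?_, fun f => ?_, by omega⟩
    · by_cases hf : f ≠ p ∧ f ≠ q
      · rw [hwS ⟨f, hf⟩]; exact huτ ⟨f, hf⟩
      · rcases not_and_or.1 hf with h | h <;> rw [not_not] at h <;> subst h
        exacts [by rw [hwp, hτ], by rw [hwq, hτ]]
    · by_cases hf : f ≠ p ∧ f ≠ q
      · rw [hwS ⟨f, hf⟩]; exact huℓ ⟨f, hf⟩
      · rcases not_and_or.1 hf with h | h <;> rw [not_not] at h <;> subst h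
        exacts [by rw [hwp, hℓ], by rw [hwq, hℓ]]
  by_cases h₁ : ∃ p, τ (v p) = τ p
  · exact key v hvℓ hxy h₁
  push Not at h₁
  -- If a side has both its flags at one vertex, making them a corner gains a face and at most one
  -- vertex. This corner lies inside one part because `a` preserves `τ`.
  by_cases h₂ : ∃ p, ℓ (a p) = ℓ p
  · obtain ⟨p, hp⟩ := h₂
    have hne := (a.ne p).symm
    have hva : v p ≠ a p := fun e => h₁ p (by rw [e, haτ])
    have hv' := swap_left v hne
    obtain ⟨w, hwτ, hwℓ, hw⟩ := key (v.swap p (a p)) (swap_preserves v hne hvℓ hp.symm)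
      (fun f _ => hxy f (h₁ f)) ⟨p, by rw [hv', haτ]⟩
    refine ⟨w, hwτ, hwℓ, ?_⟩
    have e₁ : (gen (v.swap p (a p)) ⊔ gen a).numClasses = (gen v ⊔ gen a).numClasses + 1 :=
      numClasses_swap_partner v a rfl hva
    have e₂ := numClasses_swap_le v hne (gen b)
    rw [sup_comm (gen _) (gen a), sup_comm (gen _) (gen a)] at e₁
    omega
  · push Not at h₂
    exact exists_separated_of_mixed haτ hbτ hbℓ hvℓ (fun f => hxy f (h₁ f)) h₁ h₂

/-- Vertices can be merged without decreasing the number of faces minus the number of vertices. -/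
theorem exists_merged [Finite Φ] (a b : Pairing Φ) (φ : Φ → K) (hb : ∀ f, φ (b f) = φ f) (n : ℕ) :
    ∀ w : Pairing Φ, (gen b ⊔ gen w).numClasses = n → (∀ f, φ (w f) = φ f) →
    ∃ u : Pairing Φ, gen b ⊔ gen u = ker φ ∧
      (gen b ⊔ gen u).numClasses + (gen a ⊔ gen w).numClasses ≤
        (gen a ⊔ gen u).numClasses + (gen b ⊔ gen w).numClasses := by
  induction n using Nat.strong_induction_on with
  | _ n ih =>
  intro w hn hw
  have hle : ∀ w : Pairing Φ, (∀ f, φ (w f) = φ f) → gen b ⊔ gen w ≤ ker φ := fun w hw =>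
    sup_le (gen_le_iff.2 fun f => (hb f).symm) (gen_le_iff.2 fun f => (hw f).symm)
  by_cases h : ker φ ≤ gen b ⊔ gen w
  · exact ⟨w, le_antisymm (hle w hw) h, by omega⟩
  rw [Setoid.le_def] at h
  push Not at h
  obtain ⟨p, q, hφ, hpq⟩ := h
  have hne : p ≠ q := by
    rintro rfl
    exact hpq (Setoid.refl' _ _)
  -- Linking two classes with equal labels loses at least one vertex and at most one face.
  have h₁ := numClasses_swap_lt w b le_rfl hpq
  have h₂ := numClasses_le_swap w hne (gen a)
  obtain ⟨u, hu, hu'⟩ := ih _ (by omega) (w.swap p q) rfl (swap_preserves w hne hw hφ)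
  exact ⟨u, hu, by omega⟩

/-- Only the labels `ℓ f₁` and `ℓ g₁` occur in both parts, so one identification across the parts at
each of them restores `ℓ`. -/
theorem ker_prod_sup_pair {τ : Φ → Bool} {ℓ : Φ → L} {f₁ f₂ g₁ g₂ : Φ}
    (hf : τ f₁ = true) (hf' : τ f₂ = false) (hfℓ : ℓ f₁ = ℓ f₂)
    (hg : τ g₁ = true) (hg' : τ g₂ = false) (hgℓ : ℓ g₁ = ℓ g₂)
    (h : ∀ f g, ℓ f = ℓ g → τ f ≠ τ g → ℓ f = ℓ f₁ ∨ ℓ f = ℓ g₁) :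
    (ker fun f => (τ f, ℓ f)) ⊔ pair f₁ f₂ ⊔ pair g₁ g₂ = ker ℓ := by
  refine le_antisymm (sup_le (sup_le ?_ (pair_le_iff.2 hfℓ)) (pair_le_iff.2 hgℓ)) ?_
  · intro f g hfg
    exact congrArg Prod.snd (ker_def.1 hfg)
  set r := (ker fun f => (τ f, ℓ f)) ⊔ pair f₁ f₂ ⊔ pair g₁ g₂ with hr
  have hker : ∀ f g, τ f = τ g → ℓ f = ℓ g → r f g := fun f g e₁ e₂ =>
    left_apply (left_apply (ker_def.2 (by simp [e₁, e₂])))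
  have hf₁₂ : r f₁ f₂ := left_apply (right_apply (pair_apply _ _))
  have hg₁₂ : r g₁ g₂ := right_apply (pair_apply _ _)
  have main : ∀ f g, τ f = true → τ g = false → ℓ f = ℓ g → r f g := by
    intro f g h₁ h₂ hfg
    rcases h f g hfg (by simp [h₁, h₂]) with e | e
    · exact r.trans' (hker f f₁ (by rw [h₁, hf]) e) (r.trans' hf₁₂ (hker f₂ g
        (by rw [h₂, hf']) (by rw [← hfℓ, ← e, hfg])))
    · exact r.trans' (hker f g₁ (by rw [h₁, hg]) e) (r.trans' hg₁₂ (hker g₂ g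
        (by rw [h₂, hg']) (by rw [← hgℓ, ← e, hfg])))
  intro f g hfg
  rcases hf₀ : τ f with _ | _ <;> rcases hg₀ : τ g with _ | _
  · exact hker f g (by rw [hf₀, hg₀]) hfg
  · exact r.symm' (main g f hg₀ hf₀ (ker_def.1 hfg).symm)
  · exact main f g hf₀ hg₀ hfg
  · exact hker f g (by rw [hf₀, hg₀]) hfg

theorem not_ker_prod {τ : Φ → Bool} {ℓ : Φ → L} {f₁ f₂ : Φ} (hf : τ f₁ = true)
    (hf' : τ f₂ = false) : ¬ (ker fun f => (τ f, ℓ f)) f₁ f₂ := by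
  simp [ker_def, hf, hf']

theorem not_ker_prod_sup_pair {τ : Φ → Bool} {ℓ : Φ → L} {f₁ f₂ g₁ g₂ : Φ} (hfℓ : ℓ f₁ = ℓ f₂)
    (hg : τ g₁ = true) (hg' : τ g₂ = false) (hfg : ℓ f₁ ≠ ℓ g₁) :
    ¬ ((ker fun f => (τ f, ℓ f)) ⊔ pair f₁ f₂) g₁ g₂ := by
  have hle : (ker fun f => (τ f, ℓ f)) ⊔ pair f₁ f₂ ≤ ker fun f => (τ f = true ∧ ℓ f ≠ ℓ f₁) := by
    refine sup_le ?_ (pair_le_iff.2 ?_)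
    · intro f g hfg
      obtain ⟨e₁, e₂⟩ := Prod.mk.injEq _ _ _ _ ▸ (ker_def.1 hfg)
      simp [ker_def, e₁, e₂]
    · simp [ker_def, hfℓ]
  intro hg₁₂
  have := ker_def.1 (hle hg₁₂)
  simp [hg, hg', hfg.symm] at this

/-- If two parts meet in exactly two vertices, then separating them yields two more vertices. -/
theorem numClasses_ker_prod [Finite Φ] {τ : Φ → Bool} {ℓ : Φ → L} {f₁ f₂ g₁ g₂ : Φ}
    (hf : τ f₁ = true) (hf' : τ f₂ = false) (hfℓ : ℓ f₁ = ℓ f₂)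
    (hg : τ g₁ = true) (hg' : τ g₂ = false) (hgℓ : ℓ g₁ = ℓ g₂) (hfg : ℓ f₁ ≠ ℓ g₁)
    (h : ∀ f g, ℓ f = ℓ g → τ f ≠ τ g → ℓ f = ℓ f₁ ∨ ℓ f = ℓ g₁) :
    (ker fun f => (τ f, ℓ f)).numClasses = (ker ℓ).numClasses + 2 := by
  have e₁ := numClasses_sup_pair _ (not_ker_prod (ℓ := ℓ) hf hf')
  have e₂ := numClasses_sup_pair _ (not_ker_prod_sup_pair hfℓ hg hg' hfg)
  rw [ker_prod_sup_pair hf hf' hfℓ hg hg' hgℓ h] at e₂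
  omega

theorem sup_gen_swap [Finite Φ] {b w : Pairing Φ} {p q : Φ} (h : ¬ (gen b ⊔ gen w) p q) :
    gen b ⊔ gen (w.swap p q) = gen b ⊔ gen w ⊔ pair p q := by
  have hne : p ≠ q := by
    rintro rfl
    exact h (Setoid.refl' _ _)
  exact le_antisymm (sup_gen_swap_le w hne _) (sup_le (le_swap w b le_rfl h)
    (pair_le_iff.2 (swap_rel w hne _)))

/-- Two parts that are to meet in the two ends of an edge can be glued without losing a face, such
that the two copies of the edge bound a digon. -/
theorem exists_glued [Finite Φ] {a b w : Pairing Φ} {τ : Φ → Bool} {ℓ : Φ → L} {p q : Φ}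
    (haτ : ∀ f, τ (a f) = τ f) (hw : gen b ⊔ gen w = ker fun f => (τ f, ℓ f))
    (hp : τ p = true) (hq : τ q = false) (hpq : ℓ p = ℓ q) (hpq' : ℓ (a p) = ℓ (a q))
    (hap : ℓ p ≠ ℓ (a p)) (h : ∀ f g, ℓ f = ℓ g → τ f ≠ τ g → ℓ f = ℓ p ∨ ℓ f = ℓ (a p)) :
    ∃ v : Pairing Φ, gen b ⊔ gen v = ker ℓ ∧
      (gen a ⊔ gen w).numClasses ≤ (gen a ⊔ gen v).numClasses ∧ v p = q ∧ v (a p) = a q := by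
  have hap' : τ (a p) = true := by rw [haτ, hp]
  have haq' : τ (a q) = false := by rw [haτ, hq]
  have hne : p ≠ q := fun e => by simp [e, hq] at hp
  have hne' : a p ≠ a q := fun e => hne (a.injective e)
  have hpaq : p ≠ a q := fun e => by simp [e, haq'] at hp
  have hqap : q ≠ a p := fun e => hpaq (by rw [e, a.invol])
  have h₁ : ¬ (gen b ⊔ gen w) p q := hw ▸ not_ker_prod hp hq
  have hv₁ := sup_gen_swap h₁
  -- The gluing at the end of `p` does not affect the other end, because the two ends have different
  -- labels.
  have h₂ : ¬ (gen b ⊔ gen (w.swap p q)) (a p) (a q) := by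
    rw [hv₁, hw]
    exact not_ker_prod_sup_pair hpq hap' haq' hap
  have hv₂ := sup_gen_swap h₂
  have hwp : w.swap p q p = q := swap_left w hne
  have hwp' : w.swap p q (a p) ≠ a q := fun e => h₂ (by
    rw [← e]
    exact rel_partner _ _ _)
  have hvp : (w.swap p q).swap (a p) (a q) p = q := by
    rw [swap_of_ne _ (a.ne p).symm hpaq, hwp]
    · intro e
      rw [← eq_comm_iff, hwp] at e
      exact hqap e
    · intro e
      rw [← eq_comm_iff, hwp] at e
      exact a.ne q e.symm
  have hvp' : (w.swap p q).swap (a p) (a q) (a p) = a q := swap_left _ hne'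
  refine ⟨(w.swap p q).swap (a p) (a q), ?_, ?_, hvp, hvp'⟩
  · rw [hv₂, hv₁, hw]
    exact ker_prod_sup_pair hp hq hpq hap' haq' hpq' h
  -- The first swap loses at most one face. The second regains one, since it closes up the digon
  -- `{p, q, a p, a q}` and cuts it off from the former partner of `a p`.
  · have e₁ := numClasses_le_swap w hne (gen a)
    have e₂ := numClasses_lt_swap (w.swap p q) a hne' le_rfl (fun hrel => by
      have := mem_of_rel (S := fun f => f = p ∨ f = q ∨ f = a p ∨ f = a q) ?_ ?_ hrel (by simp)
      · rcases this with e | e | e | e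
        · rw [eq_comm_iff, hwp] at e; exact hqap e.symm
        · rw [eq_comm_iff, swap_right w hne] at e; exact a.ne p e
        · exact Pairing.ne _ _ e
        · exact hwp' e
      · rintro f (rfl | rfl | rfl | rfl) <;> simp [a.invol]
      · rintro f (rfl | rfl | rfl | rfl)
        · simp [hvp]
        · rw [eq_comm_iff _ |>.1 hvp |>.symm]; simp
        · simp [hvp']
        · rw [eq_comm_iff _ |>.1 hvp' |>.symm]; simp)
    omega

/-- Two parts that meet in exactly two vertices can be separated without losing a face. -/
theorem exists_split [Finite Φ] {a b v : Pairing Φ} {τ : Φ → Bool} {ℓ : Φ → L} {f₁ f₂ g₁ g₂ : Φ}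
    (haτ : ∀ f, τ (a f) = τ f) (hbτ : ∀ f, τ (b f) = τ f) (hv : gen b ⊔ gen v = ker ℓ)
    (hf : τ f₁ = true) (hf' : τ f₂ = false) (hfℓ : ℓ f₁ = ℓ f₂)
    (hg : τ g₁ = true) (hg' : τ g₂ = false) (hgℓ : ℓ g₁ = ℓ g₂) (hfg : ℓ f₁ ≠ ℓ g₁)
    (h : ∀ f g, ℓ f = ℓ g → τ f ≠ τ g → ℓ f = ℓ f₁ ∨ ℓ f = ℓ g₁) :
    ∃ w : Pairing Φ, (gen b ⊔ gen w = ker fun f => (τ f, ℓ f)) ∧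
      (gen a ⊔ gen v).numClasses ≤ (gen a ⊔ gen w).numClasses := by
  have hbℓ : ∀ f, ℓ (b f) = ℓ f := fun f =>
    (ker_def.1 ((hv ▸ le_sup_left : gen b ≤ ker ℓ) (gen_apply b f))).symm
  have hvℓ : ∀ f, ℓ (v f) = ℓ f := fun f =>
    (ker_def.1 ((hv ▸ le_sup_right : gen v ≤ ker ℓ) (gen_apply v f))).symm
  obtain ⟨w, hwτ, hwℓ, hw⟩ := exists_separated _ Φ a b v τ ℓ (ℓ f₁) (ℓ g₁) rfl haτ hbτ hbℓ hvℓ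
    fun f hf => h f (v f) (hvℓ f).symm hf.symm
  obtain ⟨u, hu, hu'⟩ := exists_merged a b (fun f => (τ f, ℓ f)) (fun f => by rw [hbτ, hbℓ]) _ w rfl
    fun f => by rw [hwτ, hwℓ]
  refine ⟨u, hu, ?_⟩
  -- The loss of at most two in faces minus vertices is exactly accounted for by the two additional
  -- vertices.
  have := numClasses_ker_prod hf hf' hfℓ hg hg' hgℓ hfg h
  rw [← hu, ← hv] at this
  omega

end Pairing

/-! ### The flags of an embedding -/

namespace Pairing

open Setoid

variable {Φ : Type*}

/-- The points can be coloured with two colours such that every pair of two given pairings gets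
both colours. -/
theorem exists_coloring (b w : Pairing Φ) :
    ∃ κ : Φ → ℤˣ, (∀ f, κ (b f) = -κ f) ∧ ∀ f, κ (w f) = -κ f := by
  classical
  let B : Equiv.Perm Φ := ⟨b, b, b.invol, b.invol⟩
  let W : Equiv.Perm Φ := ⟨w, w, w.invol, w.invol⟩
  have hB : ∀ f, B f = b f := fun _ => rfl
  have hW : ∀ f, W f = w f := fun _ => rfl
  have hBB : B⁻¹ = B := rfl
  have hWW : W⁻¹ = W := rfl
  obtain ⟨π, hπ⟩ : ∃ π, π = B * W := ⟨_, rfl⟩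
  have hconj : ∀ k : ℤ, B * π ^ k = π ^ (-k) * B := by
    intro k
    have h₁ : B * π * B⁻¹ = π⁻¹ := by
      rw [hπ, mul_inv_rev, hWW, hBB]
      change B * (B * W) * B = W * B
      have : B * B = 1 := by
        nth_rewrite 1 [← hBB]
        exact inv_mul_cancel B
      rw [← mul_assoc, this, one_mul]
    have h₂ := congrArg (· ^ k) h₁
    simp only [conj_zpow, inv_zpow'] at h₂
    rw [← h₂, inv_mul_cancel_right]
  have hconj' : ∀ (k : ℤ) f, b ((π ^ k) f) = (π ^ (-k)) (b f) := fun k f =>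
    DFunLike.congr_fun (hconj k) f
  -- `b` inverts `π`. If `π ^ k` took `f` to `b f`, then `(π ^ j) f` would be fixed by `b` for `k =
  -- 2j` and by `w` for `k = 2j + 1`. Hence `b` exchanges two different cycles of `π`, and the
  -- colours distinguish them.
  have hne : ∀ f, ¬ π.SameCycle f (b f) := by
    rintro f ⟨k, hk⟩
    rcases Int.even_or_odd' k with ⟨j, rfl | rfl⟩
    · refine b.ne ((π ^ j) f) ?_
      rw [hconj', ← hk, ← Equiv.Perm.mul_apply, ← zpow_add]
      congr 2
      ring
    · refine w.ne ((π ^ j) f) (b.injective ?_)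
      have h₁ : b (w ((π ^ j) f)) = π ((π ^ j) f) := by rw [hπ]; rfl
      rw [h₁, hconj', ← hk, ← Equiv.Perm.mul_apply, ← Equiv.Perm.mul_apply, ← zpow_one_add,
        ← zpow_add]
      congr 2
      ring
  have hb : ∀ f g, π.SameCycle f g → π.SameCycle (b f) (b g) := by
    rintro f g ⟨k, rfl⟩
    exact ⟨-k, (hconj' k f).symm⟩
  have hwb : ∀ f, π.SameCycle (w f) (b f) := fun f => ⟨1, by
    rw [zpow_one, hπ]
    change b (w (w f)) = b f
    rw [w.invol]⟩
  let t : Setoid Φ :=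
    { r := fun f g => π.SameCycle f g ∨ π.SameCycle f (b g)
      iseqv :=
        { refl := fun f => Or.inl (Equiv.Perm.SameCycle.refl _ _)
          symm := by
            rintro f g (h | h)
            · exact Or.inl h.symm
            · refine Or.inr ?_
              have := hb _ _ h.symm
              rwa [b.invol] at this
          trans := by
            rintro f g h (h₁ | h₁) (h₂ | h₂)
            · exact Or.inl (h₁.trans h₂)
            · exact Or.inr (h₁.trans h₂)
            · exact Or.inr (h₁.trans (hb _ _ h₂))
            · refine Or.inl (h₁.trans ?_)
              have := hb _ _ h₂
              rwa [b.invol] at this } }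
  let rep : Φ → Φ := fun f => (Quotient.mk t f).out
  have hrep : ∀ f, π.SameCycle f (rep f) ∨ π.SameCycle f (b (rep f)) := fun f =>
    t.symm' (Quotient.mk_out (s := t) f)
  have hrepb : ∀ f, rep (b f) = rep f := fun f =>
    congrArg Quotient.out (Quotient.sound (s := t) (Or.inr (Equiv.Perm.SameCycle.refl _ _)))
  have hrepw : ∀ f, rep (w f) = rep f := fun f =>
    congrArg Quotient.out (Quotient.sound (s := t) (Or.inr (hwb f)))
  let κ : Φ → ℤˣ := fun f => if π.SameCycle f (rep f) then 1 else -1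
  have hκb : ∀ f, κ (b f) = -κ f := by
    intro f
    by_cases h : π.SameCycle f (rep f)
    · have h' : ¬ π.SameCycle (b f) (rep f) := fun h' => hne f (h.trans h'.symm)
      simp [κ, h, h', hrepb]
    · have h' : π.SameCycle (b f) (rep f) := by
        have := hb _ _ ((hrep f).resolve_left h)
        rwa [b.invol] at this
      simp [κ, h, h', hrepb]
  refine ⟨κ, hκb, fun f => ?_⟩
  rw [← hκb]
  have : π.SameCycle (w f) (rep f) ↔ π.SameCycle (b f) (rep f) :=
    ⟨(hwb f).symm.trans, (hwb f).trans⟩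
  simp [κ, hrepb, hrepw, this]

end Pairing

open Setoid

/-- A presentation of an embedding of a graph by its flags: `a` exchanges the two ends of a side of
an edge, `b` exchanges the two sides of an edge, and `w` exchanges the two flags at a corner. -/
structure FlagSystem {V : Type*} (G : SimpleGraph V) {Φ : Type*} (a b w : Pairing Φ)
    (D : Φ → G.Dart) : Prop where
  surj : Function.Surjective D
  fiber : ∀ f g, D f = D g → g = f ∨ g = b f
  dart_b : ∀ f, D (b f) = D f
  dart_a : ∀ f, D (a f) = (D f).symm
  comm : ∀ f, a (b f) = b (a f)
  vertex : gen b ⊔ gen w = ker fun f => (D f).fst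

theorem units_eq_or_eq_neg (s t : ℤˣ) : s = t ∨ s = -t := by
  rcases Int.units_eq_one_or s with rfl | rfl <;> rcases Int.units_eq_one_or t with rfl | rfl <;>
    decide

namespace GraphEmbedding

variable {V : Type u} {G : SimpleGraph V}

theorem dartSign_symm (P : GraphEmbedding G) (d : G.Dart) : P.dartSign d.symm = P.dartSign d := by
  simp [dartSign]

theorem units_ne_neg (s : ℤˣ) : -s ≠ s := by
  rcases Int.units_eq_one_or s with rfl | rfl <;> decide

/-- The flag at the other end of the same side of an edge. -/
def sidePairing (P : GraphEmbedding G) : Pairing (G.Dart × ℤˣ) where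
  toFun := P.faceReverse
  invol f := by
    refine Prod.ext (by simp [faceReverse]) ?_
    simp only [faceReverse, dartSign_symm]
    rw [neg_mul, neg_neg, mul_assoc, Int.units_mul_self, mul_one]
  ne f h := f.1.symm_ne (congrArg Prod.fst h)

/-- The flag on the other side of an edge. -/
def edgePairing (G : SimpleGraph V) : Pairing (G.Dart × ℤˣ) where
  toFun f := (f.1, -f.2)
  invol f := by simp
  ne f h := units_ne_neg f.2 (congrArg Prod.snd h)

/-- The other flag at the same corner. -/
def cornerPairing (P : GraphEmbedding G) : Pairing (G.Dart × ℤˣ) where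
  toFun f := ((P.rot ^ (-(f.2 : ℤ))) f.1, -f.2)
  invol f := by simp
  ne f h := units_ne_neg f.2 (congrArg Prod.snd h)

/-- A step of the face traversal runs along a side and then turns at a corner. This identifies the
faces with the classes of these two involutions. -/
theorem cornerPairing_sidePairing (P : GraphEmbedding G) (f : G.Dart × ℤˣ) :
    P.cornerPairing (P.sidePairing f) = P.faceStep f := by
  change (_, _) = (_, _)
  simp [sidePairing, faceReverse]

theorem card_face (P : GraphEmbedding G) :
    Nat.card P.Face = (gen P.sidePairing ⊔ gen P.cornerPairing).numClasses := by
  have h₁ : Relation.EqvGen.setoid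
      (fun f g : G.Dart × ℤˣ => g = P.faceStep f ∨ g = P.faceReverse f) =
      gen P.sidePairing ⊔ gen P.cornerPairing := by
    refine le_antisymm (eqvGen_le ?_) (sup_le (gen_le_iff.2 fun f => ?_)
      (gen_le_iff.2 fun f => ?_))
    · rintro f g (rfl | rfl)
      · rw [← cornerPairing_sidePairing]
        exact Setoid.trans' _ (left_apply (gen_apply P.sidePairing f))
          (right_apply (gen_apply P.cornerPairing _))
      · exact left_apply (gen_apply P.sidePairing f)
    · exact Relation.EqvGen.rel _ _ (Or.inr rfl)
    · have h₂ := Relation.EqvGen.rel (r := fun f g : G.Dart × ℤˣ =>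
        g = P.faceStep f ∨ g = P.faceReverse f) (P.sidePairing f) _ (Or.inl rfl)
      rw [← cornerPairing_sidePairing, Pairing.invol] at h₂
      exact Relation.EqvGen.trans _ _ _ (Relation.EqvGen.rel _ _ (Or.inr rfl)) h₂
  rw [← h₁]
  exact Nat.card_congr
    { toFun := Quot.map id fun _ _ h => Relation.EqvGen.rel _ _ h
      invFun := Quot.lift (Quot.mk _) fun _ _ h => Quot.eqvGen_sound h
      left_inv := by rintro ⟨f⟩; rfl
      right_inv := by rintro ⟨f⟩; rfl }

theorem flagSystem (P : GraphEmbedding G) :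
    FlagSystem G P.sidePairing (edgePairing G) P.cornerPairing Prod.fst where
  surj d := ⟨(d, 1), rfl⟩
  fiber := by
    rintro ⟨d, s⟩ ⟨d', s'⟩ rfl
    rcases units_eq_or_eq_neg s' s with rfl | rfl
    exacts [Or.inl rfl, Or.inr rfl]
  dart_b _ := rfl
  dart_a _ := rfl
  comm f := Prod.ext rfl (by
    change -(-f.2 * P.dartSign f.1) = - -(f.2 * P.dartSign f.1)
    rw [neg_mul])
  vertex := by
    refine le_antisymm (sup_le (gen_le_iff.2 fun f => rfl) (gen_le_iff.2 fun f => ?_)) ?_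
    · have key : ∀ (k : ℤ) (d : G.Dart), ((P.rot ^ k) d).fst = d.fst := by
        intro k d
        induction k with
        | zero => rfl
        | succ k ih => rw [add_comm, zpow_one_add, Equiv.Perm.mul_apply, P.rot_fst, ih]
        | pred k ih =>
          rw [← ih, ← P.rot_fst, ← Equiv.Perm.mul_apply, ← zpow_one_add]
          congr 3
          ring_nf
      exact (key _ _).symm
    · set r := gen (edgePairing G) ⊔ gen P.cornerPairing with hr
      have hb : ∀ (d : G.Dart) (s s' : ℤˣ), r (d, s) (d, s') := by
        intro d s s'
        rcases units_eq_or_eq_neg s' s with rfl | rfl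
        · exact Setoid.refl' _ _
        · exact left_apply (gen_apply (edgePairing G) (d, s))
      have hrot : ∀ d, r (d, 1) (P.rot d, 1) := by
        intro d
        refine Setoid.trans' _ (hb d 1 (-1)) ?_
        have : P.cornerPairing (d, -1) = (P.rot d, 1) := by
          change (_, _) = (_, _)
          simp
        rw [← this]
        exact Pairing.rel_partner _ _ _
      rintro ⟨d, s⟩ ⟨d', s'⟩ hd
      obtain ⟨k, hk⟩ := P.rot_cyclic d d' hd
      have key : ∀ k : ℤ, r (d, 1) ((P.rot ^ k) d, 1) := by
        intro k
        induction k with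
        | zero => exact Setoid.refl' _ _
        | succ k ih =>
          rw [add_comm, zpow_one_add, Equiv.Perm.mul_apply]
          exact Setoid.trans' _ ih (hrot _)
        | pred k ih =>
          refine Setoid.trans' _ ih (Setoid.symm' _ ?_)
          have := hrot ((P.rot ^ (-(k : ℤ) - 1)) d)
          rwa [← Equiv.Perm.mul_apply, ← zpow_one_add, add_sub_cancel] at this
      exact Setoid.trans' _ (hb d s 1) (Setoid.trans' _ (hk ▸ key k) (hb d' 1 s'))

end GraphEmbedding

namespace FlagSystem

variable {V : Type u} {G : SimpleGraph V} {Φ : Type*} {a b w : Pairing Φ} {D : Φ → G.Dart}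

theorem fst_w (h : FlagSystem G a b w D) (f : Φ) : (D (w f)).fst = (D f).fst :=
  (ker_def.1 ((h.vertex ▸ le_sup_right : gen w ≤ _) (gen_apply w f))).symm

/-- Every presentation by flags comes from an embedding. -/
theorem exists_graphEmbedding (h : FlagSystem G a b w D) :
    ∃ P : GraphEmbedding G, Nat.card P.Face = (gen a ⊔ gen w).numClasses := by
  classical
  -- The colour takes the role of `s` in a flag `(d, s)`: it is reversed by `b` and by `w`. The
  -- rotation is then read off from `w` and the signature from `a`.
  obtain ⟨κ, hκb, hκw⟩ := Pairing.exists_coloring b w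
  have hbij : Function.Bijective fun f => (D f, κ f) := by
    refine ⟨fun f g hfg => ?_, fun ⟨d, s⟩ => ?_⟩
    · obtain ⟨h₁, h₂⟩ := Prod.mk.injEq _ _ _ _ ▸ hfg
      rcases h.fiber f g h₁ with rfl | rfl
      · rfl
      · rw [hκb] at h₂
        exact (GraphEmbedding.units_ne_neg _ h₂.symm).elim
    · obtain ⟨f, rfl⟩ := h.surj d
      rcases units_eq_or_eq_neg s (κ f) with rfl | rfl
      · exact ⟨f, rfl⟩
      · exact ⟨b f, by simp [h.dart_b, hκb]⟩
  let e : Φ ≃ G.Dart × ℤˣ := Equiv.ofBijective _ hbij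
  have he : ∀ f, e f = (D f, κ f) := fun _ => rfl
  have hD : ∀ c, D (e.symm c) = c.1 := fun c => congrArg Prod.fst (e.apply_symm_apply c)
  have hκ : ∀ c, κ (e.symm c) = c.2 := fun c => congrArg Prod.snd (e.apply_symm_apply c)
  have hsymm : ∀ f d s, D f = d → κ f = s → e.symm (d, s) = f := by
    rintro f _ _ rfl rfl
    exact e.symm_apply_apply f
  let R : G.Dart → ℤˣ → G.Dart := fun d s => D (w (e.symm (d, s)))
  have hR : ∀ d s, e.symm (R d s, -s) = w (e.symm (d, s)) := fun d s =>
    hsymm _ _ _ rfl (by rw [hκw, hκ])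
  have hRR : ∀ d s, R (R d s) (-s) = d := fun d s => by
    change D (w (e.symm (R d s, -s))) = d
    rw [hR, w.invol, hD]
  let rot : Equiv.Perm G.Dart :=
    { toFun := fun d => R d (-1)
      invFun := fun d => R d 1
      left_inv := fun d => by simpa using hRR d (-1)
      right_inv := fun d => by simpa using hRR d 1 }
  let σ : G.Dart → ℤˣ := fun d => -κ (a (e.symm (d, 1)))
  -- The sign depends on the dart alone because `a` commutes with `b`.
  have hσ : ∀ f, κ (a f) = -(κ f * σ (D f)) := by
    intro f
    rcases Int.units_eq_one_or (κ f) with hf | hf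
    · rw [hf, one_mul, neg_neg, hsymm f _ _ rfl hf]
    · have : e.symm (D f, 1) = b f := hsymm _ _ _ (h.dart_b f) (by rw [hκb, hf, neg_neg])
      simp only [σ]
      rw [hf, this, h.comm, hκb]
      simp
  have hσsymm : ∀ d, σ d.symm = σ d := by
    intro d
    obtain ⟨f, rfl⟩ := h.surj d
    have h₁ := hσ (a f)
    rw [a.invol, hσ f, h.dart_a] at h₁
    have h₂ : σ (D f) * σ (D f).symm = 1 := by
      rw [neg_mul, neg_neg, mul_assoc] at h₁
      exact mul_eq_left.1 h₁.symm
    rw [← one_mul (σ (D f).symm), ← Int.units_mul_self (σ (D f)), mul_assoc, h₂, mul_one]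
  have hex : ∀ c : G.edgeSet, ∃ d : G.Dart, d.edge = c.1 := by
    rintro ⟨c, hc⟩
    induction c with
    | _ u v => exact ⟨⟨(u, v), hc⟩, rfl⟩
  choose δ hδ using hex
  have hrotR : ∀ d (s : ℤˣ), (rot ^ (-(s : ℤ))) d = R d s := by
    intro d s
    rcases Int.units_eq_one_or s with rfl | rfl
    · simp only [Units.val_one, zpow_neg, zpow_one]
      rfl
    · simp only [Units.val_neg, Units.val_one, neg_neg, zpow_one]
      rfl
  have hpow : ∀ d f, (gen b ⊔ gen w) f (e.symm (d, 1)) → rot.SameCycle (D f) d := by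
    intro d f hf
    have hle : gen b ⊔ gen w ≤ comap D (Equiv.Perm.SameCycle.setoid rot) := by
      refine sup_le (gen_le_iff.2 fun f => ?_) (gen_le_iff.2 fun f => ?_)
      · rw [comap_rel, h.dart_b]
      · refine ⟨-(κ f : ℤ), ?_⟩
        rw [hrotR]
        simp only [R]
        rw [hsymm f _ _ rfl rfl]
    have := hle hf
    rw [comap_rel, hD] at this
    exact this
  let P : GraphEmbedding G :=
    { rot := rot
      rot_fst := fun d => by
        change (D (w (e.symm (d, -1)))).fst = d.fst
        rw [h.fst_w, hD]
      rot_cyclic := fun d d' hdd => by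
        have := hpow d' (e.symm (d, 1)) (by
          rw [h.vertex, ker_def, hD, hD]
          exact hdd)
        rwa [hD] at this
      sign := fun c => σ (δ c) }
  have hsign : ∀ d, P.dartSign d = σ d := by
    intro d
    change σ (δ ⟨d.edge, d.edge_mem⟩) = σ d
    rcases (SimpleGraph.dart_edge_eq_iff _ _).1 (hδ ⟨d.edge, d.edge_mem⟩) with h' | h'
    · rw [h']
    · rw [h', hσsymm]
  refine ⟨P, ?_⟩
  rw [P.card_face, ← numClasses_comap_surjective _ e.surjective,
    comap_gen_sup e.injective P.sidePairing.invol P.cornerPairing.invol (a' := a) (w' := w)]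
  · intro f
    refine Prod.ext ?_ ?_
    · exact (h.dart_a f).symm
    · change -(κ f * P.dartSign (D f)) = κ (a f)
      rw [hsign, hσ]
  · intro f
    refine Prod.ext ?_ (hκw f).symm
    change (rot ^ (-(κ f : ℤ))) (D f) = D (w f)
    rw [hrotR]
    simp only [R]
    rw [hsymm f _ _ rfl rfl]

end FlagSystem

/-! ### The Euler genus in terms of flags -/

namespace SimpleGraph

variable {V : Type u} (G : SimpleGraph V)

/-- The contribution of the graph to the Euler genus of its embeddings. -/
noncomputable def eulerNumber : ℤ :=
  2 * (Nat.card G.ConnectedComponent : ℤ) - Nat.card V + Nat.card G.edgeSet -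
    Nat.card {v : V // G.IsIsolated v}

theorem finite_dart [Finite V] : Finite G.Dart :=
  Finite.of_injective (fun d : G.Dart => d.toProd) Dart.toProd_injective

variable {G} {Φ : Type*} {D : Φ → G.Dart}

theorem card_eq_isolated_add [Finite V] (hD : Function.Surjective D) :
    Nat.card V = Nat.card {v : V // G.IsIsolated v} + (ker fun f => (D f).fst).numClasses := by
  classical
  have h : Set.range (fun f => (D f).fst) = {v | ¬ G.IsIsolated v} := by
    ext v
    simp only [Set.mem_range, Set.mem_ofPred_eq, IsIsolated, not_forall, not_not]
    constructor
    · rintro ⟨f, rfl⟩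
      exact ⟨_, (D f).adj⟩
    · rintro ⟨u, hu⟩
      obtain ⟨f, hf⟩ := hD ⟨(v, u), hu⟩
      exact ⟨f, by rw [hf]⟩
  rw [numClasses_ker, h, ← Nat.card_congr (Equiv.sumCompl fun v => G.IsIsolated v), Nat.card_sum]
  rfl

theorem ker_connectedComponentMk (hD : Function.Surjective D) {a : Φ → Φ}
    (ha : ∀ f, D (a f) = (D f).symm) :
    gen a ⊔ (ker fun f => (D f).fst) = ker fun f => G.connectedComponentMk (D f).fst := by
  refine le_antisymm (sup_le (gen_le_iff.2 fun f => ?_) fun {f g} hfg => ?_) ?_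
  · rw [ker_def, ha]
    exact ConnectedComponent.sound (D f).adj.reachable
  · exact congrArg G.connectedComponentMk hfg
  · have key : ∀ {u v : V} (p : G.Walk u v) (f g : Φ), (D f).fst = u → (D g).fst = v →
        (gen a ⊔ (ker fun f => (D f).fst)) f g := by
      intro u v p
      induction p with
      | nil => exact fun f g hf hg => right_apply (hf.trans hg.symm)
      | cons h p ih =>
        intro f g hf hg
        obtain ⟨f', hf'⟩ := hD ⟨(_, _), h⟩
        refine Setoid.trans' _ (right_apply ?_) (Setoid.trans' _ (left_apply (gen_apply a f'))
          (ih (a f') g ?_ hg))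
        · rw [ker_def, hf, hf']
        · rw [ha, hf']
          rfl
    intro f g hfg
    obtain ⟨p⟩ := ConnectedComponent.exact (ker_def.1 hfg)
    exact key p f g rfl rfl

theorem card_connectedComponent [Finite V] (hD : Function.Surjective D) :
    Nat.card G.ConnectedComponent = Nat.card {v : V // G.IsIsolated v} +
      (ker fun f => G.connectedComponentMk (D f).fst).numClasses := by
  classical
  have : Finite G.ConnectedComponent := Quot.finite _
  set ψ := fun f => G.connectedComponentMk (D f).fst with hψ
  have hiso : ∀ {u v : V}, G.IsIsolated u → G.Reachable u v → u = v := by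
    rintro u v hu ⟨p⟩
    cases p with
    | nil => rfl
    | cons h p => exact (hu _ h).elim
  have hcard : Nat.card {v : V // G.IsIsolated v} = Nat.card {C // ¬ C ∈ Set.range ψ} := by
    refine Nat.card_congr (Equiv.ofBijective
      (fun v => ⟨G.connectedComponentMk v.1, ?_⟩) ⟨?_, ?_⟩)
    · rintro ⟨f, hf⟩
      have := hiso v.2 (ConnectedComponent.exact hf).symm
      exact v.2 (D f).snd (this ▸ (D f).adj)
    · rintro u v huv
      exact Subtype.ext (hiso u.2 (ConnectedComponent.exact (congrArg Subtype.val huv)))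
    · rintro ⟨C, hC⟩
      induction C using ConnectedComponent.ind with
      | h v =>
        refine ⟨⟨v, fun u hu => hC ?_⟩, rfl⟩
        obtain ⟨f, hf⟩ := hD ⟨(v, u), hu⟩
        exact ⟨f, by rw [hψ]; simp only; rw [hf]⟩
  rw [numClasses_ker, hcard, add_comm,
    ← Nat.card_congr (Equiv.sumCompl fun C => C ∈ Set.range ψ), Nat.card_sum]

end SimpleGraph

theorem GraphEmbedding.eulerGenus_eq {V : Type u} {G : SimpleGraph V} (P : GraphEmbedding G) :
    P.eulerGenus = G.eulerNumber - Nat.card P.Face := by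
  unfold eulerGenus SimpleGraph.eulerNumber numFaces
  push_cast
  ring

namespace FlagSystem

variable {V : Type u} {G : SimpleGraph V} {Φ : Type*} {a b w : Pairing Φ} {D : Φ → G.Dart}

theorem card_edgeSet (h : FlagSystem G a b w D) :
    Nat.card G.edgeSet = (gen a ⊔ gen b).numClasses := by
  have h₁ : gen a ⊔ gen b = ker fun f => (D f).edge := by
    refine le_antisymm (sup_le (gen_le_iff.2 fun f => ?_) (gen_le_iff.2 fun f => ?_)) ?_
    · rw [ker_def, h.dart_a, SimpleGraph.Dart.edge_symm]
    · rw [ker_def, h.dart_b]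
    · have key : ∀ f g, D f = D g → (gen a ⊔ gen b) f g := by
        intro f g hfg
        rcases h.fiber f g hfg with rfl | rfl
        exacts [Setoid.refl' _ _, Pairing.rel_partner _ _ _]
      intro f g hfg
      rcases (SimpleGraph.dart_edge_eq_iff _ _).1 (ker_def.1 hfg) with e | e
      · exact key f g e
      · refine Setoid.trans' _ (key f (a g) ?_) (Setoid.symm' _ (left_apply (gen_apply a g)))
        rw [e, h.dart_a]
  rw [h₁, numClasses_ker]
  refine Nat.card_congr (Equiv.setCongr (Set.ext fun e => ⟨fun he => ?_, ?_⟩))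
  · induction e with
    | _ u v =>
      obtain ⟨f, hf⟩ := h.surj ⟨(u, v), he⟩
      exact ⟨f, by simp only; rw [hf]; rfl⟩
  · rintro ⟨f, rfl⟩
    exact (D f).edge_mem

/-- An isolated vertex contributes 2 - 1 - 1 = 0, so the flags determine this number. -/
theorem eulerNumber_eq [Finite V] (h : FlagSystem G a b w D) :
    G.eulerNumber = 2 * ((gen a ⊔ gen b ⊔ gen w).numClasses : ℤ) - (gen b ⊔ gen w).numClasses +
      (gen a ⊔ gen b).numClasses := by
  have h₁ := SimpleGraph.card_eq_isolated_add h.surj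
  have h₂ := SimpleGraph.card_connectedComponent h.surj
  rw [← SimpleGraph.ker_connectedComponentMk h.surj h.dart_a, ← h.vertex, ← sup_assoc] at h₂
  rw [← h.vertex] at h₁
  rw [SimpleGraph.eulerNumber, h.card_edgeSet, h₁, h₂]
  push_cast
  ring

/-- As an edge has at most four flags, the `n` in Euler's inequality 2(E + F + V) ≤ n + 4c is at
most 4E, whence F ≤ 2c - V + E. It makes Euler genera nonnegative, so the infimum over `ℕ` that
defines `SimpleGraph.eulerGenus` sees every embedding. -/
theorem numClasses_le_eulerNumber [Finite V] [Finite Φ] (h : FlagSystem G a b w D) :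
    ((gen a ⊔ gen w).numClasses : ℤ) ≤ G.eulerNumber := by
  rw [h.eulerNumber_eq]
  have h₁ := Pairing.euler_inequality _ Φ a b w rfl
  have h₂ := Pairing.card_le_four_mul_numClasses (a := a) (w := b) fun f => (h.comm f).symm
  omega

end FlagSystem

namespace SimpleGraph

variable {V : Type u} {G : SimpleGraph V}

theorem _root_.GraphEmbedding.eulerGenus_nonneg [Finite V] (P : GraphEmbedding G) :
    0 ≤ P.eulerGenus := by
  have := G.finite_dart
  have h := P.flagSystem.numClasses_le_eulerNumber
  rw [← P.card_face] at h
  rw [P.eulerGenus_eq]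
  omega

/-- With the edge pairing as corner pairing, every dart is a vertex of its own;
`Pairing.exists_merged` then joins the darts that start at the same vertex. -/
theorem nonempty_graphEmbedding [Finite V] : Nonempty (GraphEmbedding G) := by
  have := G.finite_dart
  let a : Pairing (G.Dart × ℤˣ) :=
    { toFun := fun f => (f.1.symm, f.2)
      invol := fun f => by simp
      ne := fun f h => f.1.symm_ne (congrArg Prod.fst h) }
  obtain ⟨w, hw, -⟩ := Pairing.exists_merged a (GraphEmbedding.edgePairing G)
    (fun f => f.1.fst) (fun f => rfl) _ (GraphEmbedding.edgePairing G) rfl fun f => rfl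
  obtain ⟨P, -⟩ := FlagSystem.exists_graphEmbedding (G := G) (a := a)
    (b := GraphEmbedding.edgePairing G) (w := w) (D := Prod.fst)
    { surj := fun d => ⟨(d, 1), rfl⟩
      fiber := by
        rintro ⟨d, s⟩ ⟨d', s'⟩ rfl
        rcases units_eq_or_eq_neg s' s with rfl | rfl
        exacts [Or.inl rfl, Or.inr rfl]
      dart_b := fun _ => rfl
      dart_a := fun _ => rfl
      comm := fun _ => rfl
      vertex := hw }
  exact ⟨P⟩

theorem exists_eulerGenus_eq [Finite V] (G : SimpleGraph V) :
    ∃ P : GraphEmbedding G, P.eulerGenus = G.eulerGenus := by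
  obtain ⟨P⟩ := nonempty_graphEmbedding (G := G)
  obtain ⟨Q, hQ⟩ := Nat.sInf_mem (s := {n : ℕ | ∃ P : GraphEmbedding G, P.eulerGenus = n})
    ⟨P.eulerGenus.toNat, P, (Int.toNat_of_nonneg P.eulerGenus_nonneg).symm⟩
  exact ⟨Q, hQ⟩

theorem eulerGenus_le [Finite V] (P : GraphEmbedding G) : (G.eulerGenus : ℤ) ≤ P.eulerGenus := by
  have h := Nat.sInf_le (s := {n : ℕ | ∃ P : GraphEmbedding G, P.eulerGenus = n})
    ⟨P, (Int.toNat_of_nonneg P.eulerGenus_nonneg).symm⟩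
  have := Int.toNat_of_nonneg P.eulerGenus_nonneg
  have h' : G.eulerGenus ≤ P.eulerGenus.toNat := h
  omega

theorem exists_flagSystem [Finite V] (G : SimpleGraph V) :
    ∃ P : GraphEmbedding G, ((gen P.sidePairing ⊔ gen P.cornerPairing).numClasses : ℤ) =
      G.eulerNumber - G.eulerGenus := by
  obtain ⟨P, hP⟩ := G.exists_eulerGenus_eq
  refine ⟨P, ?_⟩
  rw [← P.card_face, ← hP, P.eulerGenus_eq]
  ring

theorem _root_.FlagSystem.eulerGenus_le [Finite V] {Φ : Type*} {a b w : Pairing Φ}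
    {D : Φ → G.Dart} (h : FlagSystem G a b w D) :
    (G.eulerGenus : ℤ) ≤ G.eulerNumber - (gen a ⊔ gen w).numClasses := by
  obtain ⟨P, hP⟩ := h.exists_graphEmbedding
  rw [← hP, ← P.eulerGenus_eq]
  exact SimpleGraph.eulerGenus_le P

variable {W : Type*} {G' : SimpleGraph W}

/-- The flags of an embedding only record the darts, their reversal and their common initial
vertices. So isolated vertices may be added, and both parts of an amalgam can live on the vertex
type of the whole. -/
theorem eulerGenus_le_of_dart [Finite V] [Finite W] (e : G.Dart ≃ G'.Dart)
    (hs : ∀ d, e d.symm = (e d).symm) (hf : ∀ d d', (e d).fst = (e d').fst ↔ d.fst = d'.fst) :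
    G'.eulerGenus ≤ G.eulerGenus := by
  obtain ⟨P, hP⟩ := G.exists_flagSystem
  have h := P.flagSystem
  have h' : FlagSystem G' P.sidePairing (GraphEmbedding.edgePairing G) P.cornerPairing
      fun f => e f.1 :=
    { surj := e.surjective.comp h.surj
      fiber := fun f g hfg => h.fiber f g (e.injective hfg)
      dart_b := fun f => rfl
      dart_a := fun f => hs f.1
      comm := h.comm
      vertex := by
        rw [h.vertex]
        ext f g
        exact (hf f.1 g.1).symm }
  have := h'.eulerGenus_le
  rw [h'.eulerNumber_eq] at this
  rw [h.eulerNumber_eq] at hP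
  omega

theorem eulerGenus_map [Finite V] [Finite W] (i : V ↪ W) :
    (G.map i).eulerGenus = G.eulerGenus := by
  let f : G.Dart → (G.map i).Dart := fun d =>
    ⟨(i d.fst, i d.snd), (map_adj_apply (f := i)).2 d.adj⟩
  have hf : Function.Bijective f := by
    refine ⟨fun d d' h => ?_, fun d => ?_⟩
    · have h₁ := congrArg Dart.toProd h
      obtain ⟨e₁, e₂⟩ := Prod.mk.injEq _ _ _ _ ▸ h₁
      exact Dart.ext _ _ (Prod.ext (i.injective e₁) (i.injective e₂))
    · obtain ⟨u, v, huv, hu, hv⟩ := (map_adj _ _ _ _).1 d.adj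
      exact ⟨⟨(u, v), huv⟩, Dart.ext _ _ (Prod.ext hu hv)⟩
  let e := Equiv.ofBijective f hf
  have hs : ∀ d, e d.symm = (e d).symm := fun d => rfl
  have hfst : ∀ d d', (e d).fst = (e d').fst ↔ d.fst = d'.fst := fun d d' => i.injective.eq_iff
  refine le_antisymm (eulerGenus_le_of_dart e hs hfst) (eulerGenus_le_of_dart e.symm ?_ ?_)
  · intro d
    rw [Equiv.symm_apply_eq, hs, e.apply_symm_apply]
  · intro d d'
    rw [← hfst, e.apply_symm_apply, e.apply_symm_apply]

end SimpleGraph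

/-! ### The Euler genus is additive over edge amalgamations -/

/-- `H` is obtained from `H₁` and `H₂`, which meet exactly in the two ends of the edge `xy`
that they have in common. -/
structure SimpleGraph.IsEdgeAmalgam {V : Type*} (H H₁ H₂ : SimpleGraph V) (x y : V) : Prop where
  eq_sup : H = H₁ ⊔ H₂
  adj₁ : H₁.Adj x y
  adj₂ : H₂.Adj x y
  meet : ∀ z u v, H₁.Adj z u → H₂.Adj z v → z = x ∨ z = y

namespace Pairing

variable {Φ : Type*} {Ψ : Type*}

/-- The disjoint union of two pairings. -/
def sum (w : Pairing Φ) (u : Pairing Ψ) : Pairing (Φ ⊕ Ψ) where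
  toFun := Sum.map w u
  invol f := by cases f <;> simp [w.invol, u.invol]
  ne f := by cases f <;> simp [w.ne, u.ne]

theorem comap_inl_gen_sum (a w : Pairing Φ) (c u : Pairing Ψ) :
    comap Sum.inl (gen (a.sum c) ⊔ gen (w.sum u)) = gen a ⊔ gen w :=
  comap_gen_sup Sum.inl_injective (a.sum c).invol (w.sum u).invol (fun _ => rfl) fun _ => rfl

theorem comap_inr_gen_sum (a w : Pairing Φ) (c u : Pairing Ψ) :
    comap Sum.inr (gen (a.sum c) ⊔ gen (w.sum u)) = gen c ⊔ gen u :=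
  comap_gen_sup Sum.inr_injective (a.sum c).invol (w.sum u).invol (fun _ => rfl) fun _ => rfl

theorem gen_sum_le (a w : Pairing Φ) (c u : Pairing Ψ) :
    gen (a.sum c) ⊔ gen (w.sum u) ≤ ker Sum.isLeft :=
  sup_le (gen_le_iff.2 (by rintro (f | f) <;> rfl)) (gen_le_iff.2 (by rintro (f | f) <;> rfl))

theorem numClasses_sum [Finite Φ] [Finite Ψ] (a w : Pairing Φ) (c u : Pairing Ψ) :
    (gen (a.sum c) ⊔ gen (w.sum u)).numClasses =
      (gen a ⊔ gen w).numClasses + (gen c ⊔ gen u).numClasses := by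
  rw [numClasses_eq_add _ (i := Sum.inl) (j := Sum.inr), comap_inl_gen_sum, comap_inr_gen_sum]
  · rintro (f | f)
    exacts [Or.inl ⟨f, rfl⟩, Or.inr ⟨f, rfl⟩]
  · intro f g hfg
    simpa [ker_def] using gen_sum_le _ _ _ _ hfg

theorem gen_sum_eq_ker {L : Type*} {b w : Pairing Φ} {c u : Pairing Ψ} {ℓ : Φ ⊕ Ψ → L}
    (h₁ : gen b ⊔ gen w = ker fun f => ℓ (Sum.inl f))
    (h₂ : gen c ⊔ gen u = ker fun f => ℓ (Sum.inr f)) :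
    gen (b.sum c) ⊔ gen (w.sum u) = ker fun f => (f.isLeft, ℓ f) := by
  rw [← comap_inl_gen_sum b w c u] at h₁
  rw [← comap_inr_gen_sum b w c u] at h₂
  ext f g
  constructor
  · intro h
    have hτ := ker_def.1 (gen_sum_le _ _ _ _ h)
    rw [ker_def, Prod.mk.injEq]
    refine ⟨hτ, ?_⟩
    rcases f with f | f <;> rcases g with g | g <;> simp at hτ
    · exact ker_def.1 (h₁ ▸ h : (ker fun f => ℓ (Sum.inl f)) f g)
    · exact ker_def.1 (h₂ ▸ h : (ker fun f => ℓ (Sum.inr f)) f g)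
  · intro h
    rw [ker_def, Prod.mk.injEq] at h
    obtain ⟨hτ, hℓ⟩ := h
    rcases f with f | f <;> rcases g with g | g <;> simp at hτ
    · exact (h₁.symm ▸ hℓ : comap Sum.inl (gen (b.sum c) ⊔ gen (w.sum u)) f g)
    · exact (h₂.symm ▸ hℓ : comap Sum.inr (gen (b.sum c) ⊔ gen (w.sum u)) f g)

end Pairing

namespace SimpleGraph.IsEdgeAmalgam

variable {V : Type u} {H H₁ H₂ : SimpleGraph V} {x y : V}

theorem adj (h : H.IsEdgeAmalgam H₁ H₂ x y) : H.Adj x y := h.eq_sup ▸ Or.inl h.adj₁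

theorem adj_or (h : H.IsEdgeAmalgam H₁ H₂ x y) {u v : V} (huv : H.Adj u v) :
    H₁.Adj u v ∨ H₂.Adj u v := by
  rwa [h.eq_sup] at huv

theorem eq_edge (h : H.IsEdgeAmalgam H₁ H₂ x y) {u v : V} (h₁ : H₁.Adj u v) (h₂ : H₂.Adj u v) :
    (u = x ∧ v = y) ∨ (u = y ∧ v = x) := by
  rcases h.meet u v v h₁ h₂ with rfl | rfl <;> rcases h.meet v _ _ h₁.symm h₂.symm with rfl | rfl
  · exact (h₁.ne rfl).elim
  · exact Or.inl ⟨rfl, rfl⟩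
  · exact Or.inr ⟨rfl, rfl⟩
  · exact (h₁.ne rfl).elim

/-- The darts of the two parts, as darts of the whole graph. -/
def dart (h : H.IsEdgeAmalgam H₁ H₂ x y) : H₁.Dart ⊕ H₂.Dart → H.Dart
  | .inl d => ⟨d.toProd, h.eq_sup ▸ Or.inl d.adj⟩
  | .inr d => ⟨d.toProd, h.eq_sup ▸ Or.inr d.adj⟩

theorem dart_surjective (h : H.IsEdgeAmalgam H₁ H₂ x y) : Function.Surjective h.dart := by
  rintro ⟨⟨u, v⟩, huv⟩
  rcases h.adj_or huv with h' | h'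
  · exact ⟨Sum.inl ⟨(u, v), h'⟩, rfl⟩
  · exact ⟨Sum.inr ⟨(u, v), h'⟩, rfl⟩

theorem meet_dart (h : H.IsEdgeAmalgam H₁ H₂ x y) (f g : H₁.Dart ⊕ H₂.Dart)
    (hfg : (h.dart f).fst = (h.dart g).fst) (hne : f.isLeft ≠ g.isLeft) :
    (h.dart f).fst = x ∨ (h.dart f).fst = y := by
  have key : ∀ (d : H₁.Dart) (d' : H₂.Dart), d.fst = d'.fst → d.fst = x ∨ d.fst = y := by
    intro d d' hd
    have h' := d'.adj
    rw [← hd] at h'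
    exact h.meet _ _ _ d.adj h'
  rcases f with d | d <;> rcases g with d' | d'
  · simp at hne
  · exact key d d' hfg
  · rw [hfg]
    exact key d' d hfg.symm
  · simp at hne

theorem card_edgeSet_add [Finite V] (h : H.IsEdgeAmalgam H₁ H₂ x y) :
    Nat.card H.edgeSet + 1 = Nat.card H₁.edgeSet + Nat.card H₂.edgeSet := by
  have h₁ : H.edgeSet = H₁.edgeSet ∪ H₂.edgeSet := by rw [h.eq_sup, edgeSet_sup]
  have h₂ : H₁.edgeSet ∩ H₂.edgeSet = {s(x, y)} := by
    ext e
    induction e with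
    | _ u v =>
      simp only [Set.mem_inter_iff, mem_edgeSet, Set.mem_singleton_iff, Sym2.eq_iff]
      refine ⟨fun ⟨h₁, h₂⟩ => h.eq_edge h₁ h₂, ?_⟩
      rintro (⟨rfl, rfl⟩ | ⟨rfl, rfl⟩)
      exacts [⟨h.adj₁, h.adj₂⟩, ⟨h.adj₁.symm, h.adj₂.symm⟩]
  have := Set.ncard_union_add_ncard_inter H₁.edgeSet H₂.edgeSet
  rw [← h₁, h₂, Set.ncard_singleton] at this
  exact this

/-- Isolated vertices cancel, so the count runs over darts. Compared with the disjoint union, the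
amalgam has one component, two vertices and one edge less, and -2 + 2 - 1 = -1. -/
theorem eulerNumber_add [Finite V] (h : H.IsEdgeAmalgam H₁ H₂ x y) :
    H.eulerNumber + 1 = H₁.eulerNumber + H₂.eulerNumber := by
  have := H₁.finite_dart
  have := H₂.finite_dart
  let a : H₁.Dart ⊕ H₂.Dart → H₁.Dart ⊕ H₂.Dart := Sum.map Dart.symm Dart.symm
  have ha : ∀ f, h.dart (a f) = (h.dart f).symm := by rintro (d | d) <;> rfl
  let ℓ : H₁.Dart ⊕ H₂.Dart → V := fun f => (h.dart f).fst
  let ψ : H₁.Dart ⊕ H₂.Dart → H₁.ConnectedComponent ⊕ H₂.ConnectedComponent :=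
    Sum.map (fun d => H₁.connectedComponentMk d.fst) fun d => H₂.connectedComponentMk d.fst
  have hsum : ∀ f : H₁.Dart ⊕ H₂.Dart, (∃ x, Sum.inl x = f) ∨ ∃ y, Sum.inr y = f := by
    rintro (f | f)
    exacts [Or.inl ⟨f, rfl⟩, Or.inr ⟨f, rfl⟩]
  have hψ₁ : comap Sum.inl (ker ψ) = ker fun d : H₁.Dart => H₁.connectedComponentMk d.fst := by
    ext d d'
    simp [ker_def, ψ]
  have hψ₂ : comap Sum.inr (ker ψ) = ker fun d : H₂.Dart => H₂.connectedComponentMk d.fst := by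
    ext d d'
    simp [ker_def, ψ]
  have hψ := numClasses_eq_add (ker ψ) hsum fun f g hfg => by simp [ker_def, ψ] at hfg
  rw [hψ₁, hψ₂] at hψ
  have hℓ := numClasses_eq_add (ker fun f => (f.isLeft, ℓ f)) hsum fun f g hfg => by
    simp [ker_def] at hfg
  have hℓ₁ : comap Sum.inl (ker fun f => (f.isLeft, ℓ f)) = ker fun d : H₁.Dart => d.fst := by
    ext d d'
    simp [ker_def, ℓ, dart]
  have hℓ₂ : comap Sum.inr (ker fun f => (f.isLeft, ℓ f)) = ker fun d : H₂.Dart => d.fst := by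
    ext d d'
    simp [ker_def, ℓ, dart]
  rw [hℓ₁, hℓ₂] at hℓ
  let p : H₁.Dart ⊕ H₂.Dart := Sum.inl ⟨(x, y), h.adj₁⟩
  let q : H₁.Dart ⊕ H₂.Dart := Sum.inr ⟨(x, y), h.adj₂⟩
  have h₁ := Pairing.numClasses_ker_prod (τ := Sum.isLeft) (ℓ := ℓ) (f₁ := p) (f₂ := q) (g₁ := a p)
    (g₂ := a q) rfl rfl rfl rfl rfl rfl h.adj.ne h.meet_dart
  have h₂ := Pairing.ker_prod_sup_pair (τ := Sum.isLeft) (ℓ := ℓ) (f₁ := p) (f₂ := q) (g₁ := a p)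
    (g₂ := a q) rfl rfl rfl rfl rfl rfl h.meet_dart
  have hψ' : gen a ⊔ (ker fun f => (f.isLeft, ℓ f)) = ker ψ := by
    refine le_antisymm (sup_le (gen_le_iff.2 ?_) ?_) ?_
    · rintro (d | d)
      · exact congrArg Sum.inl (ConnectedComponent.sound d.adj.reachable)
      · exact congrArg Sum.inr (ConnectedComponent.sound d.adj.reachable)
    · rintro (d | d) (d' | d') hd <;> simp only [ker_def, Prod.mk.injEq] at hd
      · exact congrArg (fun v => Sum.inl (H₁.connectedComponentMk v)) hd.2
      · simp at hd
      · simp at hd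
      · exact congrArg (fun v => Sum.inr (H₂.connectedComponentMk v)) hd.2
    · have k₁ := ker_connectedComponentMk (G := H₁) (D := id) Function.surjective_id
        (a := Dart.symm) fun _ => rfl
      have k₂ := ker_connectedComponentMk (G := H₂) (D := id) Function.surjective_id
        (a := Dart.symm) fun _ => rfl
      have l₁ : gen Dart.symm ⊔ (ker fun d : H₁.Dart => d.fst) ≤
          comap Sum.inl (gen a ⊔ (ker fun f => (f.isLeft, ℓ f))) := by
        refine sup_le (gen_le_iff.2 fun d => left_apply (gen_apply a (Sum.inl d))) ?_
        rw [← hℓ₁]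
        exact fun {f g} hfg => right_apply hfg
      have l₂ : gen Dart.symm ⊔ (ker fun d : H₂.Dart => d.fst) ≤
          comap Sum.inr (gen a ⊔ (ker fun f => (f.isLeft, ℓ f))) := by
        refine sup_le (gen_le_iff.2 fun d => left_apply (gen_apply a (Sum.inr d))) ?_
        rw [← hℓ₂]
        exact fun {f g} hfg => right_apply hfg
      rintro (d | d) (d' | d') hd
      · exact l₁ ((k₁.symm ▸ Sum.inl.inj hd :
          (gen Dart.symm ⊔ (ker fun d : H₁.Dart => d.fst)) d d'))
      · cases hd
      · cases hd
      · exact l₂ ((k₂.symm ▸ Sum.inr.inj hd :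
          (gen Dart.symm ⊔ (ker fun d : H₂.Dart => d.fst)) d d'))
  have hc : ker (fun f => H.connectedComponentMk (h.dart f).fst) = ker ψ ⊔ pair p q := by
    rw [← ker_connectedComponentMk h.dart_surjective ha, ← hψ']
    change gen a ⊔ ker ℓ = _
    rw [← h₂]
    refine le_antisymm (sup_le (le_sup_left.trans le_sup_left) (sup_le (sup_le ?_ ?_) ?_))
      (sup_le (sup_le le_sup_left ?_) ?_)
    · exact le_sup_right.trans le_sup_left
    · exact le_sup_right
    -- For components, the gluing at `y` follows from the one at `x` along the common edge.
    · refine pair_le_iff.2 ?_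
      have e : ∀ f, (gen a ⊔ (ker fun f => (f.isLeft, ℓ f)) ⊔ pair p q) f (a f) := fun f =>
        left_apply (left_apply (gen_apply a f))
      exact Setoid.trans' _ (Setoid.symm' _ (e p)) (Setoid.trans' _
        (right_apply (pair_apply p q)) (e q))
    · exact (le_sup_left.trans le_sup_left).trans le_sup_right
    · exact (le_sup_right.trans le_sup_left).trans le_sup_right
  have h₃ := numClasses_sup_pair (ker ψ) (p := p) (q := q) (by simp [ker_def, ψ, p, q])
  have v₀ := card_eq_isolated_add h.dart_surjective
  have v₁ := card_eq_isolated_add (G := H₁) (D := id) Function.surjective_id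
  have v₂ := card_eq_isolated_add (G := H₂) (D := id) Function.surjective_id
  have c₀ := card_connectedComponent h.dart_surjective
  have c₁ := card_connectedComponent (G := H₁) (D := id) Function.surjective_id
  have c₂ := card_connectedComponent (G := H₂) (D := id) Function.surjective_id
  have e₀ := h.card_edgeSet_add
  rw [hc] at c₀
  change _ = _ + (ker ℓ).numClasses at v₀
  simp only [id] at v₁ v₂ c₁ c₂
  unfold eulerNumber
  omega

/-- An embedding of an edge amalgamation yields embeddings of the two parts. -/
theorem eulerGenus_add_le [Finite V] (h : H.IsEdgeAmalgam H₁ H₂ x y) :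
    H₁.eulerGenus + H₂.eulerGenus ≤ H.eulerGenus := by
  classical
  have := H.finite_dart
  obtain ⟨P, hP⟩ := H.exists_flagSystem
  have hS := P.flagSystem
  let e₀ : H.Dart := ⟨(x, y), h.adj⟩
  -- `a₀` and `b₀` describe a single edge, which is to become a second copy of `xy`. Its ends have
  -- degree one, so `b₀` is also its corner pairing.
  let a₀ : Pairing (Bool × ℤˣ) := ⟨fun t => (!t.1, t.2), fun t => by simp,
    fun t e => by simpa using congrArg Prod.fst e⟩
  let b₀ : Pairing (Bool × ℤˣ) :=
    ⟨fun t => (t.1, -t.2), fun t => by simp,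
      fun t e => GraphEmbedding.units_ne_neg t.2 (congrArg Prod.snd e)⟩
  let a := P.sidePairing.sum a₀
  let b := (GraphEmbedding.edgePairing H).sum b₀
  let D : (H.Dart × ℤˣ) ⊕ (Bool × ℤˣ) → H.Dart :=
    Sum.elim Prod.fst fun t => if t.1 then e₀ else e₀.symm
  let ℓ : (H.Dart × ℤˣ) ⊕ (Bool × ℤˣ) → V := fun f => (D f).fst
  -- The original edge `xy` is assigned to `H₁` and its copy to `H₂`.
  let τ : (H.Dart × ℤˣ) ⊕ (Bool × ℤˣ) → Bool :=
    Sum.elim (fun f => decide (H₁.Adj f.1.fst f.1.snd)) fun _ => false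
  have hDa : ∀ f, D (a f) = (D f).symm := by
    rintro (f | ⟨_ | _, s⟩) <;> rfl
  have hDb : ∀ f, D (b f) = D f := by
    rintro (f | ⟨_ | _, s⟩) <;> rfl
  have hab : ∀ f, a (b f) = b (a f) := by
    rintro (f | f)
    · exact congrArg Sum.inl (hS.comm f)
    · rfl
  have haτ : ∀ f, τ (a f) = τ f := by
    rintro (f | f)
    · exact decide_eq_decide.2 (H₁.adj_comm _ _)
    · rfl
  have hbτ : ∀ f, τ (b f) = τ f := by
    rintro (f | f) <;> rfl
  have hb₀ : ∀ t s s', (gen b₀ ⊔ gen b₀) (t, s) (t, s') := by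
    intro t s s'
    rcases units_eq_or_eq_neg s' s with rfl | rfl
    · exact Setoid.refl' _ _
    · exact left_apply (gen_apply b₀ (t, s))
  have hw : gen b ⊔ gen (P.cornerPairing.sum b₀) = ker fun f => (f.isLeft, ℓ f) := by
    refine Pairing.gen_sum_eq_ker hS.vertex (le_antisymm (sup_le ?_ ?_) ?_)
    · exact gen_le_iff.2 fun t => rfl
    · exact gen_le_iff.2 fun t => rfl
    · rintro ⟨t, s⟩ ⟨t', s'⟩ ht
      have : t = t' := by
        rw [ker_def] at ht
        cases t <;> cases t'
        · rfl
        · exact (h.adj.ne (by simpa [ℓ, D, e₀] using ht.symm)).elim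
        · exact (h.adj.ne (by simpa [ℓ, D, e₀] using ht)).elim
        · rfl
      subst this
      exact hb₀ _ _ _
  have hxy : ∀ t : Bool × ℤˣ, ℓ (Sum.inr t) = x ∨ ℓ (Sum.inr t) = y := by
    rintro ⟨_ | _, s⟩
    exacts [Or.inr rfl, Or.inl rfl]
  obtain ⟨v, hv, hvle, -, -⟩ := Pairing.exists_glued (a := a) (p := Sum.inl (e₀, 1))
    (q := Sum.inr (true, 1)) (by rintro (f | f) <;> rfl) hw rfl rfl rfl rfl h.adj.ne (by
      rintro (f | f) (g | g) hfg hne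
      · simp at hne
      · rw [hfg]; exact hxy g
      · exact hxy f
      · simp at hne)
  have hτ₁ : ∀ f, τ f = true → H₁.Adj (D f).fst (D f).snd := by
    rintro (f | f) hf
    · exact of_decide_eq_true hf
    · simp [τ] at hf
  have hτ₂ : ∀ f, τ f = false → H₂.Adj (D f).fst (D f).snd := by
    rintro (f | ⟨_ | _, s⟩) hf
    · exact (h.adj_or f.1.adj).resolve_left (of_decide_eq_false hf)
    · exact h.adj₂.symm
    · exact h.adj₂
  have hτx : τ (Sum.inl (e₀, 1)) = true := by simpa [τ, e₀] using h.adj₁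
  obtain ⟨w, hw, hwle⟩ := Pairing.exists_split (a := a) (b := b) (v := v) (τ := τ) (ℓ := ℓ)
    (f₁ := Sum.inl (e₀, 1)) (f₂ := Sum.inr (true, 1)) (g₁ := a (Sum.inl (e₀, 1)))
    (g₂ := Sum.inr (false, 1)) haτ hbτ hv hτx rfl rfl (by rw [haτ, hτx]) rfl rfl h.adj.ne (by
      have key : ∀ f g, ℓ f = ℓ g → τ f = true → τ g = false → ℓ f = x ∨ ℓ f = y := by
        intro f g hfg hf hg
        have h₂ := hτ₂ g hg
        rw [← show (D f).fst = (D g).fst from hfg] at h₂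
        exact h.meet _ _ _ (hτ₁ f hf) h₂
      intro f g hfg hne
      rcases hf : τ f with _ | _ <;> rcases hg : τ g with _ | _
      · simp [hf, hg] at hne
      · rw [hfg]; exact key g f hfg.symm hg hf
      · exact key f g hfg hf hg
      · simp [hf, hg] at hne)
  have hwτ : ∀ f, τ (w f) = τ f := fun f => by
    have := ker_def.1 ((hw ▸ le_sup_right : gen w ≤ _) (gen_apply w f))
    exact (congrArg Prod.fst this).symm
  -- As `w` respects `τ`, the flags of each colour form an embedding of their own.
  have part : ∀ (t : Bool) (K : SimpleGraph V) (hK : ∀ f, τ f = t → K.Adj (D f).fst (D f).snd),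
      (∀ d : K.Dart, ∃ f, τ f = t ∧ (D f).toProd = d.toProd) →
      (∀ f g, τ f = t → τ g = t → D f = D g → g = f ∨ g = b f) →
      FlagSystem K (a.restrict (fun f => τ f = t) fun f hf => (haτ f).trans hf)
        (b.restrict (fun f => τ f = t) fun f hf => (hbτ f).trans hf)
        (w.restrict (fun f => τ f = t) fun f hf => (hwτ f).trans hf)
        fun f => ⟨(D f.1).toProd, hK f.1 f.2⟩ := by
    intro t K hK hsurj hfib
    constructor
    · intro d
      obtain ⟨f, hf, hd⟩ := hsurj d
      exact ⟨⟨f, hf⟩, Dart.ext _ _ hd⟩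
    · intro f g hfg
      rcases hfib f.1 g.1 f.2 g.2 (Dart.ext _ _ (by simpa using hfg)) with e | e
      exacts [Or.inl (Subtype.ext e), Or.inr (Subtype.ext e)]
    · exact fun f => Dart.ext _ _ (congrArg (fun d => d.toProd) (hDb f.1))
    · exact fun f => Dart.ext _ _ (congrArg (fun d => d.toProd) (hDa f.1))
    · exact fun f => Subtype.ext (hab f.1)
    · rw [← comap_gen_sup Subtype.val_injective b.invol w.invol (fun _ => rfl) fun _ => rfl, hw]
      ext f g
      rw [comap_rel, ker_def, ker_def, Prod.mk.injEq]
      exact ⟨fun e => e.2, fun e => ⟨f.2.trans g.2.symm, e⟩⟩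
  have hfib : ∀ d s s', (Sum.inl (d, s') : (H.Dart × ℤˣ) ⊕ (Bool × ℤˣ)) = Sum.inl (d, s) ∨
      Sum.inl (d, s') = b (Sum.inl (d, s)) := by
    intro d s s'
    rcases units_eq_or_eq_neg s' s with rfl | rfl
    exacts [Or.inl rfl, Or.inr rfl]
  have hF₁ := part true H₁ hτ₁ (fun d => ⟨Sum.inl (⟨d.toProd, h.eq_sup ▸ Or.inl d.adj⟩, 1),
    by simp [τ], rfl⟩) (by
      rintro (⟨d, s⟩ | f) (⟨d', s'⟩ | g) hf hg hfg
      · obtain rfl : d = d' := hfg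
        exact hfib _ _ _
      all_goals simp [τ] at hf hg)
  have hF₂ := part false H₂ hτ₂ (fun d => by
      by_cases hd : H₁.Adj d.fst d.snd
      · rcases h.eq_edge hd d.adj with ⟨e₁, e₂⟩ | ⟨e₁, e₂⟩
        · exact ⟨Sum.inr (true, 1), rfl, Prod.ext e₁.symm e₂.symm⟩
        · exact ⟨Sum.inr (false, 1), rfl, Prod.ext e₁.symm e₂.symm⟩
      · exact ⟨Sum.inl (⟨d.toProd, h.eq_sup ▸ Or.inr d.adj⟩, 1), by simpa [τ] using hd, rfl⟩) (by
      have key : ∀ (d : H.Dart) (s : ℤˣ) t, τ (Sum.inl (d, s)) = false → d ≠ D (Sum.inr t) := by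
        rintro d s ⟨_ | _, s'⟩ hd rfl
        · simp only [τ, Sum.elim_inl, decide_eq_false_iff_not] at hd
          exact hd h.adj₁.symm
        · simp only [τ, Sum.elim_inl, decide_eq_false_iff_not] at hd
          exact hd h.adj₁
      rintro (⟨d, s⟩ | ⟨t, s⟩) (⟨d', s'⟩ | ⟨t', s'⟩) hf hg hfg
      · obtain rfl : d = d' := hfg
        exact hfib _ _ _
      · exact (key d s _ hf hfg).elim
      · exact (key d' s' _ hg hfg.symm).elim
      · have : t = t' := by
          have := congrArg (fun d => d.fst) hfg
          cases t <;> cases t'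
          · rfl
          · exact (h.adj.ne this.symm).elim
          · exact (h.adj.ne this).elim
          · rfl
        subst this
        rcases units_eq_or_eq_neg s' s with rfl | rfl
        exacts [Or.inl rfl, Or.inr rfl])
  have hle₁ := hF₁.eulerGenus_le
  have hle₂ := hF₂.eulerGenus_le
  have hsplit := numClasses_eq_add (gen a ⊔ gen w) (i := fun f : {f // τ f = true} => f.1)
    (j := fun f : {f // τ f = false} => f.1) (fun f => by
      rcases hf : τ f with _ | _
      exacts [Or.inr ⟨⟨f, hf⟩, rfl⟩, Or.inl ⟨⟨f, hf⟩, rfl⟩]) (fun f g hfg => by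
      have hle : gen a ⊔ gen w ≤ ker τ := sup_le (gen_le_iff.2 fun f => (haτ f).symm)
        (gen_le_iff.2 fun f => (hwτ f).symm)
      have := ker_def.1 (hle hfg)
      rw [f.2, g.2] at this
      cases this)
  rw [comap_gen_sup Subtype.val_injective a.invol w.invol
      (a' := a.restrict (fun f => τ f = true) fun f hf => (haτ f).trans hf)
      (w' := w.restrict (fun f => τ f = true) fun f hf => (hwτ f).trans hf) (fun _ => rfl)
      fun _ => rfl,
    comap_gen_sup Subtype.val_injective a.invol w.invol
      (a' := a.restrict (fun f => τ f = false) fun f hf => (haτ f).trans hf)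
      (w' := w.restrict (fun f => τ f = false) fun f hf => (hwτ f).trans hf) (fun _ => rfl)
      fun _ => rfl] at hsplit
  have hsum := Pairing.numClasses_sum P.sidePairing P.cornerPairing a₀ b₀
  -- The face of the added edge compensates for the 1 in `eulerNumber_add`.
  have hpos : 0 < (gen a₀ ⊔ gen b₀).numClasses :=
    Nat.card_pos_iff.2 ⟨⟨Quotient.mk _ (true, 1)⟩, inferInstance⟩
  have hnum := h.eulerNumber_add
  change (gen a ⊔ gen _).numClasses = _ at hsum
  omega

end SimpleGraph.IsEdgeAmalgam

namespace SimpleGraph.IsEdgeAmalgam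

variable {V : Type u} {H H₁ H₂ : SimpleGraph V} {x y : V}

/-- Embeddings of the two parts yield an embedding of their edge amalgamation. -/
theorem eulerGenus_le_add [Finite V] (h : H.IsEdgeAmalgam H₁ H₂ x y) :
    H.eulerGenus ≤ H₁.eulerGenus + H₂.eulerGenus := by
  classical
  have := H₁.finite_dart
  have := H₂.finite_dart
  obtain ⟨P₁, hP₁⟩ := H₁.exists_flagSystem
  obtain ⟨P₂, hP₂⟩ := H₂.exists_flagSystem
  have hS₁ := P₁.flagSystem
  have hS₂ := P₂.flagSystem
  let Φ := (H₁.Dart × ℤˣ) ⊕ (H₂.Dart × ℤˣ)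
  let a : Pairing Φ := P₁.sidePairing.sum P₂.sidePairing
  let b : Pairing Φ := (GraphEmbedding.edgePairing H₁).sum (GraphEmbedding.edgePairing H₂)
  let D : Φ → H.Dart := fun f => h.dart (Sum.map Prod.fst Prod.fst f)
  have hDa : ∀ f, D (a f) = (D f).symm := by rintro (f | f) <;> rfl
  have hDb : ∀ f, D (b f) = D f := by rintro (f | f) <;> rfl
  have hτa : ∀ f, (a f).isLeft = f.isLeft := by rintro (f | f) <;> rfl
  have hτb : ∀ f, (b f).isLeft = f.isLeft := by rintro (f | f) <;> rfl
  obtain ⟨p, hp⟩ : ∃ p : Φ, p = Sum.inl (⟨(x, y), h.adj₁⟩, 1) := ⟨_, rfl⟩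
  obtain ⟨q, hq⟩ : ∃ q : Φ, q = Sum.inr (⟨(x, y), h.adj₂⟩, 1) := ⟨_, rfl⟩
  let e₀ : H.Dart := ⟨(x, y), h.adj⟩
  have he₀ : e₀.symm ≠ e₀ := e₀.symm_ne
  have hDp : D p = e₀ := by rw [hp]; rfl
  have hDq : D q = e₀ := by rw [hq]; rfl
  have hDap : D (a p) = e₀.symm := by rw [hDa, hDp]
  have hDaq : D (a q) = e₀.symm := by rw [hDa, hDq]
  have hτp : p.isLeft = true := by rw [hp]; rfl
  have hτq : q.isLeft = false := by rw [hq]; rfl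
  have hw : gen b ⊔ gen (P₁.cornerPairing.sum P₂.cornerPairing) =
      ker fun f => (f.isLeft, (D f).fst) :=
    Pairing.gen_sum_eq_ker (ℓ := fun f => (D f).fst) hS₁.vertex hS₂.vertex
  obtain ⟨v, hv, hvle, hvp, hvp'⟩ := Pairing.exists_glued (a := a) (ℓ := fun f => (D f).fst)
    (p := p) (q := q) hτa hw hτp hτq (by rw [hDp, hDq]) (by rw [hDap, hDaq])
    (by rw [hDp, hDap]; exact h.adj.ne) (by
      intro f g hfg hne
      rw [hDp, hDap]
      exact h.meet_dart _ _ hfg (by simpa using hne))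
  have hpq : p ≠ q := fun e => by simp [e, hτq] at hτp
  have hapq : a p ≠ a q := fun e => hpq (a.injective e)
  have hneD : ∀ {f g : Φ}, D f = e₀ → D g = e₀.symm → f ≠ g := fun hf hg e =>
    he₀ (hg.symm.trans ((congrArg D e).symm.trans hf))
  have hneD' : ∀ {f g : Φ}, D f = e₀.symm → D g = e₀ → f ≠ g := fun hf hg e =>
    hneD hg hf e.symm
  -- The flags outside `S` are the inner sides of the digon between the two copies of `xy`.
  let S : Φ → Prop := fun f => f ≠ p ∧ f ≠ q ∧ f ≠ a p ∧ f ≠ a q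
  have hS : ∀ {f}, ¬ S f → f = p ∨ f = q ∨ f = a p ∨ f = a q := by
    intro f hf
    simp only [S] at hf
    tauto
  have hSb : ∀ f, ¬ S f → S (b f) := by
    intro f hf
    by_contra hbf
    refine b.ne f ?_
    have h₁ := hDb f
    have h₂ := hτb f
    rcases hS hf with rfl | rfl | rfl | rfl <;> rcases hS hbf with e | e | e | e <;>
      simp only [e, hDp, hDq, hDap, hDaq, hτa, hτp, hτq] at h₁ h₂ ⊢ <;>
      first | exact (he₀ h₁).elim | exact (he₀ h₁.symm).elim | cases h₂
  -- Pairing the inner sides `p` and `q` with each other also pairs the outer sides `b p` and `b q`,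
  -- and likewise at the other end. Without the inner sides, the two copies have become one edge.
  let b₁ : Pairing Φ := b.swap p q
  let b₂ : Pairing Φ := b₁.swap (a p) (a q)
  have hDb₁ : ∀ f, D (b₁ f) = D f := Pairing.swap_preserves b hpq hDb (by rw [hDp, hDq])
  have hDb₂ : ∀ f, D (b₂ f) = D f :=
    Pairing.swap_preserves b₁ hapq hDb₁ (by rw [hDap, hDaq])
  have hb₁ap : b₁ (a p) = b (a p) := Pairing.swap_of_ne _ (hneD' hDap hDp) (hneD' hDap hDq)
    (hneD' hDap (by rw [hDb, hDp])) (hneD' hDap (by rw [hDb, hDq]))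
  have hb₁aq : b₁ (a q) = b (a q) := Pairing.swap_of_ne _ (hneD' hDaq hDp) (hneD' hDaq hDq)
    (hneD' hDaq (by rw [hDb, hDp])) (hneD' hDaq (by rw [hDb, hDq]))
  have hb₂₁ : ∀ f, D f = e₀ → b₂ f = b₁ f := fun f hf => Pairing.swap_of_ne _ (hneD hf hDap)
    (hneD hf hDaq) (hneD hf (by rw [hDb₁, hDap])) (hneD hf (by rw [hDb₁, hDaq]))
  have hb₂p : b₂ p = q := (hb₂₁ p hDp).trans (Pairing.swap_left _ hpq)
  have hb₂ap : b₂ (a p) = a q := Pairing.swap_left _ hapq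
  have hb₂bp : b₂ (b p) = b q :=
    (hb₂₁ _ (by rw [hDb, hDp])).trans (Pairing.swap_partner_left _ hpq)
  have hb₂bap : b₂ (b (a p)) = b (a q) := by
    rw [← hb₁ap, ← hb₁aq]
    exact Pairing.swap_partner_left _ hapq
  have hb₂ : ∀ f, S f → S (b f) → b₂ f = b f := by
    intro f hf hbf
    have e₁ : b₁ f = b f := Pairing.swap_of_ne _ hf.1 hf.2.1
      (fun e => hbf.1 (b.eq_comm_iff.2 e)) (fun e => hbf.2.1 (b.eq_comm_iff.2 e))
    rw [← e₁]
    refine Pairing.swap_of_ne _ hf.2.2.1 hf.2.2.2 ?_ ?_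
    · rw [hb₁ap]
      exact fun e => hbf.2.2.1 (b.eq_comm_iff.2 e)
    · rw [hb₁aq]
      exact fun e => hbf.2.2.2 (b.eq_comm_iff.2 e)
  have closed : ∀ u : Pairing Φ, (∀ f, ¬ S f → ¬ S (u f)) → ∀ f, S f → S (u f) := by
    intro u hu f hf
    by_contra huf
    have := hu _ huf
    rw [u.invol] at this
    exact this hf
  have hbS : ∀ f, S f → S (b₂ f) := closed b₂ (by
    intro f hf
    rcases hS hf with rfl | rfl | rfl | rfl
    · simp [S, hb₂p]
    · simp [S, ← hb₂p, b₂.invol]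
    · simp [S, hb₂ap]
    · rw [← hb₂ap]; simp [S, b₂.invol])
  have hvS : ∀ f, S f → S (v f) := closed v (by
    intro f hf
    rcases hS hf with rfl | rfl | rfl | rfl
    · simp [S, hvp]
    · simp [S, ← hvp, v.invol]
    · simp [S, hvp']
    · rw [← hvp']; simp [S, v.invol])
  have haS : ∀ f, S f → S (a f) := closed a (by
    intro f hf
    rcases hS hf with rfl | rfl | rfl | rfl <;> simp [S, a.invol])
  have hinl : ∀ d s s', (Sum.inl (d, s') : Φ) = Sum.inl (d, s) ∨
      (Sum.inl (d, s') : Φ) = b (Sum.inl (d, s)) := by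
    intro d s s'
    rcases units_eq_or_eq_neg s' s with rfl | rfl
    exacts [Or.inl rfl, Or.inr rfl]
  have hinr : ∀ d s s', (Sum.inr (d, s') : Φ) = Sum.inr (d, s) ∨
      (Sum.inr (d, s') : Φ) = b (Sum.inr (d, s)) := by
    intro d s s'
    rcases units_eq_or_eq_neg s' s with rfl | rfl
    exacts [Or.inl rfl, Or.inr rfl]
  have hfib₀ : ∀ f g : Φ, f.isLeft = g.isLeft → D f = D g → g = f ∨ g = b f := by
    rintro (⟨d, s⟩ | ⟨d, s⟩) (⟨d', s'⟩ | ⟨d', s'⟩) hτ hfg <;> simp at hτ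
    · obtain rfl : d = d' := Dart.ext _ _ (congrArg (fun d => d.toProd) hfg)
      exact hinl _ _ _
    · obtain rfl : d = d' := Dart.ext _ _ (congrArg (fun d => d.toProd) hfg)
      exact hinr _ _ _
  have hmix : ∀ f g : Φ, S f → S g → f.isLeft = true → g.isLeft = false → D f = D g →
      g = b₂ f := by
    intro f g hf hg hτf hτg hfg
    have hcase : D f = e₀ ∨ D f = e₀.symm := by
      rcases f with ⟨d, s⟩ | f
      · rcases g with g | ⟨d', s'⟩
        · cases hτg
        · have hdd : d.toProd = d'.toProd := congrArg (fun d => d.toProd) hfg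
          have h₂ := d'.adj
          rw [← hdd] at h₂
          rcases h.eq_edge d.adj h₂ with ⟨e₁, e₂⟩ | ⟨e₁, e₂⟩
          · exact Or.inl (Dart.ext _ _ (Prod.ext e₁ e₂))
          · exact Or.inr (Dart.ext _ _ (Prod.ext e₁ e₂))
      · cases hτf
    rcases hcase with e | e
    · have e₁ := (hfib₀ p f (by rw [hτf, hτp]) (by rw [hDp, e])).resolve_left hf.1
      have e₂ := (hfib₀ q g (by rw [hτg, hτq]) (by rw [hDq, ← hfg, e])).resolve_left hg.2.1
      rw [e₁, e₂, hb₂bp]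
    · have e₁ := (hfib₀ (a p) f (by rw [hτf, hτa, hτp]) (by rw [hDap, e])).resolve_left hf.2.2.1
      have e₂ := (hfib₀ (a q) g (by rw [hτg, hτa, hτq])
        (by rw [hDaq, ← hfg, e])).resolve_left hg.2.2.2
      rw [e₁, e₂, hb₂bap]
  have hfib : ∀ f g : Φ, S f → S g → D f = D g → g = f ∨ g = b₂ f := by
    intro f g hf hg hfg
    rcases hτf : f.isLeft with _ | _ <;> rcases hτg : g.isLeft with _ | _
    · rcases hfib₀ f g (by rw [hτf, hτg]) hfg with rfl | rfl
      exacts [Or.inl rfl, Or.inr (hb₂ f hf hg).symm]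
    · refine Or.inr ?_
      rw [← b₂.eq_comm_iff]
      exact (hmix g f hg hf hτg hτf hfg.symm).symm
    · exact Or.inr (hmix f g hf hg hτf hτg hfg)
    · rcases hfib₀ f g (by rw [hτf, hτg]) hfg with rfl | rfl
      exacts [Or.inl rfl, Or.inr (hb₂ f hf hg).symm]
  have hvℓ : ∀ f, (D (v f)).fst = (D f).fst := fun f =>
    (ker_def.1 ((hv ▸ le_sup_right : gen v ≤ ker fun f => (D f).fst) (gen_apply v f))).symm
  have hF : FlagSystem H (a.restrict S haS) (b₂.restrict S hbS) (v.restrict S hvS)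
      fun f => D f.1 := by
    constructor
    · intro d
      obtain ⟨d', hd'⟩ := h.dart_surjective d
      obtain ⟨f, hf⟩ : ∃ f, D f = d := by
        rcases d' with d' | d'
        · exact ⟨Sum.inl (d', 1), hd'⟩
        · exact ⟨Sum.inr (d', 1), hd'⟩
      by_cases hfS : S f
      · exact ⟨⟨f, hfS⟩, hf⟩
      · exact ⟨⟨b f, hSb f hfS⟩, (hDb f).trans hf⟩
    · intro f g hfg
      rcases hfib f.1 g.1 f.2 g.2 hfg with e | e
      exacts [Or.inl (Subtype.ext e), Or.inr (Subtype.ext e)]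
    · exact fun f => hDb₂ f.1
    · exact fun f => hDa f.1
    · intro f
      refine Subtype.ext ?_
      change a (b₂ f.1) = b₂ (a f.1)
      rcases hfib (b₂ (a f.1)) (a (b₂ f.1)) (hbS _ (haS _ f.2)) (haS _ (hbS _ f.2))
        (by rw [hDb₂, hDa, hDa, hDb₂]) with e | e
      · exact e
      · rw [b₂.invol] at e
        exact (b₂.ne _ (a.injective e)).elim
    · refine le_antisymm (sup_le (gen_le_iff.2 fun f => ?_) (gen_le_iff.2 fun f => ?_)) ?_
      · exact congrArg (fun d => d.fst) (hDb₂ f.1).symm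
      · exact (hvℓ f.1).symm
      -- This retraction replaces a removed flag by the outer side of the same copy of `xy`. It
      -- carries the vertices of the glued system to those of the remaining one, so the removal does
      -- not split a vertex.
      let ρ : Φ → {f // S f} := fun f => if hf : S f then ⟨f, hf⟩ else ⟨b f, hSb f hf⟩
      have hρ : ∀ {f} (hf : S f), ρ f = ⟨f, hf⟩ := fun hf => by simp only [ρ, dif_pos hf]
      have hρ' : ∀ {f} (hf : ¬ S f), ρ f = ⟨b f, hSb f hf⟩ := fun hf => by
        simp only [ρ, dif_neg hf]
      have hle : gen b ⊔ gen v ≤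
          comap ρ (gen (b₂.restrict S hbS) ⊔ gen (v.restrict S hvS)) := by
        refine sup_le (gen_le_iff.2 fun f => ?_) (gen_le_iff.2 fun f => ?_) <;> rw [comap_rel]
        · by_cases hf : S f
          · by_cases hbf : S (b f)
            · rw [hρ hf, hρ hbf]
              have := gen_apply (b₂.restrict S hbS) ⟨f, hf⟩
              rw [show b₂.restrict S hbS ⟨f, hf⟩ = ⟨b f, hbf⟩ from
                Subtype.ext (hb₂ f hf hbf)] at this
              exact left_apply this
            · rw [hρ hf, hρ' hbf]
              simp only [b.invol]
              exact Setoid.refl' _ _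
          · rw [hρ' hf, hρ (hSb f hf)]
        · by_cases hf : S f
          · rw [hρ hf, hρ (hvS f hf)]
            exact right_apply (gen_apply (v.restrict S hvS) ⟨f, hf⟩)
          · have hlink : ∀ f g : Φ, ¬ S f → ¬ S g → b₂ (b f) = b g →
                (gen (b₂.restrict S hbS) ⊔ gen (v.restrict S hvS)) (ρ f) (ρ g) := by
              intro f g hf hg hfg
              have := gen_apply (b₂.restrict S hbS) ⟨b f, hSb f hf⟩
              rw [show b₂.restrict S hbS ⟨b f, hSb f hf⟩ = ⟨b g, hSb g hg⟩ from
                Subtype.ext hfg] at this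
              rw [hρ' hf, hρ' hg]
              exact left_apply this
            have hvf : ¬ S (v f) := fun h' => hf (by
              have := hvS _ h'
              rwa [v.invol] at this)
            refine hlink f (v f) hf hvf ?_
            rcases hS hf with rfl | rfl | rfl | rfl
            · rw [hvp, hb₂bp]
            · rw [← v.eq_comm_iff.1 hvp, b₂.eq_comm_iff, hb₂bp]
            · rw [hvp', hb₂bap]
            · rw [← v.eq_comm_iff.1 hvp', b₂.eq_comm_iff, hb₂bap]
      intro f g hfg
      have := hle (hv.symm ▸ hfg : (gen b ⊔ gen v) f.1 g.1)
      rwa [comap_rel, hρ f.2, hρ g.2] at this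
  have hsplit := numClasses_eq_add (gen a ⊔ gen v) (i := fun f : {f // S f} => f.1)
    (j := fun f : {f // ¬ S f} => f.1) (fun f => by
      by_cases hf : S f
      exacts [Or.inl ⟨⟨f, hf⟩, rfl⟩, Or.inr ⟨⟨f, hf⟩, rfl⟩])
    (fun f g hfg => g.2 (Pairing.mem_of_rel haS hvS hfg f.2))
  rw [comap_gen_sup Subtype.val_injective a.invol v.invol (a' := a.restrict S haS)
    (w' := v.restrict S hvS) (fun _ => rfl) fun _ => rfl] at hsplit
  -- The digon is the only face lost, which matches the 1 in `eulerNumber_add`.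
  have hone : (comap (fun f : {f // ¬ S f} => f.1) (gen a ⊔ gen v)).numClasses ≤ 1 := by
    refine (Pairing.numClasses_le_card (φ := fun _ => ()) fun f g _ => ?_).trans (by simp)
    have key : ∀ f : {f // ¬ S f}, (gen a ⊔ gen v) p f.1 := by
      have h₁ : (gen a ⊔ gen v) p q := hvp ▸ Pairing.rel_partner v _ p
      rintro ⟨f, hf⟩
      rcases hS hf with rfl | rfl | rfl | rfl
      · exact Setoid.refl' _ _
      · exact h₁
      · exact left_apply (gen_apply a p)
      · exact Setoid.trans' _ h₁ (left_apply (gen_apply a q))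
    change (gen a ⊔ gen v) f.1 g.1
    exact Setoid.trans' _ (Setoid.symm' _ (key f)) (key g)
  have hle := hF.eulerGenus_le
  have hsum := Pairing.numClasses_sum P₁.sidePairing P₁.cornerPairing P₂.sidePairing
    P₂.cornerPairing
  have hnum := h.eulerNumber_add
  change (gen a ⊔ gen _).numClasses = _ at hsum
  omega

/-- The Euler genus is additive over edge amalgamations. -/
theorem eulerGenus_eq_add [Finite V] (h : H.IsEdgeAmalgam H₁ H₂ x y) :
    H.eulerGenus = H₁.eulerGenus + H₂.eulerGenus :=
  le_antisymm h.eulerGenus_le_add h.eulerGenus_add_le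

end SimpleGraph.IsEdgeAmalgam

/-! ### Additivity of ĝ⁺ and criticality of `xy`-sums -/

namespace TermGraph

open SimpleGraph

variable {G G₁ G₂ : TermGraph.{u}}

theorem IsXYSum.symm (h : G.IsXYSum G₁ G₂) : G.IsXYSum G₂ G₁ := by
  obtain ⟨f₁, f₂, hx₁, hy₁, hx₂, hy₂, hU, hI, hG⟩ := h
  exact ⟨f₂, f₁, hx₂, hy₂, hx₁, hy₁, by rw [Set.union_comm, hU], by rw [Set.inter_comm, hI],
    by rw [hG, sup_comm]⟩

theorem plus_adj_terminals (G : TermGraph.{u}) : G.plus.Adj G.x G.y :=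
  Or.inr ((edge_adj ..).2 ⟨Or.inl ⟨rfl, rfl⟩, G.x_ne_y⟩)

theorem map_plus {W : Type u} (G : TermGraph.{u}) (f : G.V ↪ W) :
    G.plus.map f = G.graph.map f ⊔ edge (f G.x) (f G.y) := by
  ext u v
  simp only [plus, SimpleGraph.map_adj, sup_adj, edge_adj]
  constructor
  · rintro ⟨a, b, h | ⟨h, hne⟩, rfl, rfl⟩
    · exact Or.inl ⟨a, b, h, rfl, rfl⟩
    · refine Or.inr ⟨?_, fun e => hne (f.injective e)⟩
      rcases h with ⟨rfl, rfl⟩ | ⟨rfl, rfl⟩ <;> simp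
  · rintro (⟨a, b, h, rfl, rfl⟩ | ⟨⟨rfl, rfl⟩ | ⟨rfl, rfl⟩, -⟩)
    · exact ⟨a, b, Or.inl h, rfl, rfl⟩
    · exact ⟨_, _, Or.inr ⟨Or.inl ⟨rfl, rfl⟩, G.x_ne_y⟩, rfl, rfl⟩
    · exact ⟨_, _, Or.inr ⟨Or.inr ⟨rfl, rfl⟩, G.x_ne_y.symm⟩, rfl, rfl⟩

/-- The parameter `ĝ⁺` is additive over `xy`-sums. -/
theorem IsXYSum.eulerGenusPlus_eq (h : G.IsXYSum G₁ G₂) :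
    G.eulerGenusPlus = G₁.eulerGenusPlus + G₂.eulerGenusPlus := by
  obtain ⟨f₁, f₂, hx₁, hy₁, hx₂, hy₂, hU, hI, hG⟩ := h
  have := G.finite
  have := G₁.finite
  have := G₂.finite
  have h₁ := G₁.map_plus f₁
  have h₂ := G₂.map_plus f₂
  rw [hx₁, hy₁] at h₁
  rw [hx₂, hy₂] at h₂
  have hA : G.plus.IsEdgeAmalgam (G₁.plus.map f₁) (G₂.plus.map f₂) G.x G.y := by
    refine ⟨?_, ?_, ?_, ?_⟩
    · rw [h₁, h₂, ← sup_sup_distrib_right, ← hG]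
      rfl
    · rw [← hx₁, ← hy₁]
      exact (map_adj_apply (f := f₁)).2 G₁.plus_adj_terminals
    · rw [← hx₂, ← hy₂]
      exact (map_adj_apply (f := f₂)).2 G₂.plus_adj_terminals
    · intro z u v hu hv
      obtain ⟨a, -, -, ha, -⟩ := (SimpleGraph.map_adj ..).1 hu
      obtain ⟨b, -, -, hb, -⟩ := (SimpleGraph.map_adj ..).1 hv
      have : z ∈ Set.range f₁ ∩ Set.range f₂ := ⟨⟨a, ha⟩, ⟨b, hb⟩⟩
      rwa [hI] at this
  rw [eulerGenusPlus, hA.eulerGenus_eq_add, eulerGenus_map, eulerGenus_map]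
  rfl

theorem IsXYSum.noTerminalEdge_iff (h : G.IsXYSum G₁ G₂) :
    G ∈ noTerminalEdge ↔ G₁ ∈ noTerminalEdge ∧ G₂ ∈ noTerminalEdge := by
  obtain ⟨f₁, f₂, hx₁, hy₁, hx₂, hy₂, -, -, hG⟩ := h
  have h₁ := map_adj_apply (G := G₁.graph) (f := f₁) (a := G₁.x) (b := G₁.y)
  have h₂ := map_adj_apply (G := G₂.graph) (f := f₂) (a := G₂.x) (b := G₂.y)
  rw [hx₁, hy₁] at h₁
  rw [hx₂, hy₂] at h₂
  simp only [noTerminalEdge, Set.mem_ofPred_eq]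
  rw [hG, sup_adj, h₁, h₂, not_or]

/-- The embeddings `f₁` and `f₂` exhibit `G` as the `xy`-sum of `G₁` and `G₂`. -/
def IsXYGluing (f₁ : G₁.V ↪ G.V) (f₂ : G₂.V ↪ G.V) : Prop :=
  f₁ G₁.x = G.x ∧ f₁ G₁.y = G.y ∧ f₂ G₂.x = G.x ∧ f₂ G₂.y = G.y ∧
    Set.range f₁ ∪ Set.range f₂ = Set.univ ∧
    Set.range f₁ ∩ Set.range f₂ = {G.x, G.y} ∧
    G.graph = G₁.graph.map f₁ ⊔ G₂.graph.map f₂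

namespace IsXYGluing

variable {f₁ : G₁.V ↪ G.V} {f₂ : G₂.V ↪ G.V}

theorem symm (h : IsXYGluing f₁ f₂) : IsXYGluing f₂ f₁ := by
  obtain ⟨hx₁, hy₁, hx₂, hy₂, hU, hI, hG⟩ := h
  exact ⟨hx₂, hy₂, hx₁, hy₁, by rw [Set.union_comm, hU], by rw [Set.inter_comm, hI],
    by rw [hG, sup_comm]⟩

theorem eq_or_eq (h : IsXYGluing f₁ f₂) {z : G.V} (h₁ : z ∈ Set.range f₁)
    (h₂ : z ∈ Set.range f₂) : z = G.x ∨ z = G.y := by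
  have : z ∈ Set.range f₁ ∩ Set.range f₂ := ⟨h₁, h₂⟩
  rwa [h.2.2.2.2.2.1] at this

theorem graph_eq (h : IsXYGluing f₁ f₂) : G.graph = G₁.graph.map f₁ ⊔ G₂.graph.map f₂ :=
  h.2.2.2.2.2.2

theorem map_mem_edgeSet (h : IsXYGluing f₁ f₂) {e : Sym2 G₁.V} (he : e ∈ G₁.graph.edgeSet) :
    e.map f₁ ∈ G.graph.edgeSet := by
  rw [h.graph_eq, edgeSet_sup, edgeSet_map]
  exact Or.inl ⟨e, he, rfl⟩

theorem exists_edge (h : IsXYGluing f₁ f₂) {e : Sym2 G.V} (he : e ∈ G.graph.edgeSet) :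
    (∃ e₁ ∈ G₁.graph.edgeSet, e₁.map f₁ = e) ∨ ∃ e₂ ∈ G₂.graph.edgeSet, e₂.map f₂ = e := by
  rw [h.graph_eq, edgeSet_sup, edgeSet_map, edgeSet_map] at he
  exact he

theorem map_ne_iff (h : IsXYGluing f₁ f₂) {e : Sym2 G₁.V} :
    e.map f₁ ≠ s(G.x, G.y) ↔ e ≠ s(G₁.x, G₁.y) := by
  rw [← h.1, ← h.2.1, ← Sym2.map_mk]
  exact (Sym2.map.injective f₁.injective).ne_iff

/-- Deletion of an edge of the first part commutes with the `xy`-sum. -/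
theorem deleteEdge (h : IsXYGluing f₁ f₂) (hno : G ∈ noTerminalEdge) {e : Sym2 G₁.V}
    (he : e ∈ G₁.graph.edgeSet) : (G.deleteEdge (e.map f₁)).IsXYSum (G₁.deleteEdge e) G₂ := by
  have hmeet := @h.eq_or_eq
  have hmemG := h.map_mem_edgeSet he
  obtain ⟨hx₁, hy₁, hx₂, hy₂, hU, hI, hG⟩ := h
  have hmem : e.map f₁ ∈ (G₁.graph.map f₁).edgeSet := by
    rw [edgeSet_map]
    exact ⟨e, he, rfl⟩
  refine ⟨f₁, f₂, hx₁, hy₁, hx₂, hy₂, hU, hI, ?_⟩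
  change G.graph.deleteEdges {e.map f₁} = (G₁.graph.deleteEdges {e}).map f₁ ⊔ G₂.graph.map f₂
  rw [hG, deleteEdges_sup]
  congr 1
  · ext u v
    simp only [deleteEdges_adj, SimpleGraph.map_adj, Set.mem_singleton_iff]
    constructor
    · rintro ⟨⟨a, b, hab, rfl, rfl⟩, hne⟩
      exact ⟨a, b, ⟨hab, fun h => hne (by rw [← h, Sym2.map_mk])⟩, rfl, rfl⟩
    · rintro ⟨a, b, ⟨hab, hne⟩, rfl, rfl⟩
      refine ⟨⟨a, b, hab, rfl, rfl⟩, fun h => hne (Sym2.map.injective f₁.injective ?_)⟩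
      rw [← h, Sym2.map_mk]
  -- An edge that lies in both copies has both ends in {x, y}, but `xy` is not an edge.
  · refine deleteEdges_eq_self.2 (Set.disjoint_singleton_right.2 fun hmem₂ => hno ?_)
    induction hc : e.map f₁ with | _ u v
    rw [hc] at hmem hmem₂
    obtain ⟨a, b, hab, rfl, rfl⟩ := (SimpleGraph.map_adj ..).1 (mem_edgeSet _ |>.1 hmem)
    obtain ⟨a', b', hab', ha, hb⟩ := (SimpleGraph.map_adj ..).1 (mem_edgeSet _ |>.1 hmem₂)
    have hadj : G.graph.Adj (f₁ a) (f₁ b) := by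
      rw [hG]
      exact Or.inl (mem_edgeSet _ |>.1 hmem)
    rcases hmeet ⟨a, rfl⟩ ⟨a', ha⟩ with h₁ | h₁ <;> rcases hmeet ⟨b, rfl⟩ ⟨b', hb⟩ with h₂ | h₂ <;>
      rw [h₁, h₂] at hadj
    · exact (hadj.ne rfl).elim
    · exact hadj
    · exact hadj.symm
    · exact (hadj.ne rfl).elim

/-- Contraction of an edge of the first part commutes with the `xy`-sum. -/
theorem contractEdge (h : IsXYGluing f₁ f₂) {e : Sym2 G₁.V} (he : e ≠ s(G₁.x, G₁.y)) :
    (G.contractEdge (e.map f₁) (h.map_ne_iff.2 he)).IsXYSum (G₁.contractEdge e he) G₂ := by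
  have hmeet := @h.eq_or_eq
  have he' := h.map_ne_iff.2 he
  obtain ⟨hx₁, hy₁, hx₂, hy₂, hU, hI, hG⟩ := h
  let mk := Quotient.mk (contractSetoid (e.map f₁))
  have hmem : ∀ {a}, f₁ a ∈ e.map f₁ ↔ a ∈ e := by
    intro a
    rw [Sym2.mem_map]
    exact ⟨fun ⟨b, hb, hba⟩ => f₁.injective hba ▸ hb, fun h => ⟨a, h, rfl⟩⟩
  let g₁ : Quotient (contractSetoid e) → Quotient (contractSetoid (e.map f₁)) :=
    Quotient.map f₁ fun a b hab =>
      hab.imp (congrArg f₁) fun h => ⟨hmem.2 h.1, hmem.2 h.2⟩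
  have hg₁ : Function.Injective g₁ := by
    rintro ⟨a⟩ ⟨b⟩ hab
    refine Quotient.sound ?_
    rcases Quotient.exact hab with h | ⟨h, h'⟩
    · exact Or.inl (f₁.injective h)
    · exact Or.inr ⟨hmem.1 h, hmem.1 h'⟩
  have hran : ∀ {z}, z ∈ e.map f₁ → z ∈ Set.range f₁ := by
    intro z hz
    obtain ⟨a, -, ha⟩ := Sym2.mem_map.1 hz
    exact ⟨a, ha⟩
  -- Only the ends of the contracted edge are identified. If both of them belonged to the second
  -- part, they would be the two terminals, which is excluded.
  have hg₂ : Function.Injective (mk ∘ f₂) := by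
    intro a b hab
    by_contra hne
    rcases Quotient.exact hab with h | ⟨h, h'⟩
    · exact hne (f₂.injective h)
    · have hne' : f₂ a ≠ f₂ b := fun h => hne (f₂.injective h)
      have heq := (Sym2.mem_and_mem_iff hne').1 ⟨h, h'⟩
      rcases hmeet (hran h) ⟨a, rfl⟩ with h₁ | h₁ <;>
        rcases hmeet (hran h') ⟨b, rfl⟩ with h₂ | h₂
      · exact hne' (h₁.trans h₂.symm)
      · exact he' (by rw [heq, h₁, h₂])
      · exact he' (by rw [heq, h₁, h₂, Sym2.eq_swap])
      · exact hne' (h₁.trans h₂.symm)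
  refine ⟨⟨g₁, hg₁⟩, ⟨mk ∘ f₂, hg₂⟩, congrArg mk hx₁, congrArg mk hy₁, congrArg mk hx₂,
    congrArg mk hy₂, ?_, ?_, ?_⟩
  · refine Set.eq_univ_of_forall ?_
    rintro ⟨z⟩
    have hz : z ∈ Set.range f₁ ∪ Set.range f₂ := hU ▸ Set.mem_univ z
    rcases hz with ⟨a, rfl⟩ | ⟨a, rfl⟩
    · exact Or.inl ⟨Quotient.mk _ a, rfl⟩
    · exact Or.inr ⟨a, rfl⟩
  · refine Set.Subset.antisymm ?_ ?_
    · rintro z ⟨⟨⟨a⟩, rfl⟩, ⟨b, hb⟩⟩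
      have hb' : mk (f₂ b) = mk (f₁ a) := hb
      have hfb : f₂ b ∈ Set.range f₁ := by
        rcases Quotient.exact hb' with h | ⟨h, -⟩
        · exact ⟨a, h.symm⟩
        · exact hran h
      change mk (f₁ a) = mk G.x ∨ mk (f₁ a) = mk G.y
      rw [← hb']
      exact (hmeet hfb ⟨b, rfl⟩).imp (congrArg mk) (congrArg mk)
    · rintro z (rfl | rfl)
      · exact ⟨⟨Quotient.mk _ G₁.x, congrArg mk hx₁⟩, ⟨G₂.x, congrArg mk hx₂⟩⟩
      · exact ⟨⟨Quotient.mk _ G₁.y, congrArg mk hy₁⟩, ⟨G₂.y, congrArg mk hy₂⟩⟩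
  · change G.graph.map mk = (G₁.graph.map (Quotient.mk (contractSetoid e))).map g₁ ⊔
      G₂.graph.map (mk ∘ f₂)
    rw [SimpleGraph.map_map, hG]
    ext u v
    simp only [SimpleGraph.map_adj', sup_adj, Function.comp_apply]
    constructor
    · rintro ⟨hne, _, _, ⟨-, a, b, hab, rfl, rfl⟩ | ⟨-, a, b, hab, rfl, rfl⟩, rfl, rfl⟩
      · exact Or.inl ⟨hne, a, b, hab, rfl, rfl⟩
      · exact Or.inr ⟨hne, a, b, hab, rfl, rfl⟩
    · rintro (⟨hne, a, b, hab, rfl, rfl⟩ | ⟨hne, a, b, hab, rfl, rfl⟩)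
      · exact ⟨hne, f₁ a, f₁ b, Or.inl ⟨f₁.injective.ne hab.ne, a, b, hab, rfl, rfl⟩, rfl, rfl⟩
      · exact ⟨hne, f₂ a, f₂ b, Or.inr ⟨f₂.injective.ne hab.ne, a, b, hab, rfl, rfl⟩, rfl, rfl⟩

/-- Every minor-operation on the first part extends to an operation on the `xy`-sum. -/
theorem exists_extend_op (h : IsXYGluing f₁ f₂) (hno : G ∈ noTerminalEdge) (μ : G₁.MinorOp) :
    ∃ ν : G.MinorOp, (G.applyOp ν).IsXYSum (G₁.applyOp μ) G₂ := by
  rcases μ with ⟨e, he⟩ | ⟨e, he, hne⟩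
  · exact ⟨.delete _ (h.map_mem_edgeSet he), h.deleteEdge hno he⟩
  · exact ⟨.contract _ (h.map_mem_edgeSet he) (h.map_ne_iff.2 hne), h.contractEdge hne⟩

/-- Every minor-operation on an `xy`-sum comes from an operation on one of the two parts. -/
theorem exists_restrict_op (h : IsXYGluing f₁ f₂) (hno : G ∈ noTerminalEdge) (ν : G.MinorOp) :
    (∃ μ : G₁.MinorOp, (G.applyOp ν).IsXYSum (G₁.applyOp μ) G₂) ∨
      ∃ μ : G₂.MinorOp, (G.applyOp ν).IsXYSum (G₂.applyOp μ) G₁ := by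
  rcases ν with ⟨e, hmem⟩ | ⟨e, hmem, hne⟩
  · rcases h.exists_edge hmem with ⟨e, he, rfl⟩ | ⟨e, he, rfl⟩
    · exact Or.inl ⟨.delete e he, h.deleteEdge hno he⟩
    · exact Or.inr ⟨.delete e he, h.symm.deleteEdge hno he⟩
  · rcases h.exists_edge hmem with ⟨e, he, rfl⟩ | ⟨e, he, rfl⟩
    · exact Or.inl ⟨.contract e he (h.map_ne_iff.1 hne), h.contractEdge (h.map_ne_iff.1 hne)⟩
    · exact Or.inr ⟨.contract e he (h.symm.map_ne_iff.1 hne),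
        h.symm.contractEdge (h.symm.map_ne_iff.1 hne)⟩

end IsXYGluing

/-- By additivity, the unchanged contribution of `G₂` cancels when an operation on `G₁` is carried
out in `G`. -/
theorem IsXYSum.isCritical_left (h : G.IsXYSum G₁ G₂) (hno : G ∈ noTerminalEdge)
    (hc : IsCritical eulerGenusPlus G) : IsCritical eulerGenusPlus G₁ := by
  have he := h.eulerGenusPlus_eq
  obtain ⟨f₁, f₂, h⟩ := h
  intro μ
  obtain ⟨ν, hν⟩ := IsXYGluing.exists_extend_op h hno μ
  have h₁ := hν.eulerGenusPlus_eq
  have h₂ := hc ν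
  omega

theorem IsXYSum.isCritical (h : G.IsXYSum G₁ G₂) (hno : G ∈ noTerminalEdge)
    (hc₁ : IsCritical eulerGenusPlus G₁) (hc₂ : IsCritical eulerGenusPlus G₂) :
    IsCritical eulerGenusPlus G := by
  have he := h.eulerGenusPlus_eq
  obtain ⟨f₁, f₂, h⟩ := h
  intro ν
  rcases IsXYGluing.exists_restrict_op h hno ν with ⟨μ, hμ⟩ | ⟨μ, hμ⟩
  · have h₁ := hμ.eulerGenusPlus_eq
    have h₂ := hc₁ μ
    omega
  · have h₁ := hμ.eulerGenusPlus_eq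
    have h₂ := hc₂ μ
    omega

/-- Connectedness provides an edge at `x`, and deleting it has to lower a natural number. -/
theorem eulerGenusPlus_pos_of_isCritical (hconn : G.graph.Connected)
    (hc : IsCritical eulerGenusPlus G) : 0 < G.eulerGenusPlus := by
  have : Nontrivial G.V := ⟨_, _, G.x_ne_y⟩
  obtain ⟨z, hz⟩ := hconn.preconnected.exists_adj_of_nontrivial G.x
  exact Nat.zero_lt_of_lt (hc (.delete s(G.x, z) hz))

/-- The subgraph induced on a set of vertices that contains the terminals. -/
def restrict (G : TermGraph.{u}) (S : Set G.V) (hx : G.x ∈ S) (hy : G.y ∈ S) : TermGraph.{u} where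
  V := S
  finite := haveI := G.finite; inferInstance
  graph := G.graph.induce S
  x := ⟨G.x, hx⟩
  y := ⟨G.y, hy⟩
  x_ne_y h := G.x_ne_y (congrArg Subtype.val h)

theorem isXYSum_restrict {S T : Set G.V} {hxS : G.x ∈ S} {hyS : G.y ∈ S} {hxT : G.x ∈ T}
    {hyT : G.y ∈ T} (hU : S ∪ T = Set.univ) (hI : S ∩ T = {G.x, G.y})
    (hadj : ∀ u v, G.graph.Adj u v → (u ∈ S ∧ v ∈ S) ∨ (u ∈ T ∧ v ∈ T)) :
    G.IsXYSum (G.restrict S hxS hyS) (G.restrict T hxT hyT) := by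
  refine ⟨Function.Embedding.subtype S, Function.Embedding.subtype T, rfl, rfl, rfl, rfl, ?_, ?_,
    ?_⟩
  · exact (congrArg₂ _ Subtype.range_coe Subtype.range_coe).trans hU
  · exact (congrArg₂ _ Subtype.range_coe Subtype.range_coe).trans hI
  · ext u v
    simp only [sup_adj]
    constructor
    · intro h
      rcases hadj u v h with ⟨hu, hv⟩ | ⟨hu, hv⟩
      · exact Or.inl ((SimpleGraph.map_adj ..).2 ⟨⟨u, hu⟩, ⟨v, hv⟩, h, rfl, rfl⟩)
      · exact Or.inr ((SimpleGraph.map_adj ..).2 ⟨⟨u, hu⟩, ⟨v, hv⟩, h, rfl, rfl⟩)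
    · rintro (h | h) <;> obtain ⟨a, b, hab, rfl, rfl⟩ := (SimpleGraph.map_adj ..).1 h <;>
        exact hab

end TermGraph

/-! ### Connectivity of the sides of a 2-vertex-cut -/

namespace SimpleGraph

variable {V : Type u} {G : SimpleGraph V} {a b : V} {S : Set V}

/-- A walk in `G - b` from a vertex of `S` to `a` cannot leave `S` before it meets `a`, if only
`a` and `b` have neighbours outside `S`. -/
theorem reachable_induce_of_walk (haS : a ∈ S)
    (hS : ∀ z ∈ S, z ≠ a → z ≠ b → ∀ w, G.Adj z w → w ∈ S) {z t : ({b}ᶜ : Set V)}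
    (p : (G.induce {b}ᶜ).Walk z t) (ht : t.1 = a) (hz : z.1 ∈ S) :
    (G.induce S).Reachable ⟨z.1, hz⟩ ⟨a, haS⟩ := by
  induction p with
  | nil =>
    subst ht
    exact Reachable.refl _
  | @cons z w t h p ih =>
    by_cases hza : z.1 = a
    · subst hza
      exact Reachable.refl _
    · have hw := hS z.1 hz hza z.2 w.1 h
      exact (Adj.reachable (G := G.induce S) (u := ⟨z.1, hz⟩) (v := ⟨w.1, hw⟩) h).trans (ih ht hw)

/-- Paths in `G - b` link every vertex of `S` other than `b` to `a` inside `S`, and paths in `G - a`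
do the same for `b`. A third vertex of `S` is linked to both, and hence links `a` to `b`. -/
theorem IsTwoConnected.connected_induce (hG : G.IsTwoConnected) (hab : a ≠ b) (ha : a ∈ S)
    (hb : b ∈ S) (hS : ∀ z ∈ S, z ≠ a → z ≠ b → ∀ w, G.Adj z w → w ∈ S)
    (hne : ∃ z ∈ S, z ≠ a ∧ z ≠ b) : (G.induce S).Connected := by
  have hra : ∀ z (hz : z ∈ S), z ≠ b → (G.induce S).Reachable ⟨z, hz⟩ ⟨a, ha⟩ := by
    intro z hz hzb
    obtain ⟨p⟩ := (hG.2.2 b).preconnected ⟨z, hzb⟩ ⟨a, hab⟩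
    exact reachable_induce_of_walk ha hS p rfl hz
  have hrb : ∀ z (hz : z ∈ S), z ≠ a → (G.induce S).Reachable ⟨z, hz⟩ ⟨b, hb⟩ := by
    intro z hz hza
    obtain ⟨p⟩ := (hG.2.2 a).preconnected ⟨z, hza⟩ ⟨b, hab.symm⟩
    exact reachable_induce_of_walk hb (fun z hz h h' => hS z hz h' h) p rfl hz
  obtain ⟨c, hc, hca, hcb⟩ := hne
  have hr : ∀ z : S, (G.induce S).Reachable z ⟨a, ha⟩ := by
    rintro ⟨z, hz⟩
    by_cases hzb : z = b
    · subst hzb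
      exact (hrb c hc hca).symm.trans (hra c hc hcb)
    · exact hra z hz hzb
  have : Nonempty S := ⟨⟨a, ha⟩⟩
  exact Connected.mk fun z w => (hr z).trans (hr w).symm

/-- The two sides of a vertex-cut. -/
theorem IsVertexCut.exists_side (h : G.IsVertexCut S) :
    ∃ C : Set V, Disjoint C S ∧ C.Nonempty ∧ (∃ v, v ∉ C ∧ v ∉ S) ∧
      ∀ u ∈ C, ∀ v, G.Adj u v → v ∈ C ∨ v ∈ S := by
  simp only [IsVertexCut, Preconnected, not_forall] at h
  obtain ⟨u, v, huv⟩ := h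
  refine ⟨{z | ∃ hz : z ∈ Sᶜ, (G.induce Sᶜ).Reachable u ⟨z, hz⟩}, ?_, ⟨u.1, u.2, Reachable.refl _⟩,
    ⟨v.1, fun ⟨_, hv⟩ => huv hv, v.2⟩, ?_⟩
  · exact Set.disjoint_left.2 fun z ⟨hz, _⟩ => hz
  · rintro z ⟨hz, hr⟩ w hzw
    by_cases hw : w ∈ S
    · exact Or.inr hw
    · exact Or.inl ⟨hw, hr.trans
        (Adj.reachable (G := G.induce Sᶜ) (u := ⟨z, hz⟩) (v := ⟨w, hw⟩) hzw)⟩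

end SimpleGraph

/-! ### Splitting at the terminals -/

namespace TermGraph

variable {G : TermGraph.{u}}

/-- One part is induced on a side `C` of the cut together with the terminals, the other on the
complement of `C`. No edge leaves `C` except to a terminal, so every edge lies in a part. -/
theorem exists_isXYSum_of_isVertexCut (h2 : G.graph.IsTwoConnected)
    (hcut : G.graph.IsVertexCut {G.x, G.y}) :
    ∃ G₁ G₂ : TermGraph.{u}, G₁.graph.Connected ∧ G₂.graph.Connected ∧ G.IsXYSum G₁ G₂ := by
  obtain ⟨C, hdisj, ⟨c, hc⟩, ⟨d, hdC, hd⟩, hadj⟩ := hcut.exists_side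
  have hne : ∀ {z}, z ∈ C → z ≠ G.x ∧ z ≠ G.y := fun hz =>
    not_or.1 (Set.disjoint_left.1 hdisj hz)
  have hxC : G.x ∉ C := fun h => (hne h).1 rfl
  have hyC : G.y ∉ C := fun h => (hne h).2 rfl
  have hxS : G.x ∈ C ∪ {G.x, G.y} := Or.inr (Or.inl rfl)
  have hyS : G.y ∈ C ∪ {G.x, G.y} := Or.inr (Or.inr rfl)
  refine ⟨G.restrict (C ∪ {G.x, G.y}) hxS hyS,
    G.restrict Cᶜ hxC hyC, ?_, ?_, isXYSum_restrict ?_ ?_ ?_⟩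
  · refine h2.connected_induce G.x_ne_y hxS hyS ?_ ⟨c, Or.inl hc, hne hc⟩
    rintro z (hz | hz) hzx hzy w hw
    · exact hadj z hz w hw
    · exact (hz.elim hzx hzy).elim
  · refine h2.connected_induce G.x_ne_y hxC hyC ?_ ⟨d, hdC, not_or.1 hd⟩
    intro z hz hzx hzy w hw hwC
    exact (hadj w hwC z hw.symm).elim hz fun h => h.elim hzx hzy
  · ext z
    by_cases hz : z ∈ C <;> simp [hz]
  · ext z
    constructor
    · rintro ⟨hz | hz, hz'⟩
      · exact (hz' hz).elim
      · exact hz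
    · exact fun hz => ⟨Or.inr hz, fun h => Set.disjoint_left.1 hdisj h hz⟩
  · intro u v huv
    by_cases hu : u ∈ C
    · exact Or.inl ⟨Or.inl hu, hadj u hu v huv⟩
    · by_cases hv : v ∈ C
      · exact Or.inl ⟨hadj v hv u huv.symm, Or.inl hv⟩
      · exact Or.inr ⟨hu, hv⟩

end TermGraph

theorem mainTheorem7 :
    (∀ G G₁ G₂ : TermGraph.{u},
      G₁.graph.Connected → G₂.graph.Connected →
      G₁ ∈ TermGraph.noTerminalEdge → G₂ ∈ TermGraph.noTerminalEdge →
      G.IsXYSum G₁ G₂ →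
      G₁ ∈ TermGraph.criticalClassNoEdge TermGraph.eulerGenusPlus 0 →
      G₂ ∈ TermGraph.criticalClassNoEdge TermGraph.eulerGenusPlus 1 →
      G ∈ TermGraph.criticalClassNoEdge TermGraph.eulerGenusPlus 2) ∧
    (∀ G : TermGraph.{u},
      G ∈ TermGraph.criticalClassNoEdge TermGraph.eulerGenusPlus 2 →
      G.graph.IsTwoConnected → G.graph.IsVertexCut {G.x, G.y} →
      ∃ G₁ G₂ : TermGraph.{u},
        G₁.graph.Connected ∧ G₂.graph.Connected ∧
        G₁ ∈ TermGraph.noTerminalEdge ∧ G₂ ∈ TermGraph.noTerminalEdge ∧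
        G.IsXYSum G₁ G₂ ∧
        G₁ ∈ TermGraph.criticalClassNoEdge TermGraph.eulerGenusPlus 0 ∧
        G₂ ∈ TermGraph.criticalClassNoEdge TermGraph.eulerGenusPlus 1) := by
  refine ⟨fun G G₁ G₂ _ _ hn₁ hn₂ h h₁ h₂ => ?_, fun G hG h2 hcut => ?_⟩
  · have hno := h.noTerminalEdge_iff.2 ⟨hn₁, hn₂⟩
    refine ⟨⟨h.isCritical hno h₁.1.1 h₂.1.1, ?_⟩, hno⟩
    rw [h.eulerGenusPlus_eq, h₁.1.2, h₂.1.2]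
  · obtain ⟨⟨hcrit, hval⟩, hno⟩ := hG
    obtain ⟨G₁, G₂, hG₁, hG₂, h⟩ := TermGraph.exists_isXYSum_of_isVertexCut h2 hcut
    have hn := h.noTerminalEdge_iff.1 hno
    have hc₁ := h.isCritical_left hno hcrit
    have hc₂ := h.symm.isCritical_left hno hcrit
    have hp₁ := TermGraph.eulerGenusPlus_pos_of_isCritical hG₁ hc₁
    have hp₂ := TermGraph.eulerGenusPlus_pos_of_isCritical hG₂ hc₂
    have he := h.eulerGenusPlus_eq
    -- Two positive values with sum 3 are 1 and 2; the order is corrected by the symmetry of the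
    -- `xy`-sum.
    obtain ⟨e₁, e₂⟩ | ⟨e₁, e₂⟩ : (G₁.eulerGenusPlus = 0 + 1 ∧ G₂.eulerGenusPlus = 1 + 1) ∨
        (G₁.eulerGenusPlus = 1 + 1 ∧ G₂.eulerGenusPlus = 0 + 1) := by omega
    · exact ⟨G₁, G₂, hG₁, hG₂, hn.1, hn.2, h, ⟨⟨hc₁, e₁⟩, hn.1⟩, ⟨⟨hc₂, e₂⟩, hn.2⟩⟩
    · exact ⟨G₂, G₁, hG₂, hG₁, hn.2, hn.1, h.symm, ⟨⟨hc₂, e₂⟩, hn.2⟩, ⟨⟨hc₁, e₁⟩, hn.1⟩⟩
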